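/- **Notation.** Fix $n$. A weight is a bounded function $w:\mathbb R^n\to[0,\infty)$ (no further regularity). Let $$\mathcal C_w=\{f\in C^\infty(\mathbb R^n)\mid \lim_{\|x\|\to\infty}\partial^\alpha f(x)\,w(x)=0\ \text{ for all }\alpha\in\mathbb N^n\},$$ with the locally convex (possibly non-Hausdorff) topology given by the seminorms $p_\alpha(f)=\|\partial^\alpha f\cdot w\|_\infty$, and let $\mathcal C_w'$ be its continuous dual. The order of $T\in\mathcal C_w'$ in $\mathcal C_w'$ is the minimal value of $\max_{\beta\in S}|\beta|$ over all finite sets $S$ of multi-indices for which there is a constant $C$ with $|\langle T,f\rangle|\le C\max_{\beta\in S}p_\beta(f)$ for all $f\in\mathcal C_w$. For an integer $d\ge0$, $\mathcal W_d$ is the set of weights with $\lim_{\|x\|\to\infty}\|x\|^d w(x)=0$, and $\mathcal W_\infty=\bigcap_{d}\mathcal W_d$. A weight $w$ is holomorphic if $w(x)\le C e^{-\epsilon\|x\|}$ for all $x$, for some $C\ge0$ and $\epsilon>0$; then $\tau_w\in(0,\infty]$ denotes the supremum of all such $\epsilon$, and $\mathcal D_w=\{\lambda\in\mathbb C^n\mid\|\operatorname{Im}\lambda\|<\tau_w\}$.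 A weight $w$ is standard quasi-analytic if $\sum_{m=1}^\infty \big(\sup_x|x_j|^m w(x)\big)^{-1/m}=\infty$ for $j=1,\dots,n$. The conventions $0^{-1/m}=\infty$ and $\infty^{-1/m}=0$ are used. For $\lambda\in\mathbb C^n$ let $e_\lambda(x)=\exp(\lambda,x)$, where $(\,\cdot\,,\,\cdot\,)$ is bilinear. The Fourier transform is $\mathcal F(f)(\lambda)=\widehat f(\lambda)=(2\pi)^{-n/2}\int f(x)e^{-i(\lambda,x)}\,dx$ for $f\in\mathcal S(\mathbb R^n)$, and $\langle\mathcal F(S),f\rangle=\langle S,\mathcal F(f)\rangle$ for $S\in\mathcal S'(\mathbb R^n)$. **Theorem 4.7.** Let $d\in\{0,1,2,\dots,\infty\}$, $w\in\mathcal W_d$, $T\in\mathcal C_w'$, and let $N$ be the order of $T$ in $\mathcal C_w'$. Then: 1. $\mathcal S(\mathbb R^n)\subset\mathcal C_w$, and sending $T\in\mathcal C_w'$ to the tempered distribution $f\mapsto\langle T,f\rangle$ $(f\in\mathcal S(\mathbb R^n))$, again denoted $T$, defines an injective linear map $\mathcal C_w'\to\mathcal S'(\mathbb R^n)$. The order of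 $T$ as a distribution is at most $N$. 2. The Fourier transform of the tempered distribution $T$ is a continuous function $\widehat T$, given for $\lambda\in\mathbb R^n$ by $$\widehat T(\lambda)=(2\pi)^{-n/2}\langle T,e_{-i\lambda}\rangle\qquad(\ast)$$ (in particular $e_{-i\lambda}\in\mathcal C_w$). The map $\mathcal C_w'\to C(\mathbb R^n)$, $T\mapsto\widehat T$, is injective. 3. $\widehat T$ is of class $C^d$ on $\mathbb R^n$, and for $\lambda\in\mathbb R^n$ and $|\alpha|\le d$ one has $x^\alpha e_{-i\lambda}\in\mathcal C_w$ and $$\partial^\alpha\widehat T(\lambda)=(2\pi)^{-n/2}(-i)^{|\alpha|}\langle T,x^\alpha e_{-i\lambda}\rangle.\qquad(\ast\ast)$$ 4. There is a constant $C>0$ such that, for all $\lambda\in\mathbb R^n$ and all $\alpha\in\mathbb N^n$ with $|\alpha|\le d$, $$|\partial^\alpha\widehat T(\lambda)|\le C(1+\|\lambda\|)^N\prod_{j=1}^n(1+\alpha_j)^N\,\Big\|\prod_{j=1}^n(1+|x_j|^{\alpha_j})\cdot w(x)\Big\|_\infty .$$ 5. If $w$ is holomorphic, then $(\ast)$ defines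 a holomorphic extension of $\widehat T$ to $\mathcal D_w$, again denoted $\widehat T$. Its complex derivatives on $\mathcal D_w$ are given by $(\ast\ast)$ for all $\alpha\in\mathbb N^n$, and there is a constant $C>0$ such that, for all $\lambda\in\mathcal D_w$ and all $\alpha\in\mathbb N^n$, $$|\partial^\alpha\widehat T(\lambda)|\le C(1+\|\lambda\|)^N\prod_{j=1}^n(1+\alpha_j)^N\,\Big\|\prod_{j=1}^n(1+|x_j|^{\alpha_j})\cdot e^{(\operatorname{Im}\lambda,x)}\cdot w(x)\Big\|_\infty .$$ 6. If $w$ is standard quasi-analytic, then $\widehat T$ is of class $C^\infty$, and there exist a constant $C>0$ and sequences $\{\widetilde M(j,m)\}_{m=0}^\infty$ of nonnegative real numbers $(j=1,\dots,n)$ such that $\sum_{m=1}^\infty\widetilde M(j,m)^{-1/m}=\infty$ for $j=1,\dots,n$ and, for all $\lambda\in\mathbb R^n$ and all $\alpha\in\mathbb N^n$, $$|\partial^\alpha\widehat T(\lambda)|\le C(1+\|\lambda\|)^N\prod_{j=1}^n\widetilde M(j,\alpha_j).$$ Moreover, if $w$ is standard quasi-analytic and there is $\lambda_0\in\mathbb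 R^n$ with $\partial^\alpha\widehat T(\lambda_0)=0$ for all $\alpha\in\mathbb N^n$, then $T=0$. -/

import Mathlib

open scoped SchwartzMap ENNReal NNReal ContDiff Topology FourierTransform

namespace WeightedFourier

/-- `ℝⁿ` with the Euclidean norm. -/
abbrev RSpace (n : ℕ) : Type := EuclideanSpace ℝ (Fin n)

/-- `ℂⁿ` with the Hermitian norm. -/
abbrev CSpace (n : ℕ) : Type := EuclideanSpace ℂ (Fin n)

/-- Multi-indices with `n` entries. -/
abbrev MultiIndex (n : ℕ) : Type := Fin n → ℕ

/-- The order `|α| = α₁ + ⋯ + αₙ` of a multi-index. -/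
def order {n : ℕ} (α : MultiIndex n) : ℕ := ∑ j, α j

/-! ### Partial derivatives -/

/-- The first-order partial derivative `∂f/∂x_j` of a function on `𝕜ⁿ`
(a real derivative for `𝕜 = ℝ`, a complex derivative for `𝕜 = ℂ`). -/
noncomputable def partialD (𝕜 : Type) [RCLike 𝕜] [NormedSpace 𝕜 ℂ] {n : ℕ} (j : Fin n)
    (f : EuclideanSpace 𝕜 (Fin n) → ℂ) : EuclideanSpace 𝕜 (Fin n) → ℂ :=
  fun x => lineDeriv 𝕜 f x (EuclideanSpace.single j (1 : 𝕜))

/-- The iterated partial derivative `∂^α f = ∂₁^{α₁} ⋯ ∂ₙ^{αₙ} f`. -/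
noncomputable def multiD (𝕜 : Type) [RCLike 𝕜] [NormedSpace 𝕜 ℂ] {n : ℕ} (α : MultiIndex n)
    (f : EuclideanSpace 𝕜 (Fin n) → ℂ) : EuclideanSpace 𝕜 (Fin n) → ℂ :=
  (List.finRange n).foldr (fun j g => (partialD 𝕜 j)^[α j] g) f

section Lemmas

variable {n : ℕ}

theorem partialD_smooth (j : Fin n) {f : RSpace n → ℂ} (hf : ContDiff ℝ ∞ f) :
    ContDiff ℝ ∞ (partialD ℝ j f) := by
  have h : partialD ℝ j f = fun x => fderiv ℝ f x (EuclideanSpace.single j (1 : ℝ)) := by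
    funext x
    exact ((hf.differentiable (by simp)) x).lineDeriv_eq_fderiv
  rw [h]
  exact (hf.fderiv_right (m := ∞) (by simp)).clm_apply contDiff_const

theorem partialD_add (j : Fin n) {f g : RSpace n → ℂ} (hf : ContDiff ℝ ∞ f)
    (hg : ContDiff ℝ ∞ g) : partialD ℝ j (f + g) = partialD ℝ j f + partialD ℝ j g := by
  funext x
  have h1 := hf.differentiable (by simp) x
  have h2 := hg.differentiable (by simp) x
  simp only [partialD, Pi.add_apply]
  rw [(h1.add h2).lineDeriv_eq_fderiv, h1.lineDeriv_eq_fderiv, h2.lineDeriv_eq_fderiv,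
    fderiv_add h1 h2]
  rfl

theorem partialD_smul (j : Fin n) (c : ℂ) {f : RSpace n → ℂ} (hf : ContDiff ℝ ∞ f) :
    partialD ℝ j (c • f) = c • partialD ℝ j f := by
  funext x
  have h1 := hf.differentiable (by simp) x
  simp only [partialD, Pi.smul_apply]
  rw [(h1.const_smul c).lineDeriv_eq_fderiv, h1.lineDeriv_eq_fderiv, fderiv_const_smul h1]
  rfl

theorem iterate_aux (j : Fin n) (k : ℕ) :
    (∀ f : RSpace n → ℂ, ContDiff ℝ ∞ f → ContDiff ℝ ∞ ((partialD ℝ j)^[k] f)) ∧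
    (∀ f g : RSpace n → ℂ, ContDiff ℝ ∞ f → ContDiff ℝ ∞ g →
      (partialD ℝ j)^[k] (f + g) = (partialD ℝ j)^[k] f + (partialD ℝ j)^[k] g) ∧
    (∀ (c : ℂ) (f : RSpace n → ℂ), ContDiff ℝ ∞ f →
      (partialD ℝ j)^[k] (c • f) = c • (partialD ℝ j)^[k] f) := by
  induction k with
  | zero => simp
  | succ k ih =>
    obtain ⟨h1, h2, h3⟩ := ih
    simp only [Function.iterate_succ_apply']
    refine ⟨fun f hf => partialD_smooth j (h1 f hf), fun f g hf hg => ?_, fun c f hf => ?_⟩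
    · rw [h2 f g hf hg, partialD_add j (h1 f hf) (h1 g hg)]
    · rw [h3 c f hf, partialD_smul j c (h1 f hf)]

theorem multiD_aux (α : MultiIndex n) :
    (∀ f : RSpace n → ℂ, ContDiff ℝ ∞ f → ContDiff ℝ ∞ (multiD ℝ α f)) ∧
    (∀ f g : RSpace n → ℂ, ContDiff ℝ ∞ f → ContDiff ℝ ∞ g →
      multiD ℝ α (f + g) = multiD ℝ α f + multiD ℝ α g) ∧
    (∀ (c : ℂ) (f : RSpace n → ℂ), ContDiff ℝ ∞ f →
      multiD ℝ α (c • f) = c • multiD ℝ α f) := by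
  unfold multiD
  induction List.finRange n with
  | nil => simp
  | cons j l ih =>
    obtain ⟨h1, h2, h3⟩ := ih
    obtain ⟨k1, k2, k3⟩ := iterate_aux j (α j)
    simp only [List.foldr_cons]
    refine ⟨fun f hf => k1 _ (h1 f hf), fun f g hf hg => ?_, fun c f hf => ?_⟩
    · rw [h2 f g hf hg, k2 _ _ (h1 f hf) (h1 g hg)]
    · rw [h3 c f hf, k3 _ _ (h1 f hf)]

end Lemmas

/-! ### Weights -/

/-- A weight on `ℝⁿ`: an arbitrary bounded function `ℝⁿ → [0, ∞)`. -/
structure Weight (n : ℕ) where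
  toFun : RSpace n → ℝ
  nonneg : ∀ x, 0 ≤ toFun x
  bounded : ∃ B, ∀ x, toFun x ≤ B

instance {n : ℕ} : CoeFun (Weight n) (fun _ => RSpace n → ℝ) := ⟨Weight.toFun⟩

/-- The supremum norm, with values in `[0, ∞]`. -/
noncomputable def supNorm {X V : Type} [NormedAddCommGroup V] (g : X → V) : ℝ≥0∞ :=
  ⨆ x, ‖g x‖ₑ

namespace Weight

variable {n : ℕ}

/-- `‖x‖^k w(x) → 0` as `‖x‖ → ∞`. -/
def Decays (w : Weight n) (k : ℕ) : Prop :=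
  Filter.Tendsto (fun x : RSpace n => ‖x‖ ^ k * w x) (Bornology.cobounded (RSpace n)) (𝓝 0)

/-- The class `𝒲_d` for `d ∈ {0, 1, 2, …, ∞}`, where `𝒲_∞ = ⋂_d 𝒲_d`. -/
def InClass (w : Weight n) : ℕ∞ → Prop
  | some d => w.Decays d
  | none => ∀ d : ℕ, w.Decays d

/-- `w(x) ≤ C exp(-ε‖x‖)` for all `x` and some `C ≥ 0`. -/
def ExpBound (w : Weight n) (ε : ℝ) : Prop :=
  ∃ C : ℝ, 0 ≤ C ∧ ∀ x, w x ≤ C * Real.exp (-ε * ‖x‖)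

/-- Holomorphic weights. -/
def IsHolomorphic (w : Weight n) : Prop := ∃ ε : ℝ, 0 < ε ∧ w.ExpBound ε

/-- `τ_w ∈ (0, ∞]`, the supremum of all `ε > 0` with `w(x) ≤ C_ε exp(-ε‖x‖)`. -/
noncomputable def tau (w : Weight n) : ℝ≥0∞ :=
  ⨆ ε ∈ {ε : ℝ | 0 < ε ∧ w.ExpBound ε}, ENNReal.ofReal ε

/-- `M_w(v, m) = sup_x |(v, x)|^m w(x) ∈ [0, ∞]`. -/
noncomputable def moment (w : Weight n) (v : RSpace n) (m : ℕ) : ℝ≥0∞ :=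
  supNorm (fun x : RSpace n => |inner ℝ v x| ^ m * w x)

end Weight

/-- Divergence of `∑_{m ≥ 1} a(m)^{-1/m}` for a sequence in `[0, ∞]`, with the conventions
`0^{-1/m} = ∞` and `∞^{-1/m} = 0`. -/
def RootSeriesDiverges (a : ℕ → ℝ≥0∞) : Prop :=
  ∑' m : ℕ, (a (m + 1)) ^ (-(1 / ((m : ℝ) + 1))) = (⊤ : ℝ≥0∞)

namespace Weight

variable {n : ℕ}

/-- Standard quasi-analytic weights: `∑_{m ≥ 1} M_w(e_j, m)^{-1/m} = ∞` for every vector `e_j`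
of the standard basis. -/
def IsStandardQuasiAnalytic (w : Weight n) : Prop :=
  ∀ j : Fin n, RootSeriesDiverges (w.moment (EuclideanSpace.single j (1 : ℝ)))

end Weight

/-! ### The space `C_w` and its topology -/

section Space

variable {n : ℕ}

/-- `C_w` as a subspace of all functions: smooth `f` with `∂^α f(x) w(x) → 0` as `‖x‖ → ∞`,
for all `α`. -/
def cwSubmodule (w : Weight n) : Submodule ℂ (RSpace n → ℂ) where
  carrier := {f | ContDiff ℝ ∞ f ∧ ∀ α : MultiIndex n,
    Filter.Tendsto (fun x => multiD ℝ α f x * (w x : ℂ)) (Bornology.cobounded (RSpace n)) (𝓝 0)}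
  zero_mem' := by
    refine ⟨contDiff_const, fun α => ?_⟩
    have h := (multiD_aux α).2.2 0 (0 : RSpace n → ℂ) contDiff_const
    rw [zero_smul, zero_smul] at h
    simpa [h] using tendsto_const_nhds
  add_mem' := by
    rintro f g ⟨hf, hf'⟩ ⟨hg, hg'⟩
    refine ⟨hf.add hg, fun α => ?_⟩
    rw [(multiD_aux α).2.1 f g hf hg]
    simpa [add_mul] using (hf' α).add (hg' α)
  smul_mem' := by
    rintro c f ⟨hf, hf'⟩
    refine ⟨contDiff_const.smul hf, fun α => ?_⟩
    rw [(multiD_aux α).2.2 c f hf]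
    simpa [mul_assoc] using (hf' α).const_mul c

/-- The space `C_w`. It is a separate type, so that it does not carry the topology of pointwise
convergence. -/
def Cw (w : Weight n) : Type := cwSubmodule w

/-- The element of `C_w` given by a function that lies in it. -/
def Cw.mk {w : Weight n} (f : RSpace n → ℂ) (hf : f ∈ cwSubmodule w) : Cw w := ⟨f, hf⟩

/-- The function underlying an element of `C_w`. -/
def Cw.val {w : Weight n} (f : Cw w) : RSpace n → ℂ := Subtype.val f

noncomputable instance (w : Weight n) : AddCommGroup (Cw w) :=
  inferInstanceAs (AddCommGroup (cwSubmodule w))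

noncomputable instance (w : Weight n) : Module ℂ (Cw w) :=
  inferInstanceAs (Module ℂ (cwSubmodule w))

theorem Cw.bddAbove (w : Weight n) (α : MultiIndex n) (f : Cw w) :
    BddAbove (Set.range fun x => ‖multiD ℝ α f.val x‖ * w x) := by
  obtain ⟨B, hB⟩ := w.bounded
  have hsm : ContDiff ℝ ∞ f.val := f.2.1
  have hc : Continuous (multiD ℝ α f.val) := ((multiD_aux α).1 _ hsm).continuous
  have ht := f.2.2 α
  have h1 : ∀ᶠ x in Bornology.cobounded (RSpace n), ‖multiD ℝ α f.val x * (w x : ℂ)‖ < 1 := by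
    have := ht.norm
    rw [norm_zero] at this
    exact this.eventually_lt_const one_pos
  rw [Metric.cobounded_eq_cocompact, Filter.eventually_iff, Filter.mem_cocompact] at h1
  obtain ⟨K, hK, hKs⟩ := h1
  obtain ⟨D, hD⟩ := hK.exists_bound_of_continuousOn hc.continuousOn
  refine ⟨max 1 (|D| * |B|), ?_⟩
  rintro _ ⟨x, rfl⟩
  by_cases hx : x ∈ K
  · refine le_max_of_le_right ?_
    exact mul_le_mul ((hD x hx).trans (le_abs_self D)) ((hB x).trans (le_abs_self B))
      (w.nonneg x) (abs_nonneg D)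
  · refine le_max_of_le_left ?_
    have := hKs hx
    simp only [Set.mem_ofPred_eq, norm_mul, Complex.norm_real, Real.norm_eq_abs,
      abs_of_nonneg (w.nonneg x)] at this
    exact this.le

/-- The seminorm `p_α(f) = sup_x |∂^α f(x)| w(x)` on `C_w`. -/
noncomputable def cwSeminorm (w : Weight n) (α : MultiIndex n) : Seminorm ℂ (Cw w) :=
  Seminorm.of (fun f => ⨆ x, ‖multiD ℝ α f.val x‖ * w x)
    (by
      intro f g
      refine ciSup_le fun x => ?_
      have h : multiD ℝ α (f + g).val = multiD ℝ α f.val + multiD ℝ α g.val :=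
        (multiD_aux α).2.1 f.val g.val f.2.1 g.2.1
      rw [h, Pi.add_apply]
      calc ‖multiD ℝ α f.val x + multiD ℝ α g.val x‖ * w x
          ≤ (‖multiD ℝ α f.val x‖ + ‖multiD ℝ α g.val x‖) * w x :=
            mul_le_mul_of_nonneg_right (norm_add_le _ _) (w.nonneg x)
        _ = ‖multiD ℝ α f.val x‖ * w x + ‖multiD ℝ α g.val x‖ * w x := add_mul _ _ _
        _ ≤ _ := add_le_add (le_ciSup (Cw.bddAbove w α f) x) (le_ciSup (Cw.bddAbove w α g) x))
    (by
      intro c f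
      have h : multiD ℝ α (c • f).val = c • multiD ℝ α f.val :=
        (multiD_aux α).2.2 c f.val f.2.1
      rw [h, Real.mul_iSup_of_nonneg (norm_nonneg c)]
      simp [mul_assoc])

/-- The locally convex topology on `C_w` defined by the seminorms `p_α`. -/
noncomputable instance (w : Weight n) : TopologicalSpace (Cw w) :=
  SeminormFamily.moduleFilterBasis (𝕜 := ℂ) (F := Cw w) (ι := MultiIndex n)
    (cwSeminorm w) |>.topology

theorem Cw.withSeminorms (w : Weight n) :
    WithSeminorms (𝕜 := ℂ) (E := Cw w) (ι := MultiIndex n) (cwSeminorm w) := ⟨rfl⟩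

/-- The continuous dual of `C_w`. -/
abbrev CwDual (w : Weight n) : Type := Cw w →L[ℂ] ℂ

/-- The order of `T` in the dual of `C_w`: the least possible value of `max_{β ∈ S} |β|`, over the
finite sets `S` of multi-indices for which there is a constant `C` with
`|⟨T, f⟩| ≤ C max_{β ∈ S} p_β(f)` for all `f`. -/
noncomputable def dualOrder {w : Weight n} (T : CwDual w) : ℕ :=
  sInf {N : ℕ | ∃ S : Finset (MultiIndex n), S.sup order = N ∧
    ∃ C : ℝ, ∀ f : Cw w, ‖T f‖ ≤ C * (S.sup (cwSeminorm w)) f}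

end Space

/-! ### Tempered distributions -/

section Tempered

variable {n : ℕ}

/-- `S` has order at most `k` as a distribution: for every compact `K` there is a constant `C` with
`|⟨S, f⟩| ≤ C max_{|β| ≤ k} ‖∂^β f‖_∞` for all test functions `f` supported in `K`. -/
def HasOrderLE (S : 𝓢'(RSpace n, ℂ)) (k : ℕ) : Prop :=
  ∀ K : Set (RSpace n), IsCompact K → ∃ C : ℝ≥0, ∀ f : 𝓢(RSpace n, ℂ), tsupport f ⊆ K →
    ‖S f‖ₑ ≤ C * ⨆ β ∈ {β : MultiIndex n | order β ≤ k}, supNorm (multiD ℝ β f)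

/-- The order of a tempered distribution, in `{0, 1, 2, …, ∞}`. -/
noncomputable def distOrder (S : 𝓢'(RSpace n, ℂ)) : ℕ∞ :=
  ⨅ k ∈ {k : ℕ | HasOrderLE S k}, (k : ℕ∞)

/-- The constant `(2π)^{-n/2}`. -/
noncomputable def fourierConst (n : ℕ) : ℂ := (((2 * Real.pi) ^ (-(n : ℝ) / 2) : ℝ) : ℂ)

/-- Multiplication by `1 / (2π)` on `ℝⁿ`. -/
noncomputable def scaleEquiv (n : ℕ) : RSpace n ≃L[ℝ] RSpace n :=
  ContinuousLinearEquiv.smulLeft (Units.mk0 ((2 * Real.pi)⁻¹) (by positivity))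

/-- The Fourier transform on Schwartz functions, with the normalization
`f̂(λ) = (2π)^{-n/2} ∫ f(x) exp(-i(λ, x)) dx`; see `schwartzFourier_apply`. -/
noncomputable def schwartzFourier (n : ℕ) : 𝓢(RSpace n, ℂ) →L[ℂ] 𝓢(RSpace n, ℂ) :=
  fourierConst n • ((SchwartzMap.compCLMOfContinuousLinearEquiv ℂ (scaleEquiv n)) ∘L
    (FourierTransform.fourierCLM ℂ 𝓢(RSpace n, ℂ)))

theorem schwartzFourier_apply (f : 𝓢(RSpace n, ℂ)) (l : RSpace n) :
    schwartzFourier n f l =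
      fourierConst n * ∫ x, f x * Complex.exp (-Complex.I * ((inner ℝ l x : ℝ) : ℂ)) := by
  have h : schwartzFourier n f l = fourierConst n * 𝓕 (f : RSpace n → ℂ) ((2 * Real.pi)⁻¹ • l) :=
    rfl
  rw [h, Real.fourier_eq']
  congr 1
  refine MeasureTheory.integral_congr_ae (Filter.Eventually.of_forall fun x => ?_)
  simp only [smul_eq_mul]
  rw [mul_comm]
  congr 2
  rw [inner_smul_right, real_inner_comm]
  have : (Real.pi : ℂ) ≠ 0 := by exact_mod_cast Real.pi_ne_zero
  push_cast
  field_simp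

/-- The Fourier transform on tempered distributions: `⟨ℱ(S), f⟩ = ⟨S, ℱ(f)⟩`. -/
noncomputable def temperedFourier (S : 𝓢'(RSpace n, ℂ)) : 𝓢'(RSpace n, ℂ) :=
  PointwiseConvergenceCLM.precomp ℂ (schwartzFourier n) S

theorem temperedFourier_apply (S : 𝓢'(RSpace n, ℂ)) (f : 𝓢(RSpace n, ℂ)) :
    temperedFourier S f = S (schwartzFourier n f) := rfl

/-- `S` is given by the function `g`: `⟨S, f⟩ = ∫ f g` for all Schwartz functions `f`, where the
integrals converge absolutely. -/
def IsRepresentedBy (S : 𝓢'(RSpace n, ℂ)) (g : RSpace n → ℂ) : Prop :=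
  ∀ f : 𝓢(RSpace n, ℂ), MeasureTheory.Integrable (fun l => f l * g l) ∧
    S f = ∫ l, f l * g l

end Tempered

/-! ### Exponentials -/

section Exponentials

variable {n : ℕ}

/-- The inclusion `ℝⁿ ⊆ ℂⁿ`. -/
noncomputable def toC (l : RSpace n) : CSpace n := WithLp.toLp 2 fun j => (l j : ℂ)

/-- The imaginary part of a vector in `ℂⁿ`. -/
noncomputable def imPart (l : CSpace n) : RSpace n := WithLp.toLp 2 fun j => (l j).im

/-- The exponential `e_ζ(x) = exp((ζ, x))` on `ℝⁿ`, for `ζ ∈ ℂⁿ`; the pairing is bilinear. -/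
noncomputable def expFun (ζ : CSpace n) : RSpace n → ℂ :=
  fun x => Complex.exp (∑ j, ζ j * (x j : ℂ))

/-- The function `x ↦ x^α e_ζ(x)`. -/
noncomputable def monoExp (α : MultiIndex n) (ζ : CSpace n) : RSpace n → ℂ :=
  fun x => (∏ j, (x j : ℂ) ^ α j) * expFun ζ x

/-- The tube `{λ ∈ ℂⁿ : ‖Im λ‖ < τ_w}` for a holomorphic weight. -/
def tube (w : Weight n) : Set (CSpace n) :=
  {l | ENNReal.ofReal ‖imPart l‖ < w.tau}

end Exponentials

end WeightedFourier

/-! A continuous functional `T` is dominated by finitely many seminorms `p_β`, `β ∈ S`, so by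
Hahn–Banach it factors through `f ↦ (∂^β f · w)_{β ∈ S}`, with values in the bounded functions on `S
× ℝⁿ` (`exists_factorization`). Every question about `λ ↦ ⟨T, x^α e_{-iλ}⟩` thus becomes one about
the Banach-valued map sending `ζ` to the image of `x^α e_ζ`. That map is norm continuous, because
the decay of `w` makes tails uniformly small (`eventually_leibniz_close`). It is differentiable,
with `∂/∂ζ_j` raising `α_j` by one, because this holds at every point evaluation and the candidate
derivative is norm continuous (`hasFDerivAt_of_norming`). Each derivative consumes one power of
`‖x‖`, whence class `C^d` for a weight in `𝒲_d`. For a holomorphic weight the exponential decay also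
absorbs `e^{(Im λ, x)}` on the tube, and the same argument gives holomorphy.

The bounds come from the Leibniz rule: a derivative of `x^α e_ζ` in the direction `j` costs a factor
of at most `‖ζ‖ + α_j`, and at most `N` derivatives occur (`norm_leibniz_le`).

That `T̂` represents the Fourier transform is an interchange of a bounded functional with a Bochner
integral (`isRepresentedBy_transform`). Injectivity of `T ↦ T̂` then reduces to that of the
restriction to Schwartz functions, which follows by approximating `f ∈ C_w` by its products with
dilated cut-offs (`toTempered_injective`).

For a standard quasi-analytic weight, the normalized weight is split into `n` equal fractional
powers, one per coordinate. The suprema of `max(1, |x_j|)^m` times such a power, multiplied by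
`D^m`, are logarithmically convex majorants whose root series still diverges (`exists_majorant`).
Carleman's inequality turns this into `∑ M_m / M_{m+1} = ∞`, and Bang's argument (`bang_step`,
`eq_zero_of_not_summable_ratio`) proves the Denjoy–Carleman theorem on the line. Applied one
coordinate at a time it gives `T̂ = 0`, hence `T = 0`. -/

namespace WeightedFourier

/-! ### Iterated partial derivatives along words -/

section Words

variable {n : ℕ}

/-- The composition of the partial derivatives listed in a word; the last letter acts first. -/
noncomputable def wordD (𝕜 : Type) [RCLike 𝕜] [NormedSpace 𝕜 ℂ] (l : List (Fin n))
    (f : EuclideanSpace 𝕜 (Fin n) → ℂ) : EuclideanSpace 𝕜 (Fin n) → ℂ :=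
  l.foldr (fun j g => partialD 𝕜 j g) f

/-- The sorted word in which the letter `j` occurs `α j` times. -/
def wordOf (α : MultiIndex n) : List (Fin n) :=
  (List.finRange n).flatMap fun j => List.replicate (α j) j

theorem wordD_cons (𝕜 : Type) [RCLike 𝕜] [NormedSpace 𝕜 ℂ] (j : Fin n) (l : List (Fin n))
    (f : EuclideanSpace 𝕜 (Fin n) → ℂ) : wordD 𝕜 (j :: l) f = partialD 𝕜 j (wordD 𝕜 l f) := rfl

theorem wordD_append (𝕜 : Type) [RCLike 𝕜] [NormedSpace 𝕜 ℂ] (l m : List (Fin n))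
    (f : EuclideanSpace 𝕜 (Fin n) → ℂ) : wordD 𝕜 (l ++ m) f = wordD 𝕜 l (wordD 𝕜 m f) := by
  simp [wordD, List.foldr_append]

theorem wordD_replicate (𝕜 : Type) [RCLike 𝕜] [NormedSpace 𝕜 ℂ] (j : Fin n) (k : ℕ)
    (f : EuclideanSpace 𝕜 (Fin n) → ℂ) :
    wordD 𝕜 (List.replicate k j) f = (partialD 𝕜 j)^[k] f := by
  induction k with
  | zero => rfl
  | succ k ih => rw [List.replicate_succ, wordD_cons, ih, Function.iterate_succ_apply']

theorem multiD_eq_wordD (𝕜 : Type) [RCLike 𝕜] [NormedSpace 𝕜 ℂ] (α : MultiIndex n)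
    (f : EuclideanSpace 𝕜 (Fin n) → ℂ) : multiD 𝕜 α f = wordD 𝕜 (wordOf α) f := by
  unfold multiD wordOf
  induction List.finRange n with
  | nil => rfl
  | cons j l ih =>
    rw [List.foldr_cons, List.flatMap_cons, wordD_append, wordD_replicate, ih]

theorem length_wordOf (α : MultiIndex n) : (wordOf α).length = order α := by
  simp [wordOf, order, List.length_flatMap, Fin.sum_univ_def]

theorem count_wordOf (α : MultiIndex n) (j : Fin n) : (wordOf α).count j = α j := by
  rw [wordOf, List.count_flatMap, ← Fin.sum_univ_def (fun i => _)]
  simp [List.count_replicate]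

theorem perm_wordOf_count (l : List (Fin n)) : l.Perm (wordOf fun j => l.count j) := by
  rw [List.perm_iff_count]
  intro j
  rw [count_wordOf]

theorem partialD_eq_fderiv (j : Fin n) {f : RSpace n → ℂ} (hf : ContDiff ℝ ∞ f) (x : RSpace n) :
    partialD ℝ j f x = fderiv ℝ f x (EuclideanSpace.single j (1 : ℝ)) :=
  ((hf.differentiable (by simp)) x).lineDeriv_eq_fderiv

theorem wordD_smooth (l : List (Fin n)) {f : RSpace n → ℂ} (hf : ContDiff ℝ ∞ f) :
    ContDiff ℝ ∞ (wordD ℝ l f) := by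
  induction l with
  | nil => exact hf
  | cons j l ih => exact partialD_smooth j ih

theorem wordD_add (l : List (Fin n)) {f g : RSpace n → ℂ} (hf : ContDiff ℝ ∞ f)
    (hg : ContDiff ℝ ∞ g) : wordD ℝ l (f + g) = wordD ℝ l f + wordD ℝ l g := by
  induction l with
  | nil => rfl
  | cons j l ih => simp only [wordD_cons, ih, partialD_add j (wordD_smooth l hf) (wordD_smooth l hg)]

theorem wordD_smul (l : List (Fin n)) (c : ℂ) {f : RSpace n → ℂ} (hf : ContDiff ℝ ∞ f) :
    wordD ℝ l (c • f) = c • wordD ℝ l f := by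
  induction l with
  | nil => rfl
  | cons j l ih => simp only [wordD_cons, ih, partialD_smul j c (wordD_smooth l hf)]

theorem partialD_comm (i j : Fin n) {f : RSpace n → ℂ} (hf : ContDiff ℝ ∞ f) :
    partialD ℝ i (partialD ℝ j f) = partialD ℝ j (partialD ℝ i f) := by
  have key : ∀ (i j : Fin n) (x : RSpace n), partialD ℝ i (partialD ℝ j f) x =
      fderiv ℝ (fderiv ℝ f) x (EuclideanSpace.single i (1 : ℝ))
        (EuclideanSpace.single j (1 : ℝ)) := by
    intro i j x
    have hd : DifferentiableAt ℝ (fderiv ℝ f) x :=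
      (hf.fderiv_right (m := ∞) (by simp)).differentiable (by simp) x
    have h : partialD ℝ j f = fun x => fderiv ℝ f x (EuclideanSpace.single j (1 : ℝ)) :=
      funext (partialD_eq_fderiv j hf)
    rw [partialD_eq_fderiv i (partialD_smooth j hf), h,
      fderiv_clm_apply hd (differentiableAt_const _)]
    simp
  funext x
  rw [key, key]
  exact (hf.contDiffAt.isSymmSndFDerivAt (by
    rw [minSmoothness_of_isRCLikeNormedField]; exact WithTop.coe_le_coe.mpr (le_top : (2 : ℕ∞) ≤ ⊤))).eq _ _

theorem wordD_perm {l m : List (Fin n)} (h : l.Perm m) {f : RSpace n → ℂ}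
    (hf : ContDiff ℝ ∞ f) : wordD ℝ l f = wordD ℝ m f := by
  induction h with
  | nil => rfl
  | cons j _ ih => rw [wordD_cons, wordD_cons, ih]
  | swap i j l => exact partialD_comm _ _ (wordD_smooth l hf)
  | trans _ _ h1 h2 => exact h1.trans h2

/-- Mixed partials commute, so a word can be sorted. Words allow induction one derivative at a time,
which the fixed order of differentiation in `multiD` does not. -/
theorem wordD_eq_multiD (l : List (Fin n)) {f : RSpace n → ℂ} (hf : ContDiff ℝ ∞ f) :
    wordD ℝ l f = multiD ℝ (fun j => l.count j) f := by
  rw [multiD_eq_wordD]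
  exact wordD_perm (perm_wordOf_count l) hf

theorem mem_cwSubmodule_iff {w : Weight n} {f : RSpace n → ℂ} : f ∈ cwSubmodule w ↔
    ContDiff ℝ ∞ f ∧ ∀ l : List (Fin n), Filter.Tendsto (fun x => wordD ℝ l f x * (w x : ℂ))
      (Bornology.cobounded (RSpace n)) (𝓝 0) := by
  constructor
  · rintro ⟨h1, h2⟩
    exact ⟨h1, fun l => by rw [wordD_eq_multiD l h1]; exact h2 _⟩
  · rintro ⟨h1, h2⟩
    exact ⟨h1, fun α => by rw [multiD_eq_wordD]; exact h2 _⟩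

theorem partialD_mul (j : Fin n) {f g : RSpace n → ℂ} (hf : ContDiff ℝ ∞ f)
    (hg : ContDiff ℝ ∞ g) : partialD ℝ j (f * g) = partialD ℝ j f * g + f * partialD ℝ j g := by
  funext x
  have h1 := hf.differentiable (by simp) x
  have h2 := hg.differentiable (by simp) x
  simp only [Pi.add_apply, Pi.mul_apply]
  rw [partialD_eq_fderiv (f := f * g) j (hf.mul hg), partialD_eq_fderiv j hf, partialD_eq_fderiv j hg,
    fderiv_mul h1 h2]
  simp [mul_comm]
  ring

/-- The iterated derivative of a Schwartz function as a Schwartz function. -/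
noncomputable def schwartzWordD (l : List (Fin n)) : 𝓢(RSpace n, ℂ) →L[ℂ] 𝓢(RSpace n, ℂ) :=
  l.foldr (fun j g => (LineDeriv.lineDerivOpCLM ℂ 𝓢(RSpace n, ℂ)
    (EuclideanSpace.single j (1 : ℝ))).comp g) (ContinuousLinearMap.id ℂ _)

theorem schwartzWordD_coe (l : List (Fin n)) (f : 𝓢(RSpace n, ℂ)) :
    (schwartzWordD l f : RSpace n → ℂ) = wordD ℝ l f := by
  induction l with
  | nil => rfl
  | cons j l ih =>
    rw [wordD_cons, ← ih]
    funext x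
    exact SchwartzMap.lineDerivOp_apply _ _ _

theorem schwartz_mem_cwSubmodule (w : Weight n) (f : 𝓢(RSpace n, ℂ)) :
    (f : RSpace n → ℂ) ∈ cwSubmodule w := by
  rw [mem_cwSubmodule_iff]
  refine ⟨f.smooth ⊤, fun l => ?_⟩
  rw [← schwartzWordD_coe]
  obtain ⟨B, hB⟩ := w.bounded
  have h0 : Filter.Tendsto (schwartzWordD l f) (Bornology.cobounded (RSpace n)) (𝓝 0) := by
    rw [Metric.cobounded_eq_cocompact]
    exact (schwartzWordD l f).toZeroAtInfty.zero_at_infty'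
  refine h0.zero_mul_isBoundedUnder_le ⟨B, ?_⟩
  simp only [Filter.eventually_map]
  refine Filter.Eventually.of_forall fun x => ?_
  simpa [abs_of_nonneg (w.nonneg x)] using hB x

theorem le_cwSeminorm (w : Weight n) (α : MultiIndex n) (f : Cw w) (x : RSpace n) :
    ‖multiD ℝ α f.val x‖ * w x ≤ cwSeminorm w α f :=
  le_ciSup (Cw.bddAbove w α f) x

theorem cwSeminorm_le {w : Weight n} {α : MultiIndex n} {f : Cw w} {a : ℝ}
    (h : ∀ x, ‖multiD ℝ α f.val x‖ * w x ≤ a) : cwSeminorm w α f ≤ a :=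
  ciSup_le h

end Words

/-! ### Derivatives of monomials times exponentials -/

section MonoExp

variable {n : ℕ}

/-- The multi-index `α` with the entry at `j` decreased by one (if possible). -/
def lower (α : MultiIndex n) (j : Fin n) : MultiIndex n := Function.update α j (α j - 1)

/-- The multi-index `α + e_j`. -/
def raise (α : MultiIndex n) (j : Fin n) : MultiIndex n := Function.update α j (α j + 1)

theorem order_raise (α : MultiIndex n) (j : Fin n) : order (raise α j) = order α + 1 := by
  unfold order raise
  rw [Finset.sum_update_of_mem (Finset.mem_univ j), ← Finset.add_sum_erase _ α (Finset.mem_univ j),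
    Finset.sdiff_singleton_eq_erase]
  ring

theorem lower_raise_self (α : MultiIndex n) (j : Fin n) : lower (raise α j) j = α := by
  simp [lower, raise]

theorem raise_lower_self (α : MultiIndex n) {j : Fin n} (h : α j ≠ 0) :
    raise (lower α j) j = α := by
  simp [lower, raise, Nat.sub_add_cancel (Nat.one_le_iff_ne_zero.mpr h)]

theorem lower_raise_of_ne (α : MultiIndex n) {i j : Fin n} (h : i ≠ j) :
    lower (raise α j) i = raise (lower α i) j := by
  simp only [lower, raise, Function.update_of_ne h, Function.update_of_ne h.symm]
  exact Function.update_comm h.symm _ _ _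

theorem lower_le (α : MultiIndex n) (j k : Fin n) : lower α j k ≤ α k := by
  unfold lower
  rcases eq_or_ne k j with rfl | h
  · simp
  · simp [h]

/-- The monomial `x^α` as a complex-valued function. -/
noncomputable def monomial (α : MultiIndex n) (x : RSpace n) : ℂ := ∏ j, (x j : ℂ) ^ α j

theorem monomial_eq_mul_erase (α : MultiIndex n) (j : Fin n) (x : RSpace n) :
    monomial α x = (x j : ℂ) ^ α j * ∏ k ∈ Finset.univ.erase j, (x k : ℂ) ^ α k :=
  (Finset.mul_prod_erase _ _ (Finset.mem_univ j)).symm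

theorem monomial_update (α : MultiIndex n) (j : Fin n) (a : ℕ) (x : RSpace n) :
    monomial (Function.update α j a) x =
      (x j : ℂ) ^ a * ∏ k ∈ Finset.univ.erase j, (x k : ℂ) ^ α k := by
  rw [monomial_eq_mul_erase _ j, Function.update_self]
  congr 1
  exact Finset.prod_congr rfl fun k hk => by rw [Function.update_of_ne (Finset.ne_of_mem_erase hk)]

theorem monomial_raise (α : MultiIndex n) (j : Fin n) (x : RSpace n) :
    monomial (raise α j) x = x j * monomial α x := by
  rw [raise, monomial_update, monomial_eq_mul_erase α j, pow_succ]
  ring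

theorem monoExp_eq (α : MultiIndex n) (ζ : CSpace n) (x : RSpace n) :
    monoExp α ζ x = monomial α x * expFun ζ x := rfl

theorem monoExp_zero (ζ : CSpace n) : monoExp (0 : MultiIndex n) ζ = expFun ζ := by
  funext x
  simp [monoExp]

theorem contDiff_coord (j : Fin n) : ContDiff ℝ ∞ fun x : RSpace n => (x j : ℂ) :=
  Complex.ofRealCLM.contDiff.comp (EuclideanSpace.proj (𝕜 := ℝ) j).contDiff

theorem monoExp_smooth (α : MultiIndex n) (ζ : CSpace n) : ContDiff ℝ ∞ (monoExp α ζ) := by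
  refine (contDiff_prod fun j _ => (contDiff_coord j).pow _).mul ?_
  exact (Complex.contDiff_exp (𝕜 := ℝ)).comp
    (ContDiff.sum fun j _ => contDiff_const.mul (contDiff_coord j))

theorem single_apply' (i j : Fin n) :
    (EuclideanSpace.single j (1 : ℝ) : RSpace n) i = if i = j then 1 else 0 := by
  simp

theorem contDiff_const_smul' (c : ℂ) {f : RSpace n → ℂ} (hf : ContDiff ℝ ∞ f) :
    ContDiff ℝ ∞ (c • f) := contDiff_const.smul hf

/-- On the line through `x` in the direction `j` the function is `(x_j + t)^{α_j} P exp(s + ζ_j t)`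
with `P` and `s` constant. If `α_j = 0`, the truncated `lower α j` is harmless because its
coefficient vanishes. -/
theorem partialD_monoExp (j : Fin n) (α : MultiIndex n) (ζ : CSpace n) :
    partialD ℝ j (monoExp α ζ) = ζ j • monoExp α ζ + (α j : ℂ) • monoExp (lower α j) ζ := by
  funext x
  refine HasDerivAt.deriv ?_
  set P : ℂ := ∏ k ∈ Finset.univ.erase j, (x k : ℂ) ^ α k
  set s : ℂ := ∑ k, ζ k * (x k : ℂ)
  have hfun : (fun t : ℝ => monoExp α ζ (x + t • EuclideanSpace.single j (1 : ℝ))) =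
      fun t : ℝ => (((x j : ℂ) + t) ^ α j * P) * Complex.exp (s + ζ j * t) := by
    funext t
    have h1 : ∀ k, (x + t • EuclideanSpace.single j (1 : ℝ) : RSpace n) k =
        x k + t * if k = j then 1 else 0 := by
      intro k
      rw [PiLp.add_apply, PiLp.smul_apply, single_apply', smul_eq_mul]
    rw [monoExp_eq, monomial_eq_mul_erase α j, expFun]
    congr 1
    · congr 1
      · simp [h1]
      · refine Finset.prod_congr rfl fun k hk => ?_
        simp [h1, Finset.ne_of_mem_erase hk]
    · congr 1
      simp only [h1, Complex.ofReal_add, mul_add, Finset.sum_add_distrib, s]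
      congr 1
      simp [apply_ite Complex.ofReal]
  rw [hfun]
  have hx : HasDerivAt (fun t : ℝ => (x j : ℂ) + (t : ℂ)) 1 0 :=
    (Complex.ofRealCLM.hasDerivAt (x := (0 : ℝ))).const_add _
  have he : HasDerivAt (fun t : ℝ => s + ζ j * (t : ℂ)) (ζ j) 0 := by
    simpa using ((Complex.ofRealCLM.hasDerivAt (x := (0 : ℝ))).const_mul (ζ j)).const_add s
  have := ((hx.fun_pow (α j)).mul_const P).mul he.cexp
  convert! this using 1
  simp only [Pi.add_apply, Pi.smul_apply, smul_eq_mul, monoExp_eq]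
  rw [lower, monomial_update, monomial_eq_mul_erase α j, expFun]
  simp only [Complex.ofReal_zero, add_zero, mul_zero, mul_one]
  change _ = (α j : ℂ) * (x j : ℂ) ^ (α j - 1) * P * Complex.exp s +
    (x j : ℂ) ^ α j * P * (Complex.exp s * ζ j)
  ring

/-- `∂^l (x^α e_ζ)`, computed by the Leibniz recursion along the word `l` (last letter of the
list applied last). -/
noncomputable def leibniz : List (Fin n) → MultiIndex n → CSpace n → RSpace n → ℂ
  | [], α, ζ, x => monoExp α ζ x
  | j :: l, α, ζ, x => ζ j * leibniz l α ζ x + (α j : ℂ) * leibniz l (lower α j) ζ x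

/-- The reversal arises because `leibniz` peels off the innermost derivative first, whereas the head
of a word in `wordD` is the outermost one. -/
theorem wordD_reverse_monoExp (l : List (Fin n)) (α : MultiIndex n) (ζ : CSpace n) :
    wordD ℝ l.reverse (monoExp α ζ) = leibniz l α ζ := by
  induction l generalizing α with
  | nil => rfl
  | cons j l ih =>
    rw [List.reverse_cons, wordD_append]
    change wordD ℝ l.reverse (partialD ℝ j (monoExp α ζ)) = _
    rw [partialD_monoExp, wordD_add _ (contDiff_const_smul' _ (monoExp_smooth _ _))
      (contDiff_const_smul' _ (monoExp_smooth _ _)), wordD_smul _ _ (monoExp_smooth _ _),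
      wordD_smul _ _ (monoExp_smooth _ _), ih, ih]
    rfl

theorem wordD_monoExp (l : List (Fin n)) (α : MultiIndex n) (ζ : CSpace n) :
    wordD ℝ l (monoExp α ζ) = leibniz l.reverse α ζ := by
  rw [← wordD_reverse_monoExp, List.reverse_reverse]

theorem continuous_leibniz (l : List (Fin n)) (α : MultiIndex n) :
    Continuous fun p : CSpace n × RSpace n => leibniz l α p.1 p.2 := by
  induction l generalizing α with
  | nil =>
    simp only [leibniz, monoExp, expFun]
    fun_prop
  | cons j l ih =>
    simp only [leibniz]
    have h1 := ih α
    have h2 := ih (lower α j)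
    fun_prop

/-- The weight `∏ max(1, |x_j|)^{α_j}` that dominates `x^α`. -/
noncomputable def maxMono (α : MultiIndex n) (x : RSpace n) : ℝ := ∏ j, max 1 |x j| ^ α j

/-- This monotonicity, which `|x^α|` lacks near the coordinate hyperplanes, lets the lowered terms
of the Leibniz rule be absorbed. -/
theorem maxMono_mono {α β : MultiIndex n} (h : ∀ j, α j ≤ β j) (x : RSpace n) :
    maxMono α x ≤ maxMono β x :=
  Finset.prod_le_prod (fun _ _ => by positivity)
    fun j _ => pow_le_pow_right₀ (le_max_left _ _) (h j)

theorem maxMono_nonneg (α : MultiIndex n) (x : RSpace n) : 0 ≤ maxMono α x :=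
  Finset.prod_nonneg fun _ _ => by positivity

/-- The real part of a vector in `ℂⁿ`. -/
noncomputable def rePart (ζ : CSpace n) : RSpace n := WithLp.toLp 2 fun j => (ζ j).re

theorem norm_expFun (ζ : CSpace n) (x : RSpace n) :
    ‖expFun ζ x‖ = Real.exp (inner ℝ (rePart ζ) x) := by
  rw [expFun, Complex.norm_exp]
  congr 1
  simp [rePart, PiLp.inner_apply, mul_comm]

/-- Each letter `j` multiplies the bound by at most `‖ζ‖ + α_j ≤ (1 + ‖ζ‖) ∏ (1 + α_k)`, and
lowering `α` only decreases both this factor and `maxMono`. -/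
theorem norm_leibniz_le (l : List (Fin n)) (α : MultiIndex n) (ζ : CSpace n) (x : RSpace n) :
    ‖leibniz l α ζ x‖ ≤ ((1 + ‖ζ‖) * ∏ j, (1 + (α j : ℝ))) ^ l.length * maxMono α x *
      Real.exp (inner ℝ (rePart ζ) x) := by
  induction l generalizing α with
  | nil =>
    rw [leibniz, monoExp_eq, norm_mul, norm_expFun]
    simp only [List.length_nil, pow_zero, one_mul]
    refine mul_le_mul_of_nonneg_right ?_ (Real.exp_pos _).le
    rw [monomial, norm_prod]
    refine Finset.prod_le_prod (fun _ _ => norm_nonneg _) fun j _ => ?_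
    rw [norm_pow, Complex.norm_real, Real.norm_eq_abs]
    exact pow_le_pow_left₀ (abs_nonneg _) (le_max_right _ _) _
  | cons j l ih =>
    set P := ∏ j, (1 + (α j : ℝ)) with hP
    set A := (1 + ‖ζ‖) * P
    set K := A ^ l.length * maxMono α x * Real.exp (inner ℝ (rePart ζ) x) with hK
    have hζ : ‖ζ j‖ ≤ ‖ζ‖ := PiLp.norm_apply_le ζ j
    have hPj : 1 + (α j : ℝ) ≤ P := by
      rw [hP, ← Finset.mul_prod_erase _ _ (Finset.mem_univ j)]
      exact le_mul_of_one_le_right (by positivity) (Finset.one_le_prod fun k => by simp)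
    have hP0 : 0 ≤ P := le_trans (by positivity) hPj
    have hA0 : 0 ≤ A := mul_nonneg (by positivity) hP0
    have hK0 : 0 ≤ K := by have := maxMono_nonneg α x; positivity
    have h1 : ‖leibniz l α ζ x‖ ≤ K := ih α
    have h2 : ‖leibniz l (lower α j) ζ x‖ ≤ K := by
      refine (ih (lower α j)).trans ?_
      have h3 : ∏ k, (1 + (lower α j k : ℝ)) ≤ P :=
        Finset.prod_le_prod (fun _ _ => by positivity) fun k _ => by
          have := lower_le α j k
          gcongr
      have h4 := maxMono_mono (lower_le α j) x
      have h5 := maxMono_nonneg (lower α j) x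
      have h6 : 0 ≤ ∏ k, (1 + (lower α j k : ℝ)) := Finset.prod_nonneg fun _ _ => by positivity
      have h7 : (1 + ‖ζ‖) * ∏ k, (1 + (lower α j k : ℝ)) ≤ A :=
        mul_le_mul_of_nonneg_left h3 (by positivity)
      rw [hK]
      gcongr
    have hA : ‖ζ j‖ + α j ≤ A := by
      have : (0 : ℝ) ≤ α j := Nat.cast_nonneg _
      have := norm_nonneg ζ
      calc ‖ζ j‖ + α j ≤ (1 + ‖ζ‖) * (1 + α j) := by nlinarith
        _ ≤ A := mul_le_mul_of_nonneg_left hPj (by positivity)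
    calc ‖leibniz (j :: l) α ζ x‖
        ≤ ‖ζ j‖ * ‖leibniz l α ζ x‖ + α j * ‖leibniz l (lower α j) ζ x‖ := by
          rw [leibniz]
          refine (norm_add_le _ _).trans ?_
          rw [norm_mul, norm_mul, Complex.norm_natCast]
      _ ≤ ‖ζ j‖ * K + α j * K := by gcongr
      _ = (‖ζ j‖ + α j) * K := by ring
      _ ≤ A * K := by gcongr
      _ = _ := by rw [hK, List.length_cons, pow_succ]; ring

theorem hasFDerivAt_expFun (ζ : CSpace n) (x : RSpace n) :
    HasFDerivAt (fun ζ => expFun ζ x)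
      (∑ j, ((x j : ℂ) * expFun ζ x) • (EuclideanSpace.proj j : CSpace n →L[ℂ] ℂ)) ζ := by
  have h1 : HasFDerivAt (fun ζ : CSpace n => ∑ j, ζ j * (x j : ℂ))
      (∑ j, (x j : ℂ) • (EuclideanSpace.proj j : CSpace n →L[ℂ] ℂ)) ζ := by
    refine HasFDerivAt.fun_sum fun j _ => ?_
    exact ((EuclideanSpace.proj j : CSpace n →L[ℂ] ℂ).hasFDerivAt).mul_const _
  convert! h1.cexp using 1
  rw [Finset.smul_sum]
  exact Finset.sum_congr rfl fun j _ => by rw [smul_smul, mul_comm]; rfl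

/-- Differentiation in `ζ_j` multiplies `x^α e_ζ` by `x_j` and commutes with the derivatives in `x`.
-/
theorem hasFDerivAt_leibniz (l : List (Fin n)) (α : MultiIndex n) (ζ : CSpace n) (x : RSpace n) :
    HasFDerivAt (fun ζ => leibniz l α ζ x)
      (∑ j, leibniz l (raise α j) ζ x • (EuclideanSpace.proj j : CSpace n →L[ℂ] ℂ)) ζ := by
  induction l generalizing α with
  | nil =>
    simp only [leibniz, monoExp_eq]
    convert! (hasFDerivAt_expFun ζ x).const_mul (monomial α x) using 1
    rw [Finset.smul_sum]
    refine Finset.sum_congr rfl fun j _ => ?_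
    rw [smul_smul]
    congr 1
    rw [monomial_raise]
    ring
  | cons i l ih =>
    simp only [leibniz]
    have h1 : HasFDerivAt (fun ζ : CSpace n => ζ i) (EuclideanSpace.proj i : CSpace n →L[ℂ] ℂ) ζ :=
      (EuclideanSpace.proj i : CSpace n →L[ℂ] ℂ).hasFDerivAt
    convert! (h1.mul (ih α)).add ((ih (lower α i)).const_mul (α i : ℂ)) using 1
    ext v
    simp only [_root_.add_apply, _root_.smul_apply,
      _root_.sum_apply, smul_eq_mul, PiLp.proj_apply, Finset.mul_sum]
    -- Raising and lowering commute except for `j = i`, where the coefficient changes from `α_i` to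
    -- `α_i + 1`. The surplus term is exactly the one produced by differentiating the factor `ζ_i`.
    have h2 : ∀ j, (α i : ℂ) * leibniz l (raise (lower α i) j) ζ x * v j =
        ((raise α j i : ℕ) : ℂ) * leibniz l (lower (raise α j) i) ζ x * v j -
          if j = i then leibniz l α ζ x * v i else 0 := by
      intro j
      split_ifs with h
      · subst h
        rw [lower_raise_self]
        have : raise α j j = α j + 1 := by simp [raise]
        rw [this]
        by_cases h0 : α j = 0
        · simp [h0]
        · rw [raise_lower_self α h0]; push_cast; ring
      · rw [lower_raise_of_ne α (Ne.symm h), sub_zero]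
        have : raise α j i = α i := by simp [raise, Ne.symm h]
        rw [this]
    have h3 : ∀ j, (α i : ℂ) * (leibniz l (raise (lower α i) j) ζ x * v j) = _ :=
      fun j => (mul_assoc _ _ _).symm.trans (h2 j)
    simp only [h3, Finset.sum_sub_distrib, Finset.sum_ite_eq', Finset.mem_univ, if_true, add_mul,
      Finset.sum_add_distrib]
    simp only [mul_assoc]
    ring

end MonoExp

/-! ### Decay of weights and the monomial exponentials in `C_w` -/

section Decay

variable {n : ℕ}

/-- `max(1, ‖x‖)^k e^{r‖x‖} w(x) → 0` as `‖x‖ → ∞`. -/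
def Weight.DecaysExp (w : Weight n) (k : ℕ) (r : ℝ) : Prop :=
  Filter.Tendsto (fun x : RSpace n => max 1 ‖x‖ ^ k * Real.exp (r * ‖x‖) * w x)
    (Bornology.cobounded (RSpace n)) (𝓝 0)

theorem Weight.DecaysExp.mono {w : Weight n} {k k' : ℕ} {r : ℝ} (h : w.DecaysExp k r)
    (hk : k' ≤ k) : w.DecaysExp k' r := by
  refine squeeze_zero (fun x => ?_) (fun x => ?_) h
  · have := w.nonneg x
    positivity
  · have := w.nonneg x
    have h1 : max 1 ‖x‖ ^ k' ≤ max 1 ‖x‖ ^ k := pow_le_pow_right₀ (le_max_left _ _) hk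
    gcongr

theorem Weight.Decays.decaysExp {w : Weight n} {k : ℕ} (h : w.Decays k) : w.DecaysExp k 0 := by
  refine Filter.Tendsto.congr' ?_ h
  filter_upwards [(Metric.hasBasis_cobounded_compl_closedBall (0 : RSpace n)).eventually_iff.mpr
    ⟨1, trivial, fun {x} hx => hx⟩] with x hx
  have : 1 ≤ ‖x‖ := by
    have : 1 < ‖x‖ := by simpa using hx
    exact this.le
  simp [max_eq_right this]

theorem maxMono_le (α : MultiIndex n) (x : RSpace n) : maxMono α x ≤ max 1 ‖x‖ ^ order α := by
  rw [maxMono, order, ← Finset.prod_pow_eq_pow_sum]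
  refine Finset.prod_le_prod (fun _ _ => by positivity) fun j _ => ?_
  have : |x j| ≤ ‖x‖ := PiLp.norm_apply_le x j
  gcongr

theorem norm_leibniz_mul_le {w : Weight n} {k : ℕ} {r : ℝ} (l : List (Fin n)) {α : MultiIndex n}
    (hα : order α ≤ k) {ζ : CSpace n} (hζ : ‖rePart ζ‖ ≤ r) (x : RSpace n) :
    ‖leibniz l α ζ x‖ * w x ≤ ((1 + ‖ζ‖) * ∏ j, (1 + (α j : ℝ))) ^ l.length *
      (max 1 ‖x‖ ^ k * Real.exp (r * ‖x‖) * w x) := by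
  have hw := w.nonneg x
  have h1 := norm_leibniz_le l α ζ x
  have h2 : maxMono α x ≤ max 1 ‖x‖ ^ k :=
    (maxMono_le α x).trans (pow_le_pow_right₀ (le_max_left _ _) hα)
  have h3 : inner ℝ (rePart ζ) x ≤ r * ‖x‖ :=
    (real_inner_le_norm _ _).trans (by gcongr)
  have h4 := maxMono_nonneg α x
  have h5 : 0 ≤ ∏ j, (1 + (α j : ℝ)) := Finset.prod_nonneg fun _ _ => by positivity
  calc ‖leibniz l α ζ x‖ * w x
      ≤ ((1 + ‖ζ‖) * ∏ j, (1 + (α j : ℝ))) ^ l.length * max 1 ‖x‖ ^ k *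
          Real.exp (r * ‖x‖) * w x := by
        refine mul_le_mul_of_nonneg_right (h1.trans ?_) hw
        gcongr
    _ = _ := by ring

theorem monoExp_mem {w : Weight n} {k : ℕ} {r : ℝ} (h : w.DecaysExp k r) {α : MultiIndex n}
    (hα : order α ≤ k) {ζ : CSpace n} (hζ : ‖rePart ζ‖ ≤ r) : monoExp α ζ ∈ cwSubmodule w := by
  rw [mem_cwSubmodule_iff]
  refine ⟨monoExp_smooth α ζ, fun l => ?_⟩
  rw [wordD_monoExp]
  have h0 := h.const_mul (((1 + ‖ζ‖) * ∏ j, (1 + (α j : ℝ))) ^ l.reverse.length)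
  rw [mul_zero] at h0
  refine squeeze_zero_norm (fun x => ?_) h0
  rw [norm_mul, Complex.norm_real, Real.norm_eq_abs, abs_of_nonneg (w.nonneg x)]
  exact norm_leibniz_mul_le l.reverse hα hζ x

/-- Off a compact set both terms are at most `ε / 2` by the decay of the weight, uniformly in `ζ`;
on the compact set joint continuity gives uniform closeness. -/
theorem eventually_leibniz_close {w : Weight n} {k : ℕ} {r : ℝ} (h : w.DecaysExp k r)
    (l : List (Fin n)) {α : MultiIndex n} (hα : order α ≤ k) {ζ₀ : CSpace n}
    (hζ₀ : ‖rePart ζ₀‖ ≤ r) {ε : ℝ} (hε : 0 < ε) :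
    ∀ᶠ ζ in 𝓝[{ζ | ‖rePart ζ‖ ≤ r}] ζ₀,
      ∀ x, ‖leibniz l α ζ x - leibniz l α ζ₀ x‖ * w x ≤ ε := by
  obtain ⟨B, hB⟩ := w.bounded
  have hB1 : 0 < |B| + 1 := by positivity
  set P := ∏ j, (1 + (α j : ℝ))
  have hP : 0 < P := Finset.prod_pos fun _ _ => by positivity
  -- `A` bounds the Leibniz factor for every `ζ` with `‖ζ‖ ≤ ‖ζ₀‖ + 1`.
  set A := ((1 + (‖ζ₀‖ + 1)) * P) ^ l.length
  have hA : 0 < A := by positivity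
  have h1 := h.eventually_lt_const (show 0 < ε / (2 * A) by positivity)
  rw [Metric.cobounded_eq_cocompact, Filter.eventually_iff, Filter.mem_cocompact] at h1
  obtain ⟨K, hK, hKs⟩ := h1
  have h2 : ∀ᶠ ζ in 𝓝 ζ₀, ∀ x ∈ K, ‖leibniz l α ζ x - leibniz l α ζ₀ x‖ < ε / (|B| + 1) := by
    refine hK.eventually_forall_of_forall_eventually fun x _ => ?_
    have hc : Continuous fun p : CSpace n × RSpace n =>
        ‖leibniz l α p.1 p.2 - leibniz l α ζ₀ p.2‖ := by
      have h3 := continuous_leibniz l α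
      exact (h3.sub (h3.comp (continuous_const.prodMk continuous_snd))).norm
    refine hc.continuousAt.eventually_lt_const ?_
    simp only [sub_self, norm_zero]
    positivity
  have h3 : ∀ᶠ ζ in 𝓝 ζ₀, ‖ζ‖ < ‖ζ₀‖ + 1 :=
    continuous_norm.continuousAt.eventually_lt_const (by simp)
  filter_upwards [self_mem_nhdsWithin, nhdsWithin_le_nhds h2, nhdsWithin_le_nhds h3]
    with ζ hζ hζK hζn x
  have hw := w.nonneg x
  by_cases hx : x ∈ K
  · calc ‖leibniz l α ζ x - leibniz l α ζ₀ x‖ * w x ≤ ε / (|B| + 1) * (|B| + 1) := by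
          have h4 := (hζK x hx).le
          have h5 : w x ≤ |B| + 1 := by linarith [hB x, le_abs_self B]
          gcongr
      _ = ε := by field_simp
  · have hD : max 1 ‖x‖ ^ k * Real.exp (r * ‖x‖) * w x ≤ ε / (2 * A) :=
      le_of_lt (hKs hx)
    set D := max 1 ‖x‖ ^ k * Real.exp (r * ‖x‖) * w x
    have hD0 : 0 ≤ D := by positivity
    have h4 : ∀ ζ' : CSpace n, ‖rePart ζ'‖ ≤ r → ‖ζ'‖ ≤ ‖ζ₀‖ + 1 →
        ‖leibniz l α ζ' x‖ * w x ≤ ε / 2 := by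
      intro ζ' h5 h6
      refine (norm_leibniz_mul_le l hα h5 x).trans ?_
      calc ((1 + ‖ζ'‖) * P) ^ l.length * D ≤ A * (ε / (2 * A)) := by
            refine mul_le_mul (pow_le_pow_left₀ (by positivity) ?_ _) hD hD0 hA.le
            gcongr
        _ = ε / 2 := by field_simp
    calc ‖leibniz l α ζ x - leibniz l α ζ₀ x‖ * w x
        ≤ (‖leibniz l α ζ x‖ + ‖leibniz l α ζ₀ x‖) * w x := by
          gcongr
          exact norm_sub_le _ _
      _ ≤ ε := by
          have := h4 ζ hζ hζn.le
          have := h4 ζ₀ hζ₀ (by linarith)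
          linarith

end Decay

/-! ### Realization of `C_w` in a space of bounded functions -/

section Lift

variable {n : ℕ}

/-- The Banach space of bounded functions on `S × ℝⁿ`. -/
abbrev LiftSpace (S : Finset (MultiIndex n)) : Type := lp (fun _ : S × RSpace n => ℂ) ∞

theorem memℓp_lift {w : Weight n} (S : Finset (MultiIndex n)) (f : Cw w) :
    Memℓp (fun b : S × RSpace n => multiD ℝ b.1 f.val b.2 * (w b.2 : ℂ)) ∞ := by
  refine memℓp_infty ⟨∑ β ∈ S, cwSeminorm w β f, ?_⟩
  rintro _ ⟨⟨⟨β, hβ⟩, x⟩, rfl⟩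
  simp only [norm_mul, Complex.norm_real, Real.norm_eq_abs, abs_of_nonneg (w.nonneg x)]
  exact (le_cwSeminorm w β f x).trans
    (Finset.single_le_sum (f := fun β => cwSeminorm w β f) (fun _ _ => apply_nonneg _ _) hβ)

/-- The map `f ↦ (∂^β f · w)_{β ∈ S}`. -/
noncomputable def lift (w : Weight n) (S : Finset (MultiIndex n)) : Cw w →ₗ[ℂ] LiftSpace S where
  toFun f := ⟨_, memℓp_lift S f⟩
  map_add' f g := by
    ext b
    change multiD ℝ b.1 (f.val + g.val) b.2 * (w b.2 : ℂ) =
      multiD ℝ b.1 f.val b.2 * (w b.2 : ℂ) + multiD ℝ b.1 g.val b.2 * (w b.2 : ℂ)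
    rw [(multiD_aux _).2.1 f.val g.val f.2.1 g.2.1, Pi.add_apply, add_mul]
  map_smul' c f := by
    ext b
    change multiD ℝ b.1 (c • f.val) b.2 * (w b.2 : ℂ) = c * (multiD ℝ b.1 f.val b.2 * (w b.2 : ℂ))
    rw [(multiD_aux _).2.2 c f.val f.2.1, Pi.smul_apply, smul_eq_mul, mul_assoc]

theorem lift_apply {w : Weight n} (S : Finset (MultiIndex n)) (f : Cw w) (b : S × RSpace n) :
    lift w S f b = multiD ℝ b.1 f.val b.2 * (w b.2 : ℂ) := rfl

theorem sup_cwSeminorm_le_norm_lift {w : Weight n} (S : Finset (MultiIndex n)) (f : Cw w) :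
    (S.sup (cwSeminorm w)) f ≤ ‖lift w S f‖ := by
  refine Seminorm.finset_sup_apply_le (norm_nonneg _) fun β hβ => cwSeminorm_le fun x => ?_
  have := lp.norm_apply_le_norm (p := ∞) (by simp) (lift w S f) (⟨β, hβ⟩, x)
  rwa [lift_apply, norm_mul, Complex.norm_real, Real.norm_eq_abs, abs_of_nonneg (w.nonneg x)]
    at this

theorem exists_bound_dualOrder {w : Weight n} (T : CwDual w) :
    ∃ S : Finset (MultiIndex n), S.sup order = dualOrder T ∧
      ∃ C : ℝ, 0 < C ∧ ∀ f : Cw w, ‖T f‖ ≤ C * (S.sup (cwSeminorm w)) f := by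
  have hne : {N : ℕ | ∃ S : Finset (MultiIndex n), S.sup order = N ∧
    ∃ C : ℝ, ∀ f : Cw w, ‖T f‖ ≤ C * (S.sup (cwSeminorm w)) f}.Nonempty := by
    -- Continuity of `T` yields some admissible `S`, so the infimum defining the order is attained
    -- and is not the default value of `sInf ∅`.
    let q : Seminorm ℂ (Cw w) := (normSeminorm ℂ ℂ).comp T.toLinearMap
    have hq : Continuous q := continuous_norm.comp T.continuous
    obtain ⟨S, C, -, hC⟩ := Seminorm.bound_of_continuous (Cw.withSeminorms w) q hq
    exact ⟨_, S, rfl, C, fun f => hC f⟩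
  obtain ⟨S, hS, C, hC⟩ := Nat.sInf_mem hne
  refine ⟨S, hS, max C 1, lt_max_of_lt_right one_pos, fun f => (hC f).trans ?_⟩
  exact mul_le_mul_of_nonneg_right (le_max_left _ _) (apply_nonneg _ _)

/-- Hahn–Banach: a functional dominated by `‖J ·‖` extends along `J`. -/
theorem exists_extension_along {V E : Type*} [AddCommGroup V] [Module ℂ V]
    [NormedAddCommGroup E] [NormedSpace ℂ E] (J : V →ₗ[ℂ] E) (T : V →ₗ[ℂ] ℂ) (C : ℝ)
    (hC : ∀ f, ‖T f‖ ≤ C * ‖J f‖) : ∃ T' : E →L[ℂ] ℂ, ∀ f, T f = T' (J f) := by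
  -- A linear section of `J` transports `T` to the range of `J`, where the hypothesis makes it
  -- bounded.
  obtain ⟨g, hg⟩ := J.rangeRestrict.exists_rightInverse_of_surjective
    (LinearMap.range_rangeRestrict _)
  have hg' : ∀ y : LinearMap.range J, J (g y) = y := fun y =>
    congrArg Subtype.val (LinearMap.congr_fun hg y)
  let T₀ : LinearMap.range J →L[ℂ] ℂ :=
    (T.comp g).mkContinuous C fun y => by
      simpa [hg'] using hC (g y)
  obtain ⟨T', hT', -⟩ := exists_extension_norm_eq (LinearMap.range J) T₀
  refine ⟨T', fun f => ?_⟩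
  have h1 := hT' ⟨J f, f, rfl⟩
  rw [h1]
  change T f = T (g _)
  -- `f` and `g (J f)` differ by an element of the kernel of `J`, on which the bound forces `T` to
  -- vanish.
  rw [← sub_eq_zero, ← map_sub, ← norm_le_zero_iff]
  refine (hC _).trans ?_
  rw [map_sub, hg', sub_self, norm_zero, mul_zero]

/-- A continuous functional on `C_w` factors through a space of bounded functions. -/
theorem exists_factorization {w : Weight n} (T : CwDual w) :
    ∃ (S : Finset (MultiIndex n)) (T' : LiftSpace S →L[ℂ] ℂ), ∀ f, T f = T' (lift w S f) := by
  obtain ⟨S, -, C, hC0, hC⟩ := exists_bound_dualOrder T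
  exact ⟨S, exists_extension_along (lift w S) T.toLinearMap C fun f =>
    (hC f).trans (mul_le_mul_of_nonneg_left (sup_cwSeminorm_le_norm_lift S f) hC0.le)⟩

theorem lp_evalCLM_apply (𝕜 : Type*) {ι : Type*} [RCLike 𝕜] [NormedAlgebra 𝕜 ℂ]
    (f : lp (fun _ : ι => ℂ) ∞) (b : ι) : lp.evalCLM 𝕜 (fun _ : ι => ℂ) ∞ b f = f b := rfl

theorem eventually_norm_sub_lt {X E : Type*} [TopologicalSpace X] [SeminormedAddCommGroup E]
    {f : X → E} {x₀ : X} (hc : ContinuousAt f x₀) {ε : ℝ} (hε : 0 < ε) :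
    ∀ᶠ x in 𝓝 x₀, ‖f x - f x₀‖ < ε := by
  filter_upwards [Metric.tendsto_nhds.mp hc ε hε] with x hx
  rwa [dist_eq_norm] at hx

/-- A map into a normed space that is differentiable along a norming family of functionals,
with derivatives that fit together continuously, is differentiable. -/
theorem hasFDerivAt_of_norming {𝕜 V E ι : Type*} [RCLike 𝕜] [NormedAlgebra 𝕜 ℂ]
    [NormedAddCommGroup V] [NormedSpace 𝕜 V] [NormedAddCommGroup E] [NormedSpace 𝕜 E]
    (ev : ι → E →L[𝕜] ℂ) (hev : ∀ b y, ‖ev b y‖ ≤ ‖y‖)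
    (hnorm : ∀ (y : E) (C : ℝ), 0 ≤ C → (∀ b, ‖ev b y‖ ≤ C) → ‖y‖ ≤ C)
    {f : V → E} {f' : V → V →L[𝕜] E} {v₀ : V}
    (hf : ∀ᶠ v in 𝓝 v₀, ∀ b, HasFDerivAt (𝕜 := 𝕜) (fun v => ev b (f v)) ((ev b).comp (f' v)) v)
    (hc : ContinuousAt f' v₀) : HasFDerivAt f (f' v₀) v₀ := by
  rw [hasFDerivAt_iff_isLittleO, Asymptotics.isLittleO_iff]
  intro ε hε
  obtain ⟨δ, hδ, hball⟩ := Metric.eventually_nhds_iff_ball.mp (hf.and (eventually_norm_sub_lt hc hε))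
  filter_upwards [Metric.ball_mem_nhds v₀ hδ] with v hv
  refine hnorm _ _ (by positivity) fun b => ?_
  let _ : NormedSpace ℝ V := NormedSpace.restrictScalars ℝ 𝕜 V
  -- The mean value inequality is applied to each scalar function `ev b ∘ f`; the constant `ε` does
  -- not depend on `b`, so the norming property recovers the norm in `E`.
  have := (convex_ball v₀ δ).norm_image_sub_le_of_norm_hasFDerivWithin_le' (𝕜 := 𝕜)
    (f := fun v => ev b (f v)) (f' := fun v => (ev b).comp (f' v))
    (φ := (ev b).comp (f' v₀)) (C := ε)
    (fun v hv => ((hball v hv).1 b).hasFDerivWithinAt) (fun v hv => ?_)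
    (Metric.mem_ball_self hδ) hv
  · simpa using this
  · refine ContinuousLinearMap.opNorm_le_bound _ hε.le fun u => ?_
    refine le_trans (le_of_eq ?_) ((hev b ((f' v - f' v₀) u)).trans
      (((f' v - f' v₀).le_opNorm u).trans
        (mul_le_mul_of_nonneg_right (hball v hv).2.le (norm_nonneg _))))
    simp

open Classical in
/-- The image of `x^α e_ζ` under `lift`; zero if this function is not in `C_w`. -/
noncomputable def liftMono (w : Weight n) (S : Finset (MultiIndex n)) (α : MultiIndex n)
    (ζ : CSpace n) : LiftSpace S :=
  if h : monoExp α ζ ∈ cwSubmodule w then lift w S (Cw.mk _ h) else 0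

theorem liftMono_eq {w : Weight n} (S : Finset (MultiIndex n)) {α : MultiIndex n} {ζ : CSpace n}
    (h : monoExp α ζ ∈ cwSubmodule w) : liftMono w S α ζ = lift w S (Cw.mk _ h) := dif_pos h

theorem liftMono_apply {w : Weight n} (S : Finset (MultiIndex n)) {α : MultiIndex n}
    {ζ : CSpace n} (h : monoExp α ζ ∈ cwSubmodule w) (b : S × RSpace n) :
    liftMono w S α ζ b = leibniz (wordOf b.1.1).reverse α ζ b.2 * (w b.2 : ℂ) := by
  rw [liftMono_eq S h, lift_apply, multiD_eq_wordD, ← wordD_monoExp]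
  rfl

theorem continuousOn_liftMono {w : Weight n} (S : Finset (MultiIndex n)) {k : ℕ} {r : ℝ}
    (h : w.DecaysExp k r) {α : MultiIndex n} (hα : order α ≤ k) :
    ContinuousOn (liftMono w S α) {ζ | ‖rePart ζ‖ ≤ r} := by
  intro ζ₀ hζ₀
  rw [ContinuousWithinAt, Metric.tendsto_nhds]
  intro ε hε
  have h1 : ∀ᶠ ζ in 𝓝[{ζ | ‖rePart ζ‖ ≤ r}] ζ₀, ∀ β : S, ∀ x,
      ‖leibniz (wordOf β.1).reverse α ζ x - leibniz (wordOf β.1).reverse α ζ₀ x‖ * w x ≤ ε / 2 :=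
    Filter.eventually_all.mpr fun β => eventually_leibniz_close h _ hα hζ₀ (half_pos hε)
  filter_upwards [h1, self_mem_nhdsWithin] with ζ hζ hζr
  rw [dist_eq_norm]
  refine (lp.norm_le_of_forall_le (half_pos hε).le fun b => ?_).trans_lt (half_lt_self hε)
  rw [lp.coeFn_sub, Pi.sub_apply, liftMono_apply S (monoExp_mem h hα hζr),
    liftMono_apply S (monoExp_mem h hα hζ₀), ← sub_mul, norm_mul, Complex.norm_real,
    Real.norm_eq_abs, abs_of_nonneg (w.nonneg _)]
  exact hζ b.1 b.2

/-- Point evaluations norm the space of bounded functions, and at each of them the derivative is the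
one of `leibniz`. The linear map `A` allows one proof for real `λ` and for complex `λ`, where it is
multiplication by `-i`. -/
theorem hasFDerivAt_liftMono {𝕜 V : Type*} [RCLike 𝕜] [NormedAlgebra 𝕜 ℂ]
    [NormedAddCommGroup V] [NormedSpace 𝕜 V]
    {w : Weight n} (S : Finset (MultiIndex n)) {k : ℕ} {r : ℝ}
    (h : w.DecaysExp k r) {α : MultiIndex n} (hα : order α + 1 ≤ k) (A : V →L[𝕜] CSpace n) {v₀ : V}
    (hA : ∀ᶠ v in 𝓝 v₀, ‖rePart (A v)‖ ≤ r) :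
    HasFDerivAt (fun v => liftMono w S α (A v))
      (∑ j, ((ContinuousLinearMap.lsmul 𝕜 ℂ).flip (liftMono w S (raise α j) (A v₀))).comp
        (((EuclideanSpace.proj j : CSpace n →L[ℂ] ℂ).restrictScalars 𝕜).comp A)) v₀ := by
  have hr : ∀ j, order (raise α j) ≤ k := fun j => by rw [order_raise]; exact hα
  refine hasFDerivAt_of_norming (fun b => lp.evalCLM 𝕜 (fun _ : S × RSpace n => ℂ) ∞ b)
    (fun b y => lp.norm_apply_le_norm (p := ∞) (by simp) y b)
    (fun y C hC h => lp.norm_le_of_forall_le hC h) (f' := fun v => ∑ j, ((ContinuousLinearMap.lsmul 𝕜 ℂ).flip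
    (liftMono w S (raise α j) (A v))).comp
      (((EuclideanSpace.proj j : CSpace n →L[ℂ] ℂ).restrictScalars 𝕜).comp A)) ?_ ?_
  · filter_upwards [hA.eventually_nhds] with v hv b
    have h1 : (fun v => liftMono w S α (A v) b) =ᶠ[𝓝 v]
        fun v => leibniz (wordOf b.1.1).reverse α (A v) b.2 * (w b.2 : ℂ) := by
      filter_upwards [hv] with u hu
      exact liftMono_apply S (monoExp_mem h ((Nat.le_succ _).trans hα) hu) b
    refine HasFDerivAt.congr_of_eventuallyEq ?_ h1
    have h2 := (((hasFDerivAt_leibniz (wordOf b.1.1).reverse α (A v) b.2).restrictScalars 𝕜).comp v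
      A.hasFDerivAt).mul_const (w b.2 : ℂ)
    convert! h2 using 1
    ext u
    simp only [ContinuousLinearMap.comp_apply, _root_.sum_apply, map_sum, _root_.smul_apply,
      ContinuousLinearMap.flip_apply, ContinuousLinearMap.lsmul_apply, smul_eq_mul,
      ContinuousLinearMap.coe_restrictScalars', Finset.mul_sum, PiLp.proj_apply]
    refine Finset.sum_congr rfl fun j _ => ?_
    rw [lp_evalCLM_apply, lp.coeFn_smul, Pi.smul_apply,
      liftMono_apply S (monoExp_mem h (hr j) hv.self_of_nhds), smul_eq_mul]
    ring
  · have h1 : ∀ j, ContinuousAt (fun v => liftMono w S (raise α j) (A v)) v₀ := fun j => by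
      have h2 := continuousOn_liftMono S h (hr j) (A v₀) hA.self_of_nhds
      exact h2.tendsto.comp (tendsto_nhdsWithin_iff.mpr ⟨A.continuous.continuousAt, hA⟩)
    refine tendsto_finsetSum _ fun j _ => ?_
    have h3 := ((ContinuousLinearMap.lsmul 𝕜 ℂ :
      ℂ →L[𝕜] LiftSpace S →L[𝕜] LiftSpace S).flip.continuous.continuousAt).comp (h1 j)
    exact h3.clm_comp continuousAt_const

end Lift

/-! ### Functionals evaluated at monomial exponentials -/

section EvalMono

variable {n : ℕ}

open Classical in
/-- `⟨T, x^α e_ζ⟩`, and zero if `x^α e_ζ` is not in `C_w`. -/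
noncomputable def evalMono {w : Weight n} (T : CwDual w) (α : MultiIndex n) (ζ : CSpace n) : ℂ :=
  if h : monoExp α ζ ∈ cwSubmodule w then T (Cw.mk _ h) else 0

theorem evalMono_eq {w : Weight n} (T : CwDual w) {α : MultiIndex n} {ζ : CSpace n}
    (h : monoExp α ζ ∈ cwSubmodule w) : evalMono T α ζ = T (Cw.mk _ h) := dif_pos h

theorem evalMono_eq_liftMono {w : Weight n} {T : CwDual w} {S : Finset (MultiIndex n)}
    {T' : LiftSpace S →L[ℂ] ℂ} (hT : ∀ f, T f = T' (lift w S f)) (α : MultiIndex n)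
    (ζ : CSpace n) : evalMono T α ζ = T' (liftMono w S α ζ) := by
  by_cases h : monoExp α ζ ∈ cwSubmodule w
  · rw [evalMono_eq T h, liftMono_eq S h, hT]
  · rw [evalMono, liftMono, dif_neg h, dif_neg h, map_zero]

theorem continuousOn_evalMono {w : Weight n} (T : CwDual w) {k : ℕ} {r : ℝ}
    (h : w.DecaysExp k r) {α : MultiIndex n} (hα : order α ≤ k) :
    ContinuousOn (evalMono T α) {ζ | ‖rePart ζ‖ ≤ r} := by
  obtain ⟨S, T', hT⟩ := exists_factorization T
  rw [show evalMono T α = fun ζ => T' (liftMono w S α ζ) from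
    funext (evalMono_eq_liftMono hT α)]
  exact T'.continuous.comp_continuousOn (continuousOn_liftMono S h hα)

theorem hasFDerivAt_evalMono {𝕜 V : Type*} [RCLike 𝕜] [NormedAlgebra 𝕜 ℂ]
    [NormedAddCommGroup V] [NormedSpace 𝕜 V]
    {w : Weight n} (T : CwDual w) {k : ℕ} {r : ℝ}
    (h : w.DecaysExp k r) {α : MultiIndex n} (hα : order α + 1 ≤ k) (A : V →L[𝕜] CSpace n) {v₀ : V}
    (hA : ∀ᶠ v in 𝓝 v₀, ‖rePart (A v)‖ ≤ r) :
    HasFDerivAt (fun v => evalMono T α (A v))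
      (∑ j, evalMono T (raise α j) (A v₀) •
        (((EuclideanSpace.proj j : CSpace n →L[ℂ] ℂ).restrictScalars 𝕜).comp A)) v₀ := by
  obtain ⟨S, T', hT⟩ := exists_factorization T
  have h1 := ((T'.restrictScalars 𝕜).hasFDerivAt).comp v₀ (hasFDerivAt_liftMono S h hα A hA)
  convert! h1 using 1
  · exact funext fun v => evalMono_eq_liftMono hT α (A v)
  · ext u
    simp only [ContinuousLinearMap.comp_apply, _root_.sum_apply, map_sum, _root_.smul_apply,
      ContinuousLinearMap.flip_apply, ContinuousLinearMap.lsmul_apply, smul_eq_mul,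
      ContinuousLinearMap.coe_restrictScalars', PiLp.proj_apply, map_smul]
    exact Finset.sum_congr rfl fun j _ => by rw [evalMono_eq_liftMono hT, mul_comm]

/-! ### The growth bound governed by the order of the functional. -/

theorem maxMono_le_prod_one_add (α : MultiIndex n) (x : RSpace n) :
    maxMono α x ≤ ∏ j, (1 + |x j| ^ α j) := by
  refine Finset.prod_le_prod (fun _ _ => by positivity) fun j _ => ?_
  rcases max_cases 1 |x j| with h | h
  · rw [h.1, one_pow]; exact le_add_of_nonneg_right (by positivity)
  · rw [h.1]; exact le_add_of_nonneg_left zero_le_one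

theorem norm_le_toReal_supNorm {X V : Type} [NormedAddCommGroup V] {g : X → V}
    (h : supNorm g ≠ ⊤) (x : X) : ‖g x‖ ≤ (supNorm g).toReal := by
  have h1 : ‖g x‖ₑ ≤ supNorm g := le_iSup (fun x => ‖g x‖ₑ) x
  have h2 := ENNReal.toReal_mono h h1
  rwa [toReal_enorm] at h2

/-- The bound on `⟨T, x^α e_ζ⟩` in terms of the order of `T`. -/
theorem exists_enorm_evalMono_le {w : Weight n} (T : CwDual w) :
    ∃ C : ℝ, 0 < C ∧ ∀ (α : MultiIndex n) (ζ : CSpace n), ‖evalMono T α ζ‖ₑ ≤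
      ENNReal.ofReal (C * (1 + ‖ζ‖) ^ dualOrder T * ∏ j, (1 + (α j : ℝ)) ^ dualOrder T) *
        supNorm (fun x : RSpace n => (∏ j, (1 + |x j| ^ α j)) *
          Real.exp (inner ℝ (rePart ζ) x) * w x) := by
  obtain ⟨S, hS, C, hC0, hC⟩ := exists_bound_dualOrder T
  refine ⟨C, hC0, fun α ζ => ?_⟩
  set N := dualOrder T
  set s := supNorm (fun x : RSpace n => (∏ j, (1 + |x j| ^ α j)) *
          Real.exp (inner ℝ (rePart ζ) x) * w x) with hs
  set P := ∏ j, (1 + (α j : ℝ)) with hPdef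
  have hP1 : 1 ≤ P := Finset.one_le_prod fun j => by simp
  have hPN : ∏ j, (1 + (α j : ℝ)) ^ N = P ^ N := Finset.prod_pow _ _ _
  rw [hPN]
  have hpos : 0 < C * (1 + ‖ζ‖) ^ N * P ^ N := by positivity
  -- With an infinite supremum the right-hand side is infinite, since the first factor is positive;
  -- otherwise everything can be done in `ℝ`.
  by_cases hsf : s = ⊤
  · rw [hsf, ENNReal.mul_top (by simpa using! hpos)]
    exact le_top
  by_cases h : monoExp α ζ ∈ cwSubmodule w
  swap
  · rw [evalMono, dif_neg h]; simp
  rw [evalMono_eq T h]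
  have hbound : ‖T (Cw.mk _ h)‖ ≤ C * (1 + ‖ζ‖) ^ N * P ^ N * s.toReal := by
    refine (hC _).trans ?_
    have : (S.sup (cwSeminorm w)) (Cw.mk _ h) ≤ ((1 + ‖ζ‖) * P) ^ N * s.toReal := by
      refine Seminorm.finset_sup_apply_le (by positivity) fun β hβ => cwSeminorm_le fun x => ?_
      change ‖multiD ℝ β (monoExp α ζ) x‖ * w x ≤ _
      rw [multiD_eq_wordD, wordD_monoExp]
      have hβN : order β ≤ N := hS ▸ Finset.le_sup (f := order) hβ
      have h1 := norm_leibniz_le (wordOf β).reverse α ζ x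
      rw [List.length_reverse, length_wordOf] at h1
      have h2 : ((1 + ‖ζ‖) * P) ^ order β ≤ ((1 + ‖ζ‖) * P) ^ N :=
        pow_le_pow_right₀ (one_le_mul_of_one_le_of_one_le
          (le_add_of_nonneg_right (norm_nonneg _)) hP1) hβN
      have h3 := maxMono_le_prod_one_add α x
      have h4 := maxMono_nonneg α x
      have h5 := (Real.le_norm_self _).trans (norm_le_toReal_supNorm hsf x)
      have h6 := w.nonneg x
      calc ‖leibniz (wordOf β).reverse α ζ x‖ * w x
          ≤ (((1 + ‖ζ‖) * P) ^ N * (∏ j, (1 + |x j| ^ α j)) *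
              Real.exp (inner ℝ (rePart ζ) x)) * w x := by
            refine mul_le_mul_of_nonneg_right (h1.trans ?_) h6
            gcongr
        _ = ((1 + ‖ζ‖) * P) ^ N * ((∏ j, (1 + |x j| ^ α j)) *
              Real.exp (inner ℝ (rePart ζ) x) * w x) := by ring
        _ ≤ _ := by gcongr
    calc C * (S.sup (cwSeminorm w)) (Cw.mk _ h) ≤ C * (((1 + ‖ζ‖) * P) ^ N * s.toReal) := by gcongr
      _ = _ := by rw [mul_pow]; ring
  rw [← ENNReal.ofReal_toReal hsf, ← ENNReal.ofReal_mul hpos.le, ← ofReal_norm]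
  exact ENNReal.ofReal_le_ofReal hbound

end EvalMono

/-! ### The transform and its derivatives -/

section Transform

variable {n : ℕ}

theorem rePart_neg_I_smul (l : CSpace n) : rePart (-Complex.I • l) = imPart l := by
  ext j
  simp [rePart, imPart]

theorem imPart_toC (l : RSpace n) : imPart (toC l) = 0 := by
  ext j
  simp [imPart, toC]

theorem norm_toC (l : RSpace n) : ‖toC l‖ = ‖l‖ := by
  simp [EuclideanSpace.norm_eq, toC]

/-- The map `l ↦ -i l` from `ℝⁿ` to `ℂⁿ`. -/
noncomputable def negIReal (n : ℕ) : RSpace n →L[ℝ] CSpace n :=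
  LinearMap.toContinuousLinearMap
    { toFun := fun l => -Complex.I • toC l
      map_add' := fun l m => by ext j; simp [toC]; ring
      map_smul' := fun c l => by ext j; simp [toC]; ring }

/-- The map `l ↦ -i l` on `ℂⁿ`. -/
noncomputable def negIComplex (n : ℕ) : CSpace n →L[ℂ] CSpace n :=
  -Complex.I • ContinuousLinearMap.id ℂ (CSpace n)

theorem negIReal_apply (l : RSpace n) : negIReal n l = -Complex.I • toC l := rfl

theorem negIComplex_apply (l : CSpace n) : negIComplex n l = -Complex.I • l := rfl

theorem rePart_negIReal (l : RSpace n) : rePart (negIReal n l) = 0 := by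
  rw [negIReal_apply, rePart_neg_I_smul, imPart_toC]

/-- The right-hand side `(2π)^{-n/2} (-i)^{|α|} ⟨T, x^α e_{-iλ}⟩` of the formula for the
derivatives of the transform. -/
noncomputable def transform {w : Weight n} (T : CwDual w) (α : MultiIndex n) (l : CSpace n) : ℂ :=
  fourierConst n * (-Complex.I) ^ order α * evalMono T α (-Complex.I • l)

/-- The factor `I` compensates the additional `-I` in the normalization of `transform T (raise α
j)`. It cancels once `A` is written out as multiplication by `-i`. -/
theorem hasFDerivAt_transform {𝕜 V : Type*} [RCLike 𝕜] [NormedAlgebra 𝕜 ℂ]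
    [NormedAddCommGroup V] [NormedSpace 𝕜 V]
    {w : Weight n} (T : CwDual w) {k : ℕ} {r : ℝ}
    (h : w.DecaysExp k r) {α : MultiIndex n} (hα : order α + 1 ≤ k) (A : V →L[𝕜] CSpace n)
    (B : V → CSpace n) (hAB : ∀ v, A v = -Complex.I • B v) {v₀ : V}
    (hA : ∀ᶠ v in 𝓝 v₀, ‖imPart (B v)‖ ≤ r) :
    HasFDerivAt (fun v => transform T α (B v))
      (∑ j, (Complex.I * transform T (raise α j) (B v₀)) •
        (((EuclideanSpace.proj j : CSpace n →L[ℂ] ℂ).restrictScalars 𝕜).comp A)) v₀ := by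
  have h1 := (hasFDerivAt_evalMono T h hα A (v₀ := v₀) (by
    filter_upwards [hA] with v hv
    rwa [hAB, rePart_neg_I_smul])).const_mul (fourierConst n * (-Complex.I) ^ order α)
  simp only [hAB] at h1
  convert! h1 using 1
  rw [Finset.smul_sum]
  refine Finset.sum_congr rfl fun j _ => ?_
  rw [smul_smul, transform, order_raise, pow_succ]
  congr 1
  linear_combination (-fourierConst n * (-Complex.I) ^ order α *
    evalMono T (raise α j) (-Complex.I • B v₀)) * Complex.I_mul_I

/-- A family in which `∂_j` raises the index contains all iterated derivatives of its member at `0`,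
by induction along words. Openness of `U` is needed because the induction hypothesis must hold near
`v` before differentiating again. -/
theorem multiD_eq_of_hasLineDerivAt {𝕜 : Type} [RCLike 𝕜] [NormedSpace 𝕜 ℂ] {d : ℕ∞}
    {H : MultiIndex n → EuclideanSpace 𝕜 (Fin n) → ℂ} {U : Set (EuclideanSpace 𝕜 (Fin n))}
    (hU : IsOpen U) (hH : ∀ α j, ((order α + 1 : ℕ) : ℕ∞) ≤ d → ∀ v ∈ U,
      HasLineDerivAt 𝕜 (H α) (H (raise α j) v) v (EuclideanSpace.single j (1 : 𝕜)))
    {α : MultiIndex n} (hα : (order α : ℕ∞) ≤ d) {v : EuclideanSpace 𝕜 (Fin n)} (hv : v ∈ U) :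
    multiD 𝕜 α (H 0) v = H α v := by
  have key : ∀ l : List (Fin n), (l.length : ℕ∞) ≤ d → ∀ v ∈ U,
      wordD 𝕜 l (H 0) v = H (fun j => l.count j) v ∧ order (fun j => l.count j) = l.length := by
    intro l
    induction l with
    | nil => exact fun _ v _ => ⟨rfl, by simp [order]⟩
    | cons j l ih =>
      intro hl v hv
      have hl' : (l.length : ℕ∞) ≤ d := le_trans (by simp) hl
      have hr : (fun i => (j :: l).count i) = raise (fun i => l.count i) j := by
        funext i
        by_cases hij : i = j
        · subst hij; simp [raise]
        · simp [raise, hij, List.count_cons_of_ne (Ne.symm hij)]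
      have ho := (ih hl' v hv).2
      refine ⟨?_, by rw [hr, order_raise, ho, List.length_cons]⟩
      rw [wordD_cons, hr, partialD]
      have he : wordD 𝕜 l (H 0) =ᶠ[𝓝 v] H (fun j => l.count j) := by
        filter_upwards [hU.mem_nhds hv] with u hu using (ih hl' u hu).1
      rw [he.lineDeriv_eq]
      exact (hH _ j (by rw [ho]; simpa using hl) v hv).lineDeriv
  rw [multiD_eq_wordD, (key _ (by rwa [length_wordOf]) v hv).1]
  congr 1
  funext j
  exact count_wordOf α j

theorem hasFDerivAt_transform_real {w : Weight n} (T : CwDual w) {k : ℕ} (h : w.DecaysExp k 0)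
    {α : MultiIndex n} (hα : order α + 1 ≤ k) (l : RSpace n) :
    HasFDerivAt (fun l => transform T α (toC l))
      (∑ j, transform T (raise α j) (toC l) •
        (Complex.ofRealCLM.comp (EuclideanSpace.proj j : RSpace n →L[ℝ] ℝ))) l := by
  have h1 := hasFDerivAt_transform T h hα (negIReal n) toC negIReal_apply (v₀ := l)
    (Filter.Eventually.of_forall fun v => by rw [imPart_toC, norm_zero])
  convert! h1 using 1
  refine Finset.sum_congr rfl fun j _ => ?_
  ext v
  simp only [_root_.smul_apply, ContinuousLinearMap.comp_apply, smul_eq_mul,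
    ContinuousLinearMap.coe_restrictScalars', PiLp.proj_apply, negIReal_apply, PiLp.smul_apply,
    Complex.ofRealCLM_apply, toC]
  linear_combination (transform T (raise α j) (WithLp.toLp 2 fun j => (l j : ℂ)) * (v j : ℂ)) *
    Complex.I_mul_I

theorem hasFDerivAt_transform_complex {w : Weight n} (T : CwDual w) {k : ℕ} {r : ℝ}
    (h : w.DecaysExp k r) {α : MultiIndex n} (hα : order α + 1 ≤ k) {l : CSpace n}
    (hl : ∀ᶠ v in 𝓝 l, ‖imPart v‖ ≤ r) :
    HasFDerivAt (transform T α)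
      (∑ j, transform T (raise α j) l • (EuclideanSpace.proj j : CSpace n →L[ℂ] ℂ)) l := by
  have h1 := hasFDerivAt_transform T h hα (negIComplex n) id negIComplex_apply (v₀ := l) hl
  convert! h1 using 1
  refine Finset.sum_congr rfl fun j _ => ?_
  ext v
  simp only [_root_.smul_apply, ContinuousLinearMap.comp_apply, smul_eq_mul,
    ContinuousLinearMap.coe_restrictScalars', PiLp.proj_apply, negIComplex_apply, PiLp.smul_apply,
    id]
  linear_combination (transform T (raise α j) l * v j) * Complex.I_mul_I

theorem hasLineDerivAt_transform_real {w : Weight n} (T : CwDual w) {k : ℕ} (h : w.DecaysExp k 0)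
    {α : MultiIndex n} (hα : order α + 1 ≤ k) (j : Fin n) (l : RSpace n) :
    HasLineDerivAt ℝ (fun l => transform T α (toC l)) (transform T (raise α j) (toC l)) l
      (EuclideanSpace.single j (1 : ℝ)) := by
  have h1 := (hasFDerivAt_transform_real T h hα l).hasLineDerivAt (EuclideanSpace.single j (1 : ℝ))
  convert! h1 using 1
  simp [apply_ite Complex.ofReal]

theorem hasLineDerivAt_transform_complex {w : Weight n} (T : CwDual w) {k : ℕ} {r : ℝ}
    (h : w.DecaysExp k r) {α : MultiIndex n} (hα : order α + 1 ≤ k) (j : Fin n) {l : CSpace n}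
    (hl : ∀ᶠ v in 𝓝 l, ‖imPart v‖ ≤ r) :
    HasLineDerivAt ℂ (transform T α) (transform T (raise α j) l) l
      (EuclideanSpace.single j (1 : ℂ)) := by
  have h1 := (hasFDerivAt_transform_complex T h hα hl).hasLineDerivAt
    (EuclideanSpace.single j (1 : ℂ))
  convert! h1 using 1
  simp

theorem continuous_transform_real {w : Weight n} (T : CwDual w) {k : ℕ} (h : w.DecaysExp k 0)
    {α : MultiIndex n} (hα : order α ≤ k) : Continuous fun l => transform T α (toC l) := by
  have h1 : Continuous fun l : RSpace n => evalMono T α (-Complex.I • toC l) :=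
    (continuousOn_evalMono T h hα).comp_continuous (negIReal n).continuous fun l => by
      exact (congrArg norm (rePart_negIReal l)).trans norm_zero |>.le
  exact continuous_const.mul h1

/-- Induction on `m`: the derivative involves only the indices `raise α j`, so each derivative
spends one unit of the decay `k`. -/
theorem contDiff_transform_real {w : Weight n} (T : CwDual w) {k : ℕ} (h : w.DecaysExp k 0)
    (m : ℕ) {α : MultiIndex n} (hα : order α + m ≤ k) :
    ContDiff ℝ m fun l => transform T α (toC l) := by
  induction m generalizing α with
  | zero => exact contDiff_zero.mpr (continuous_transform_real T h hα)
  | succ m ih =>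
    rw [Nat.cast_succ, contDiff_succ_iff_hasFDerivAt]
    refine ⟨_, ?_, fun l => hasFDerivAt_transform_real T h (by omega) l⟩
    exact ContDiff.sum fun j _ => (ih (by rw [order_raise]; omega)).smul contDiff_const

theorem Weight.InClass.decaysExp {w : Weight n} {d : ℕ∞} (h : w.InClass d) {k : ℕ}
    (hk : (k : ℕ∞) ≤ d) : w.DecaysExp k 0 := by
  induction d using ENat.recTopCoe with
  | top => exact Weight.Decays.decaysExp (h k)
  | coe d => exact (Weight.Decays.decaysExp (w := w) (k := d) h).mono (by exact_mod_cast hk)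

end Transform

/-! ### The map from the dual of `C_w` to the tempered distributions -/

section Tempered

variable {n : ℕ}

/-- The inclusion of the Schwartz space in `C_w`. -/
noncomputable def schwartzIncl (w : Weight n) : 𝓢(RSpace n, ℂ) →ₗ[ℂ] Cw w where
  toFun f := Cw.mk f (schwartz_mem_cwSubmodule w f)
  map_add' _ _ := rfl
  map_smul' _ _ := rfl

/-- As `w` is bounded, `p_β` is dominated by the sup norm of `∂^β f`. The same `S` therefore serves
for the continuity on Schwartz functions and for the order as a distribution. -/
theorem exists_bound_norm_schwartzIncl {w : Weight n} (T : CwDual w) :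
    ∃ S : Finset (MultiIndex n), S.sup order = dualOrder T ∧ ∃ C : ℝ, 0 < C ∧
      ∀ (f : 𝓢(RSpace n, ℂ)) (s : ℝ), 0 ≤ s → (∀ β ∈ S, ∀ x, ‖multiD ℝ β f x‖ ≤ s) →
        ‖T (schwartzIncl w f)‖ ≤ C * s := by
  obtain ⟨S, hS, C, hC0, hC⟩ := exists_bound_dualOrder T
  obtain ⟨B, hB⟩ := w.bounded
  refine ⟨S, hS, C * (|B| + 1), by positivity, fun f s hs h => (hC _).trans ?_⟩
  have : (S.sup (cwSeminorm w)) (schwartzIncl w f) ≤ s * (|B| + 1) := by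
    refine Seminorm.finset_sup_apply_le (by positivity) fun β hβ => cwSeminorm_le fun x => ?_
    have h1 := h β hβ x
    have h2 : w x ≤ |B| + 1 := by linarith [hB x, le_abs_self B]
    exact mul_le_mul h1 h2 (w.nonneg x) hs
  calc C * (S.sup (cwSeminorm w)) (schwartzIncl w f) ≤ C * (s * (|B| + 1)) := by gcongr
    _ = _ := by ring

theorem continuous_comp_schwartzIncl {w : Weight n} (T : CwDual w) :
    Continuous fun f => T (schwartzIncl w f) := by
  obtain ⟨S, -, C, hC0, hC⟩ := exists_bound_norm_schwartzIncl T
  let q : MultiIndex n → 𝓢(RSpace n, ℂ) → ℝ := fun β f =>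
    ‖SchwartzMap.toBoundedContinuousFunctionCLM ℂ (RSpace n) ℂ (schwartzWordD (wordOf β) f)‖
  have hq : Continuous fun f => C * ∑ β ∈ S, q β f :=
    continuous_const.mul (continuous_finsetSum _ fun β _ =>
      ((ContinuousLinearMap.continuous _).comp (schwartzWordD (wordOf β)).continuous).norm)
  have hb : ∀ f, ‖T (schwartzIncl w f)‖ ≤ C * ∑ β ∈ S, q β f := fun f => by
    refine hC f _ (Finset.sum_nonneg fun β _ => norm_nonneg _) fun β hβ x => ?_
    rw [multiD_eq_wordD, ← schwartzWordD_coe]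
    refine le_trans ?_ (Finset.single_le_sum (f := fun β => q β f)
      (fun _ _ => norm_nonneg _) hβ)
    exact BoundedContinuousFunction.norm_coe_le_norm
      (SchwartzMap.toBoundedContinuousFunctionCLM ℂ (RSpace n) ℂ (schwartzWordD (wordOf β) f)) x
  refine continuous_of_continuousAt_zero (T.toLinearMap.comp (schwartzIncl w)) ?_
  rw [ContinuousAt, map_zero]
  refine squeeze_zero_norm hb ?_
  have := hq.tendsto 0
  simpa [q] using this

/-- The natural map from the dual of `C_w` to the tempered distributions. -/
noncomputable def toTempered (w : Weight n) : CwDual w →ₗ[ℂ] 𝓢'(RSpace n, ℂ) where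
  toFun T := ContinuousLinearMap.toPointwiseConvergenceCLM _ _ _ _
    ⟨T.toLinearMap.comp (schwartzIncl w), continuous_comp_schwartzIncl T⟩
  map_add' _ _ := rfl
  map_smul' _ _ := rfl

theorem toTempered_apply {w : Weight n} (T : CwDual w) (f : 𝓢(RSpace n, ℂ)) :
    toTempered w T f = T (schwartzIncl w f) := rfl

theorem distOrder_toTempered_le {w : Weight n} (T : CwDual w) :
    distOrder (toTempered w T) ≤ (dualOrder T : ℕ∞) := by
  refine iInf₂_le (dualOrder T) ?_
  obtain ⟨S, hS, C, hC0, hC⟩ := exists_bound_norm_schwartzIncl T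
  intro K _
  refine ⟨C.toNNReal, fun f _ => ?_⟩
  rw [toTempered_apply]
  set s := ⨆ β ∈ {β : MultiIndex n | order β ≤ dualOrder T}, supNorm (multiD ℝ β f) with hs
  by_cases hst : s = ⊤
  · rw [hst, ENNReal.mul_top (by simpa using hC0)]
    exact le_top
  have h1 := hC f s.toReal ENNReal.toReal_nonneg fun β hβ x => by
    have h2 : supNorm (multiD ℝ β f) ≤ s :=
      le_iSup₂_of_le (f := fun (β : MultiIndex n) (_ : β ∈ {β : MultiIndex n |
        order β ≤ dualOrder T}) => supNorm (multiD ℝ β f)) β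
        (hS ▸ Finset.le_sup (f := order) hβ) le_rfl
    exact (norm_le_toReal_supNorm (ne_top_of_le_ne_top hst h2) x).trans (ENNReal.toReal_mono hst h2)
  rw [← ofReal_norm]
  refine (ENNReal.ofReal_le_ofReal h1).trans (le_of_eq ?_)
  rw [ENNReal.ofReal_mul hC0.le, ENNReal.ofReal_toReal hst]
  rfl

/-! ### Cut-offs and approximation by compactly supported functions. -/

theorem partialD_const (j : Fin n) (c : ℂ) (x : RSpace n) :
    partialD ℝ j (fun _ => c) x = 0 := by
  simp [partialD, lineDeriv]

/-- Families of smooth functions with uniformly bounded derivatives, the `m`-th of which vanishes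
on the ball of radius `m`. -/
def IsTail (ψ : ℕ → RSpace n → ℂ) : Prop :=
  (∀ m, ContDiff ℝ ∞ (ψ m)) ∧ (∀ (m : ℕ) x, ‖x‖ < m → ψ m x = 0) ∧
    ∀ l : List (Fin n), ∃ A : ℝ, ∀ m x, ‖wordD ℝ l (ψ m) x‖ ≤ A

theorem IsTail.partialD {ψ : ℕ → RSpace n → ℂ} (h : IsTail ψ) (j : Fin n) :
    IsTail fun m => partialD ℝ j (ψ m) := by
  refine ⟨fun m => partialD_smooth j (h.1 m), fun m x hx => ?_, fun l => ?_⟩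
  · have he : ψ m =ᶠ[𝓝 x] fun _ => 0 := by
      filter_upwards [(isOpen_lt continuous_norm continuous_const).mem_nhds hx] with y hy
      exact h.2.1 m y hy
    exact he.lineDeriv_eq.trans (partialD_const j 0 x)
  · obtain ⟨A, hA⟩ := h.2.2 (l ++ [j])
    refine ⟨A, fun m x => ?_⟩
    have := hA m x
    rwa [wordD_append] at this

theorem partialD_mem {w : Weight n} {f : RSpace n → ℂ} (hf : f ∈ cwSubmodule w) (j : Fin n) :
    partialD ℝ j f ∈ cwSubmodule w := by
  rw [mem_cwSubmodule_iff] at hf ⊢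
  refine ⟨partialD_smooth j hf.1, fun l => ?_⟩
  have := hf.2 (l ++ [j])
  rwa [wordD_append] at this

/-- For the empty word, `ψ_m` vanishes where `f · w` need not be small and is uniformly bounded
elsewhere. The product rule reduces a longer word to two instances with one letter less, as tails
and `C_w` are both stable under `∂_j`. -/
theorem IsTail.eventually_small {w : Weight n} (l : List (Fin n)) {ψ : ℕ → RSpace n → ℂ}
    (h : IsTail ψ) {f : RSpace n → ℂ} (hf : f ∈ cwSubmodule w) {ε : ℝ} (hε : 0 < ε) :
    ∀ᶠ m in Filter.atTop, ∀ x, ‖wordD ℝ l.reverse (ψ m * f) x‖ * w x ≤ ε := by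
  induction l generalizing ψ f ε with
  | nil =>
    obtain ⟨A, hA⟩ := h.2.2 []
    have h1 := (mem_cwSubmodule_iff.mp hf).2 []
    have hA' : 0 < |A| + 1 := by positivity
    obtain ⟨R, -, hR⟩ := (Metric.hasBasis_cobounded_compl_closedBall (0 : RSpace n)).eventually_iff.mp
      (Metric.tendsto_nhds.mp h1 (ε / (|A| + 1)) (by positivity))
    filter_upwards [Filter.eventually_gt_atTop ⌈R⌉₊] with m hm x
    have hw := w.nonneg x
    change ‖ψ m x * f x‖ * w x ≤ ε
    by_cases hx : ‖x‖ < m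
    · rw [h.2.1 m x hx, zero_mul, norm_zero, zero_mul]
      exact hε.le
    · have hx' : x ∈ (Metric.closedBall (0 : RSpace n) R)ᶜ := by
        have h2 : R < m := lt_of_le_of_lt (Nat.le_ceil R) (by exact_mod_cast hm)
        simpa using lt_of_lt_of_le h2 (not_lt.mp hx)
      have h3 := (hR hx').le
      simp only [dist_zero_right, norm_mul, Complex.norm_real, Real.norm_eq_abs,
        abs_of_nonneg hw] at h3
      have h4 : ‖ψ m x‖ ≤ |A| + 1 := (hA m x).trans (by linarith [le_abs_self A])
      calc ‖ψ m x * f x‖ * w x = ‖ψ m x‖ * (‖f x‖ * w x) := by rw [norm_mul, mul_assoc]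
        _ ≤ (|A| + 1) * (ε / (|A| + 1)) := mul_le_mul h4 h3 (by positivity) hA'.le
        _ = ε := by field_simp
  | cons j l ih =>
    have hfs := hf.1
    filter_upwards [ih (h.partialD j) hf (half_pos hε), ih h (partialD_mem hf j) (half_pos hε)]
      with m h1 h2 x
    have hw := w.nonneg x
    rw [List.reverse_cons, wordD_append]
    change ‖wordD ℝ l.reverse (WeightedFourier.partialD ℝ j (ψ m * f)) x‖ * w x ≤ ε
    have hs1 : ContDiff ℝ ∞ (WeightedFourier.partialD ℝ j (ψ m) * f) :=
      (partialD_smooth j (h.1 m)).mul hfs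
    have hs2 : ContDiff ℝ ∞ (ψ m * WeightedFourier.partialD ℝ j f) :=
      (h.1 m).mul (partialD_smooth j hfs)
    rw [partialD_mul j (h.1 m) hfs, wordD_add _ hs1 hs2, Pi.add_apply]
    have h3 := h1 x
    have h4 := h2 x
    calc _ ≤ (‖wordD ℝ l.reverse (WeightedFourier.partialD ℝ j (ψ m) * f) x‖ +
          ‖wordD ℝ l.reverse (ψ m * WeightedFourier.partialD ℝ j f) x‖) * w x :=
        mul_le_mul_of_nonneg_right (norm_add_le _ _) hw
      _ ≤ ε := by linarith

theorem wordD_comp_smul (l : List (Fin n)) (c : ℝ) {f : RSpace n → ℂ} (hf : ContDiff ℝ ∞ f) :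
    wordD ℝ l (fun x => f (c • x)) = (c : ℂ) ^ l.length • fun x => wordD ℝ l f (c • x) := by
  induction l with
  | nil => simp [wordD]
  | cons j l ih =>
    have hs : ContDiff ℝ ∞ fun x => wordD ℝ l f (c • x) :=
      (wordD_smooth l hf).comp (contDiff_const_smul c)
    rw [wordD_cons, ih, partialD_smul j _ hs, List.length_cons, pow_succ, mul_smul]
    congr 1
    funext x
    rw [partialD_eq_fderiv j hs, Pi.smul_apply, wordD_cons, partialD_eq_fderiv j (wordD_smooth l hf)]
    have h1 := ((wordD_smooth l hf).differentiable (by simp) (c • x)).hasFDerivAt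
    have h2 : HasFDerivAt (fun x : RSpace n => c • x) (c • ContinuousLinearMap.id ℝ (RSpace n)) x :=
      (hasFDerivAt_id x).const_smul c
    have h3 : HasFDerivAt (fun x => wordD ℝ l f (c • x)) _ x := h1.comp x h2
    rw [h3.fderiv]
    simp

theorem wordD_one_norm_le (l : List (Fin n)) (x : RSpace n) :
    ‖wordD ℝ l (1 : RSpace n → ℂ) x‖ ≤ 1 := by
  suffices h : ∃ c : ℂ, ‖c‖ ≤ 1 ∧ wordD ℝ l (1 : RSpace n → ℂ) = fun _ => c by
    obtain ⟨c, hc, h⟩ := h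
    rwa [h]
  induction l with
  | nil => exact ⟨1, by simp, rfl⟩
  | cons j l ih =>
    obtain ⟨c, -, hc⟩ := ih
    refine ⟨0, by simp, ?_⟩
    rw [wordD_cons, hc]
    funext x
    exact partialD_const j c x

/-- Dilated cut-off functions. -/
theorem exists_cutoff (n : ℕ) : ∃ χ : ℕ → 𝓢(RSpace n, ℂ),
    (∀ m, HasCompactSupport (χ m)) ∧ IsTail fun m => 1 - (χ m : RSpace n → ℂ) := by
  let φ : ContDiffBump (0 : RSpace n) := default
  let g : RSpace n → ℂ := fun x => (φ x : ℂ)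
  have hg : ContDiff ℝ ∞ g := Complex.ofRealCLM.contDiff.comp φ.contDiff
  have hgc : HasCompactSupport g := φ.hasCompactSupport.comp_left Complex.ofReal_zero
  -- The bump equals `1` on the unit ball, so its dilate equals `1` for `‖x‖ ≤ m + 1`. Since `c m ≤
  -- 1`, dilation does not increase the bounds on derivatives.
  let c : ℕ → ℝ := fun m => ((m : ℝ) + 1)⁻¹
  have hc : ∀ m, 0 < c m := fun m => by positivity
  have hc1 : ∀ m, c m ≤ 1 := fun m => inv_le_one_of_one_le₀ (by simp)
  have hcomp : ∀ m, HasCompactSupport fun x => g (c m • x) := fun m =>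
    hgc.comp_homeomorph (Homeomorph.smulOfNeZero (c m) (hc m).ne')
  have hsm : ∀ m, ContDiff ℝ ∞ fun x => g (c m • x) := fun m =>
    hg.comp (contDiff_const_smul (c m))
  refine ⟨fun m => (hcomp m).toSchwartzMap (hsm m), hcomp, ?_⟩
  have hcoe : ∀ m, (1 - ((hcomp m).toSchwartzMap (hsm m) : RSpace n → ℂ)) =
      1 + (-1 : ℂ) • fun x => g (c m • x) := fun m => by
    funext x
    simp [sub_eq_add_neg, HasCompactSupport.toSchwartzMap_toFun]
  refine ⟨fun m => ?_, fun m x hx => ?_, fun l => ?_⟩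
  · exact contDiff_const.sub (SchwartzMap.smooth _ ⊤)
  · simp only [hcoe]
    have h1 : φ (c m • x) = 1 := by
      refine φ.one_of_mem_closedBall ?_
      rw [mem_closedBall_zero_iff, norm_smul, Real.norm_eq_abs, abs_of_pos (hc m)]
      change _ ≤ (1 : ℝ)
      rw [inv_mul_le_iff₀ (by positivity)]
      linarith
    simp [g, h1]
  · have hb := SchwartzMap.norm_le_seminorm ℝ (schwartzWordD l (hgc.toSchwartzMap hg))
    rw [schwartzWordD_coe] at hb
    refine ⟨1 + SchwartzMap.seminorm ℝ 0 0 (schwartzWordD l (hgc.toSchwartzMap hg)),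
      fun m x => ?_⟩
    simp only [hcoe]
    have hone : ContDiff ℝ ∞ (1 : RSpace n → ℂ) := contDiff_const
    rw [wordD_add _ hone (contDiff_const_smul' _ (hsm m)), wordD_smul _ _ (hsm m),
      wordD_comp_smul l _ hg]
    refine (norm_add_le _ _).trans (add_le_add (wordD_one_norm_le l x) ?_)
    simp only [Pi.smul_apply, norm_smul, norm_neg, norm_one, one_mul, norm_pow, Complex.norm_real,
      Real.norm_eq_abs, abs_of_pos (hc m)]
    exact (mul_le_of_le_one_left (norm_nonneg _) (pow_le_one₀ (hc m).le (hc1 m))).trans (hb _)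

/-- `χ_m f` is smooth with compact support, so `T` kills it if it kills the Schwartz functions; then
`T f = T ((1 - χ_m) f)`, which is arbitrarily small. -/
theorem toTempered_injective (w : Weight n) : Function.Injective (toTempered w) := by
  rw [injective_iff_map_eq_zero]
  intro T hT
  ext f
  obtain ⟨S, -, C, hC0, hC⟩ := exists_bound_dualOrder T
  obtain ⟨χ, hχ, htail⟩ := exists_cutoff n
  rw [_root_.zero_apply, ← norm_le_zero_iff]
  refine le_of_forall_pos_le_add fun ε hε => ?_
  have hf : f.val ∈ cwSubmodule w := f.2
  have h1 : ∀ᶠ m in Filter.atTop, ∀ β ∈ S, ∀ x,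
      ‖multiD ℝ β ((1 - (χ m : RSpace n → ℂ)) * f.val) x‖ * w x ≤ ε / C := by
    rw [Filter.eventually_all_finset]
    intro β _
    have := htail.eventually_small (wordOf β).reverse hf (ε := ε / C) (by positivity)
    simpa only [List.reverse_reverse, ← multiD_eq_wordD] using this
  obtain ⟨m, hm⟩ := h1.exists
  have hs : ContDiff ℝ ∞ ((χ m : RSpace n → ℂ) * f.val) := ((χ m).smooth ⊤).mul hf.1
  let g : 𝓢(RSpace n, ℂ) := ((hχ m).mul_right (f' := f.val)).toSchwartzMap hs
  have hg : T (schwartzIncl w g) = 0 := by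
    rw [← toTempered_apply, hT]
    rfl
  have hval : (f - schwartzIncl w g).val = (1 - (χ m : RSpace n → ℂ)) * f.val := by
    rw [sub_mul, one_mul]
    rfl
  have h2 : T f = T (f - schwartzIncl w g) := by rw [map_sub, hg, sub_zero]
  rw [h2, zero_add]
  refine (hC _).trans ?_
  have h3 : (S.sup (cwSeminorm w)) (f - schwartzIncl w g) ≤ ε / C := by
    refine Seminorm.finset_sup_apply_le (by positivity) fun β hβ => cwSeminorm_le fun x => ?_
    rw [hval]
    exact hm β hβ x
  calc C * (S.sup (cwSeminorm w)) (f - schwartzIncl w g) ≤ C * (ε / C) := by gcongr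
    _ = ε := by field_simp

end Tempered

/-! ### The Fourier transform of a functional on `C_w` -/

section FourierRepresentation

open MeasureTheory

variable {n : ℕ}

theorem schwartzFourier_surjective (n : ℕ) : Function.Surjective (schwartzFourier n) := by
  intro g
  have hc : fourierConst n ≠ 0 := by
    rw [fourierConst, Complex.ofReal_ne_zero]
    positivity
  refine ⟨FourierTransform.fourierInv ((fourierConst n)⁻¹ •
    SchwartzMap.compCLMOfContinuousLinearEquiv ℂ (scaleEquiv n).symm g), ?_⟩
  ext x
  simp only [schwartzFourier, _root_.smul_apply, ContinuousLinearMap.comp_apply,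
    FourierTransform.fourierCLM_apply, FourierTransform.fourier_fourierInv_eq, map_smul]
  rw [smul_smul, mul_inv_cancel₀ hc, one_smul]
  simp

/-- Multiplication by `-i λ_j` on the Schwartz space. -/
noncomputable def mulCoord (j : Fin n) (f : 𝓢(RSpace n, ℂ)) : 𝓢(RSpace n, ℂ) :=
  -- These constants are those produced by differentiating `𝓕` in the rescaled direction `scaleEquiv
  -- n e_j`; the factors `2π` cancel.
  -(2 * Real.pi * Complex.I) • SchwartzMap.smulLeftCLM ℂ
    (fun l : RSpace n => inner ℝ l (scaleEquiv n (EuclideanSpace.single j (1 : ℝ)))) f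

theorem mulCoord_apply (j : Fin n) (f : 𝓢(RSpace n, ℂ)) (l : RSpace n) :
    mulCoord j f l = (-Complex.I • toC l) j * f l := by
  have h : (fun l : RSpace n => inner ℝ l
      (scaleEquiv n (EuclideanSpace.single j (1 : ℝ)))).HasTemperateGrowth :=
    ((innerSL ℝ).flip (scaleEquiv n (EuclideanSpace.single j (1 : ℝ)))).hasTemperateGrowth
  have hs : scaleEquiv n (EuclideanSpace.single j (1 : ℝ)) =
      (2 * Real.pi)⁻¹ • EuclideanSpace.single j (1 : ℝ) := rfl
  rw [mulCoord, _root_.smul_apply, SchwartzMap.smulLeftCLM_apply_apply h, hs,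
    inner_smul_right]
  have hpi : (Real.pi : ℂ) ≠ 0 := by exact_mod_cast Real.pi_ne_zero
  simp [toC, EuclideanSpace.inner_single_right]
  field_simp

theorem partialD_schwartzFourier (j : Fin n) (f : 𝓢(RSpace n, ℂ)) :
    partialD ℝ j (schwartzFourier n f) = schwartzFourier n (mulCoord j f) := by
  have h : LineDeriv.lineDerivOp (EuclideanSpace.single j (1 : ℝ)) (schwartzFourier n f) =
      schwartzFourier n (mulCoord j f) := by
    simp only [schwartzFourier, _root_.smul_apply, ContinuousLinearMap.comp_apply,
      FourierTransform.fourierCLM_apply]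
    rw [LineDeriv.lineDerivOp_smul, SchwartzMap.lineDerivOp_compCLMOfContinuousLinearEquiv,
      SchwartzMap.lineDerivOp_fourier_eq]
    rfl
  rw [← h]
  funext x
  exact (SchwartzMap.lineDerivOp_apply _ _ _).symm

theorem leibniz_zero (l : List (Fin n)) (ζ : CSpace n) (x : RSpace n) :
    leibniz l 0 ζ x = (l.map fun j => ζ j).prod * expFun ζ x := by
  induction l with
  | nil => simp [leibniz, monoExp_zero]
  | cons j l ih => simp [leibniz, ih, mul_assoc]

theorem wordD_schwartzFourier (l : List (Fin n)) (f : 𝓢(RSpace n, ℂ)) :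
    ∃ g : 𝓢(RSpace n, ℂ), wordD ℝ l (schwartzFourier n f) = schwartzFourier n g ∧
      ∀ k, g k = (l.map fun j => (-Complex.I • toC k) j).prod * f k := by
  induction l with
  | nil => exact ⟨f, rfl, by simp⟩
  | cons j l ih =>
    obtain ⟨g, h1, h2⟩ := ih
    refine ⟨mulCoord j g, by rw [wordD_cons, h1, partialD_schwartzFourier], fun k => ?_⟩
    rw [mulCoord_apply, h2, List.map_cons, List.prod_cons, mul_assoc]

theorem expFun_neg_I_smul (l x : RSpace n) :
    expFun (-Complex.I • toC l) x = Complex.exp (-Complex.I * ((inner ℝ x l : ℝ) : ℂ)) := by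
  rw [expFun]
  congr 1
  simp [toC, PiLp.inner_apply, Finset.mul_sum, mul_assoc]

/-- For `α = 0` the Leibniz expression is the exponential times the product of the `-iλ_j`, that is,
the factor by which differentiation acts under the Fourier integral. -/
theorem multiD_schwartzFourier (β : MultiIndex n) (f : 𝓢(RSpace n, ℂ)) (x : RSpace n) :
    multiD ℝ β (schwartzFourier n f) x =
      fourierConst n * ∫ l, f l * leibniz (wordOf β).reverse 0 (-Complex.I • toC l) x := by
  obtain ⟨g, h1, h2⟩ := wordD_schwartzFourier (wordOf β) f
  rw [multiD_eq_wordD, h1, schwartzFourier_apply]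
  congr 1
  refine integral_congr_ae (Filter.Eventually.of_forall fun l => ?_)
  simp only [h2, leibniz_zero, expFun_neg_I_smul, List.map_reverse, List.prod_reverse]
  ring

theorem integrable_schwartz_smul {E : Type*} [NormedAddCommGroup E] [NormedSpace ℂ E]
    (f : 𝓢(RSpace n, ℂ)) {Φ : RSpace n → E} (hΦ : Continuous Φ) {K : ℝ} {N : ℕ}
    (hK : ∀ l, ‖Φ l‖ ≤ K * (1 + ‖l‖) ^ N) : Integrable fun l => f l • Φ l := by
  have h1 : Integrable fun l : RSpace n => K * (2 ^ N * (‖l‖ ^ 0 * ‖f l‖ + ‖l‖ ^ N * ‖f l‖)) :=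
    (((f.integrable_pow_mul volume 0).add (f.integrable_pow_mul volume N)).const_mul _).const_mul _
  refine h1.mono' (f.continuous.smul hΦ).aestronglyMeasurable (Filter.Eventually.of_forall fun l => ?_)
  have hK0 : 0 ≤ K := by
    have := (norm_nonneg _).trans (hK 0)
    simpa using this
  have h2 : (1 + ‖l‖) ^ N ≤ 2 ^ N * (1 + ‖l‖ ^ N) := by
    have h3 : (1 + ‖l‖) ≤ 2 * max 1 ‖l‖ := by
      have := le_max_left 1 ‖l‖
      have := le_max_right 1 ‖l‖
      linarith
    calc (1 + ‖l‖) ^ N ≤ (2 * max 1 ‖l‖) ^ N := pow_le_pow_left₀ (by positivity) h3 _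
      _ = 2 ^ N * max 1 ‖l‖ ^ N := mul_pow _ _ _
      _ ≤ _ := by
        gcongr
        rcases max_cases 1 ‖l‖ with h | h <;> rw [h.1]
        · rw [one_pow]; exact le_add_of_nonneg_right (by positivity)
        · exact le_add_of_nonneg_left zero_le_one
  rw [norm_smul]
  calc ‖f l‖ * ‖Φ l‖ ≤ ‖f l‖ * (K * (2 ^ N * (1 + ‖l‖ ^ N))) := by
        refine mul_le_mul_of_nonneg_left ((hK l).trans ?_) (norm_nonneg _)
        gcongr
    _ = _ := by ring

theorem integral_clm_schwartz_smul {E : Type*} [NormedAddCommGroup E] [NormedSpace ℂ E]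
    [CompleteSpace E] (T' : E →L[ℂ] ℂ) (f : 𝓢(RSpace n, ℂ)) {Φ : RSpace n → E}
    (h : Integrable fun l => f l • Φ l) :
    ∫ l, f l * T' (Φ l) = T' (∫ l, f l • Φ l) := by
  rw [← T'.integral_comp_comm h]
  simp

/-- Polynomial growth in `λ` makes the product with a Schwartz function Bochner integrable. -/
theorem norm_liftMono_zero_le {w : Weight n} (h : w.DecaysExp 0 0) (S : Finset (MultiIndex n)) :
    ∃ K : ℝ, ∀ l : RSpace n,
      ‖liftMono w S 0 (-Complex.I • toC l)‖ ≤ K * (1 + ‖l‖) ^ S.sup order := by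
  obtain ⟨B, hB⟩ := w.bounded
  refine ⟨|B|, fun l => lp.norm_le_of_forall_le (by positivity) fun b => ?_⟩
  have hr : ‖rePart (-Complex.I • toC l)‖ ≤ 0 := by
    rw [rePart_neg_I_smul, imPart_toC, norm_zero]
  have h0 : order (0 : MultiIndex n) ≤ 0 := by simp [order]
  rw [liftMono_apply S (monoExp_mem h h0 hr), norm_mul, Complex.norm_real, Real.norm_eq_abs,
    abs_of_nonneg (w.nonneg _)]
  refine (norm_leibniz_mul_le _ h0 hr b.2).trans ?_
  have hw := w.nonneg b.2
  simp only [pow_zero, zero_mul, Real.exp_zero, one_mul, Pi.zero_apply, Nat.cast_zero, add_zero,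
    Finset.prod_const_one, mul_one, List.length_reverse, length_wordOf, norm_smul, norm_neg,
    Complex.norm_I, norm_toC]
  rw [mul_comm]
  have h1 : (1 + ‖l‖) ^ order b.1.1 ≤ (1 + ‖l‖) ^ S.sup order :=
    pow_le_pow_right₀ (by simp) (Finset.le_sup (f := order) b.1.2)
  have h2 : w b.2 ≤ |B| := (hB _).trans (le_abs_self B)
  gcongr

/-- The image of `ℱ f` under `lift` is, up to the constant, the Bochner integral of `f(λ)` times the
image of `e_{-iλ}`, and `T'` passes under the integral. -/
theorem isRepresentedBy_transform {w : Weight n} (T : CwDual w) (h : w.DecaysExp 0 0) :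
    IsRepresentedBy (temperedFourier (toTempered w T)) fun l => transform T 0 (toC l) := by
  intro f
  obtain ⟨S, T', hT⟩ := exists_factorization T
  have h0 : order (0 : MultiIndex n) ≤ 0 := by simp [order]
  have hr : ∀ l : RSpace n, ‖rePart (-Complex.I • toC l)‖ ≤ 0 := fun l => by
    rw [rePart_neg_I_smul, imPart_toC, norm_zero]
  have hcont : Continuous fun l : RSpace n => liftMono w S 0 (-Complex.I • toC l) :=
    (continuousOn_liftMono S h h0).comp_continuous (negIReal n).continuous hr
  obtain ⟨K, hK⟩ := norm_liftMono_zero_le h S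
  have hint := integrable_schwartz_smul f hcont hK
  have htr : ∀ l : RSpace n, f l * transform T 0 (toC l) =
      fourierConst n * (f l * T' (liftMono w S 0 (-Complex.I • toC l))) := fun l => by
    rw [transform, evalMono_eq_liftMono hT]
    simp [order]
    ring
  have hint' : Integrable fun l => f l * T' (liftMono w S 0 (-Complex.I • toC l)) := by
    refine (T'.integrable_comp hint).congr (Filter.Eventually.of_forall fun l => ?_)
    simp
  simp only [htr]
  refine ⟨hint'.const_mul _, ?_⟩
  rw [integral_const_mul, integral_clm_schwartz_smul T' f hint, temperedFourier_apply,
    toTempered_apply, hT, ← smul_eq_mul, ← map_smul]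
  congr 1
  -- Equality of bounded functions is checked pointwise; evaluation at `b` is continuous and linear,
  -- so it too commutes with the integral.
  ext b
  have hev := (lp.evalCLM ℂ (fun _ : S × RSpace n => ℂ) ∞ b).integral_comp_comm hint
  rw [lift_apply]
  change multiD ℝ b.1.1 (schwartzFourier n f) b.2 * (w b.2 : ℂ) =
    fourierConst n * (lp.evalCLM ℂ (fun _ : S × RSpace n => ℂ) ∞ b
      (∫ l, f l • liftMono w S 0 (-Complex.I • toC l)))
  rw [← hev, multiD_schwartzFourier, mul_assoc, ← integral_mul_const]
  congr 1
  refine integral_congr_ae (Filter.Eventually.of_forall fun l => ?_)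
  simp only [map_smul, smul_eq_mul, lp_evalCLM_apply]
  rw [liftMono_apply S (monoExp_mem h h0 (hr l)), mul_assoc]

end FourierRepresentation

/-! ### The Denjoy–Carleman theorem on the line -/

section DenjoyCarleman

open Set

/-- Bang's estimate: smallness of all derivatives, measured against `e^{m-N} M_m`, propagates
over the distance `M_N / (e M_{N+1})` at the cost of one power of `e`. -/
theorem bang_step {M : ℕ → ℝ} (hM : ∀ m, 0 < M m) (hlc : ∀ m, M (m + 1) ^ 2 ≤ M m * M (m + 2))
    {g : ℕ → ℝ → ℂ} (hg : ∀ m t, HasDerivAt (g m) (g (m + 1) t) t) {a b : ℝ}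
    (hb : ∀ m, ∀ t ∈ Icc a b, ‖g m t‖ ≤ M m) {N : ℕ} {y : ℝ} (hy : a ≤ y)
    (h : ∀ m, ‖g m y‖ ≤ Real.exp ((m : ℝ) - (N + 1 : ℕ)) * M m) {t : ℝ} (hyt : y ≤ t) (htb : t ≤ b)
    (ht : t - y ≤ M N / (Real.exp 1 * M (N + 1))) (m : ℕ) :
    ‖g m t‖ ≤ Real.exp ((m : ℝ) - N) * M m := by
  set μ : ℝ := M (N + 1) / M N with hμ
  have hμ0 : 0 < μ := div_pos (hM _) (hM _)
  -- Logarithmic convexity means that the ratios `M (m + 1) / M m` increase, so the one at `N`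
  -- dominates the earlier ones.
  have hratio : ∀ m ≤ N, M (m + 1) ≤ M m * μ := by
    intro m hm
    have hmono : Monotone fun m => M (m + 1) / M m := by
      refine monotone_nat_of_le_succ fun m => ?_
      rw [div_le_div_iff₀ (hM _) (hM _)]
      nlinarith [hlc m]
    have := hmono hm
    simp only at this
    rw [div_le_iff₀ (hM _)] at this
    linarith
  -- Descending induction on `m`. At `m = N + 1` the a priori bound suffices because the prefactor
  -- is `1`; below that, the bound on `g (m + 1)` is at most the derivative of the comparison
  -- function for `g m`.
  have key : ∀ k m, m + k = N + 1 → ∀ s ∈ Icc y b, ‖g m s‖ ≤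
      Real.exp ((m : ℝ) - (N + 1 : ℕ)) * M m * Real.exp (Real.exp 1 * μ * (s - y)) := by
    intro k
    induction k with
    | zero =>
      intro m hm s hs
      obtain rfl : m = N + 1 := by omega
      have h1 := hb (N + 1) s ⟨hy.trans hs.1, hs.2⟩
      rw [sub_self, Real.exp_zero, one_mul]
      refine h1.trans (le_mul_of_one_le_right (hM _).le (Real.one_le_exp ?_))
      have := hs.1
      have : 0 ≤ s - y := by linarith
      positivity
    | succ k ih =>
      intro m hm s hs
      have ih' := ih (m + 1) (by omega)
      refine image_norm_le_of_norm_deriv_right_le_deriv_boundary (f := g m) (f' := g (m + 1))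
        (B := fun s => Real.exp ((m : ℝ) - (N + 1 : ℕ)) * M m *
          Real.exp (Real.exp 1 * μ * (s - y)))
        (B' := fun s => Real.exp ((m : ℝ) - (N + 1 : ℕ)) * M m *
          (Real.exp (Real.exp 1 * μ * (s - y)) * (Real.exp 1 * μ)))
        (a := y) (b := b)
        (fun s _ => (hg m s).continuousAt.continuousWithinAt)
        (fun s _ => (hg m s).hasDerivWithinAt) ?_ ?_ ?_ hs
      · simpa using h m
      · intro s
        have h1 : HasDerivAt (fun s => Real.exp 1 * μ * (s - y)) (Real.exp 1 * μ) s := by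
          simpa using ((hasDerivAt_id s).sub_const y).const_mul (Real.exp 1 * μ)
        exact h1.exp.const_mul _
      · intro s hs
        refine (ih' s (Ico_subset_Icc_self hs)).trans ?_
        have h2 : Real.exp (((m + 1 : ℕ) : ℝ) - (N + 1 : ℕ)) =
            Real.exp ((m : ℝ) - (N + 1 : ℕ)) * Real.exp 1 := by
          rw [← Real.exp_add]; push_cast; ring_nf
        rw [h2]
        have h3 := hratio m (by omega)
        calc Real.exp ((m : ℝ) - (N + 1 : ℕ)) * Real.exp 1 * M (m + 1) *
              Real.exp (Real.exp 1 * μ * (s - y))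
            ≤ Real.exp ((m : ℝ) - (N + 1 : ℕ)) * Real.exp 1 * (M m * μ) *
              Real.exp (Real.exp 1 * μ * (s - y)) := by gcongr
          _ = _ := by ring
  by_cases hm : m ≤ N
  · refine (key (N + 1 - m) m (by omega) t ⟨hyt, htb⟩).trans ?_
    have h1 : Real.exp 1 * μ * (t - y) ≤ 1 := by
      calc Real.exp 1 * μ * (t - y)
          ≤ Real.exp 1 * μ * (M N / (Real.exp 1 * M (N + 1))) := by gcongr
        _ = 1 := by
          rw [hμ]
          have := (hM N).ne'
          have := (hM (N + 1)).ne'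
          field_simp
    calc Real.exp ((m : ℝ) - (N + 1 : ℕ)) * M m * Real.exp (Real.exp 1 * μ * (t - y))
        ≤ Real.exp ((m : ℝ) - (N + 1 : ℕ)) * M m * Real.exp 1 := by
          have := (hM m).le
          gcongr
      _ = Real.exp ((m : ℝ) - N) * M m := by
          rw [mul_right_comm, ← Real.exp_add]; push_cast; ring_nf
  -- For `m > N` the exponential is at least `1`, so the a priori bound already suffices.
  · refine (hb m t ⟨hy.trans hyt, htb⟩).trans (le_mul_of_one_le_left (hM m).le ?_)
    rw [Real.one_le_exp_iff, sub_nonneg]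
    exact_mod_cast (not_le.mp hm).le

/-- Quasi-analyticity for a logarithmically convex sequence with `∑ M_m / M_{m+1} = ∞`. -/
theorem eq_zero_of_not_summable_ratio {M : ℕ → ℝ} (hM : ∀ m, 0 < M m)
    (hlc : ∀ m, M (m + 1) ^ 2 ≤ M m * M (m + 2)) (hdiv : ¬ Summable fun m => M m / M (m + 1))
    {g : ℕ → ℝ → ℂ} (hg : ∀ m t, HasDerivAt (g m) (g (m + 1) t) t) {a b : ℝ}
    (hb : ∀ m, ∀ t ∈ Icc a b, ‖g m t‖ ≤ M m) (h0 : ∀ m, g m a = 0) :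
    ∀ m, ∀ t ∈ Icc a b, g m t = 0 := by
  have he := Real.exp_pos 1
  set s : ℕ → ℝ := fun m => M m / (Real.exp 1 * M (m + 1)) with hs
  have hs0 : ∀ m, 0 ≤ s m := fun m => by
    have := hM m; have := hM (m + 1); positivity
  -- `k` is the number of Bang steps needed to reach `t` from `a`. Going back by `s N`, though not
  -- beyond `a`, trades the level `N` for `N + 1`; at `a` all levels hold.
  have key : ∀ k N : ℕ, ∀ t ∈ Icc a b, t - a ≤ ∑ i ∈ Finset.range k, s (N + i) →
      ∀ m : ℕ, ‖g m t‖ ≤ Real.exp ((m : ℝ) - N) * M m := by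
    intro k
    induction k with
    | zero =>
      intro N t ht hta m
      simp only [Finset.range_zero, Finset.sum_empty] at hta
      obtain rfl : t = a := le_antisymm (by linarith) ht.1
      rw [h0 m, norm_zero]
      have := hM m
      positivity
    | succ k ih =>
      intro N t ht hta
      rw [Finset.sum_range_succ'] at hta
      set y := max a (t - s N) with hyd
      have hay : a ≤ y := le_max_left _ _
      have hyt : y ≤ t := max_le ht.1 (by linarith [hs0 N])
      refine bang_step hM hlc hg hb hay (ih (N + 1) y ⟨hay, hyt.trans ht.2⟩ ?_) hyt ht.2 ?_
      · have h1 : ∑ i ∈ Finset.range k, s (N + 1 + i) = ∑ i ∈ Finset.range k, s (N + (i + 1)) :=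
          Finset.sum_congr rfl fun i _ => by congr 1; omega
        rw [h1, hyd]
        have h2 : 0 ≤ ∑ i ∈ Finset.range k, s (N + (i + 1)) :=
          Finset.sum_nonneg fun i _ => hs0 _
        rcases max_cases a (t - s N) with h | h <;> rw [h.1] <;> simp at hta ⊢ <;> linarith
      · have : t - s N ≤ y := le_max_right _ _
        change t - y ≤ s N
        linarith
  intro m t ht
  -- Divergence of every tail of the step lengths puts `t` within reach whatever the level `N`; then
  -- `N → ∞`.
  have hall : ∀ N : ℕ, ‖g m t‖ ≤ Real.exp ((m : ℝ) - N) * M m := by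
    intro N
    have h1 : ¬ Summable fun i => s (N + i) := by
      intro hsum
      have h2 : Summable s := by
        rw [← summable_nat_add_iff N]
        exact hsum.congr fun i => by rw [add_comm]
      refine hdiv ((h2.mul_left (Real.exp 1)).congr fun i => ?_)
      have := (hM (i + 1)).ne'
      simp only [hs]
      field_simp
    have h2 := (not_summable_iff_tendsto_nat_atTop_of_nonneg (fun i => hs0 (N + i))).mp h1
    obtain ⟨k, hk⟩ := (h2.eventually_ge_atTop (t - a)).exists
    exact key k N t ht hk m
  have hlim : Filter.Tendsto (fun N : ℕ => Real.exp ((m : ℝ) - N) * M m) Filter.atTop (𝓝 0) := by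
    have : Filter.Tendsto (fun N : ℕ => (m : ℝ) - N) Filter.atTop Filter.atBot :=
      Filter.tendsto_atBot_add_const_left _ _
        (Filter.tendsto_neg_atTop_atBot.comp tendsto_natCast_atTop_atTop)
    simpa using (Real.tendsto_exp_atBot.comp this).mul_const (M m)
  exact norm_le_zero_iff.mp (ge_of_tendsto' hlim hall)

/-- Quasi-analyticity on the whole line for sequences of locally bounded derivatives. -/
theorem eq_zero_of_local_bounds {M : ℕ → ℝ} (hM : ∀ m, 0 < M m)
    (hlc : ∀ m, M (m + 1) ^ 2 ≤ M m * M (m + 2)) (hdiv : ¬ Summable fun m => M m / M (m + 1))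
    {g : ℕ → ℝ → ℂ} (hg : ∀ m t, HasDerivAt (g m) (g (m + 1) t) t)
    (hb : ∀ R : ℝ, ∃ K : ℝ, ∀ m t, |t| ≤ R → ‖g m t‖ ≤ K * M m) {a : ℝ} (h0 : ∀ m, g m a = 0) :
    ∀ m t, g m t = 0 := by
  have main : ∀ (g : ℕ → ℝ → ℂ), (∀ m t, HasDerivAt (g m) (g (m + 1) t) t) →
      (∀ R : ℝ, ∃ K : ℝ, ∀ m t, |t| ≤ R → ‖g m t‖ ≤ K * M m) → ∀ a, (∀ m, g m a = 0) →
      ∀ m t, a ≤ t → g m t = 0 := by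
    intro g hg hb a h0 m t hat
    obtain ⟨K, hK⟩ := hb (max |a| |t|)
    set K' := max K 1
    have hK' : 0 < K' := lt_max_of_lt_right one_pos
    refine eq_zero_of_not_summable_ratio (M := fun m => K' * M m) (fun m => mul_pos hK' (hM m))
      (fun m => ?_) ?_ hg (a := a) (b := t) (fun m s hs => ?_) h0 m t ⟨hat, le_rfl⟩
    · have := hlc m
      have h2 : 0 < K' ^ 2 := by positivity
      nlinarith
    · refine fun h => hdiv (h.congr fun m => ?_)
      rw [mul_div_mul_left _ _ hK'.ne']
    · refine (hK m s ?_).trans (mul_le_mul_of_nonneg_right (le_max_left _ _) (hM m).le)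
      rw [abs_le]
      constructor
      · have := neg_abs_le a
        have := le_max_left |a| |t|
        linarith [hs.1]
      · exact hs.2.trans ((le_abs_self t).trans (le_max_right _ _))
  intro m t
  rcases le_total a t with hat | hat
  · exact main g hg hb a h0 m t hat
  -- Points to the left of `a` are handled by the reflection `t ↦ -t`.
  · have h1 := main (fun m t => (-1) ^ m * g m (-t)) (fun m t => ?_) (fun R => ?_) (-a)
      (fun m => by simp [h0]) m (-t) (by linarith)
    · simpa using h1
    · have := ((hg m (-t)).scomp t (hasDerivAt_neg t)).const_mul ((-1 : ℂ) ^ m)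
      convert! this using 1
      simp [pow_succ]
    · obtain ⟨K, hK⟩ := hb R
      exact ⟨K, fun m t ht => by simpa using hK m (-t) (by simpa using ht)⟩

end DenjoyCarleman

/-! ### Carleman's inequality -/

section Carleman

/-- Carleman's inequality, in qualitative form. -/
theorem summable_geom_mean {a : ℕ → ℝ} (ha : ∀ k, 0 ≤ a k) (hs : Summable a) :
    Summable fun m : ℕ => (∏ k ∈ Finset.range (m + 1), a k) ^ (1 / ((m : ℝ) + 1)) := by
  set S : ℕ → ℝ := fun m => ∑ k ∈ Finset.range m, ((k : ℝ) + 1) * a k with hS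
  have hS0 : ∀ m, 0 ≤ S m := fun m => Finset.sum_nonneg fun k _ => by have := ha k; positivity
  have hSs : ∀ m, S (m + 1) = S m + ((m : ℝ) + 1) * a m := fun m => Finset.sum_range_succ _ _
  have hsum : Summable fun m : ℕ => S (m + 1) / (((m : ℝ) + 1) * (m + 2)) := by
    refine summable_of_sum_range_le (c := ∑' k, a k)
      (fun m => div_nonneg (hS0 _) (by positivity)) fun L => ?_
    -- Summation by parts, using `1/((m+1)(m+2)) = 1/(m+1) - 1/(m+2)`.
    have key : ∑ m ∈ Finset.range L, S (m + 1) / (((m : ℝ) + 1) * (m + 2)) =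
        ∑ m ∈ Finset.range L, a m - S L / ((L : ℝ) + 1) := by
      induction L with
      | zero => simp [hS]
      | succ L ih =>
        rw [Finset.sum_range_succ, ih, Finset.sum_range_succ, hSs]
        push_cast
        field_simp
        ring
    rw [key]
    have h1 := hs.sum_le_tsum (Finset.range L) fun k _ => ha k
    have h2 : 0 ≤ S L / ((L : ℝ) + 1) := div_nonneg (hS0 _) (by positivity)
    linarith
  refine Summable.of_nonneg_of_le (fun m => Real.rpow_nonneg (Finset.prod_nonneg fun k _ => ha k) _)
    (fun m => ?_) (hsum.mul_left (2 * Real.exp 1))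
  set p : ℝ := (m : ℝ) + 1 with hp
  have hp0 : 0 < p := by positivity
  have hprod : ∏ k ∈ Finset.range (m + 1), ((k : ℝ) + 1) * a k =
      ((m + 1).factorial : ℝ) * ∏ k ∈ Finset.range (m + 1), a k := by
    rw [Finset.prod_mul_distrib, ← Finset.prod_range_add_one_eq_factorial]
    push_cast
    rfl
  -- The weights `k + 1` make the arithmetic means summable after the factorial they introduce, at
  -- least `(p/e)^p`, is divided out.
  have hamgm : (∏ k ∈ Finset.range (m + 1), ((k : ℝ) + 1) * a k) ^ (1 / p) ≤ S (m + 1) / p := by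
    have h1 := Real.geom_mean_le_arith_mean_weighted (Finset.range (m + 1)) (fun _ => 1 / p)
      (fun k => ((k : ℝ) + 1) * a k) (fun _ _ => by positivity) (by simp [hp]; field_simp)
      (fun k _ => by have := ha k; positivity)
    rw [Real.finsetProd_rpow _ _ fun k _ => by have := ha k; positivity] at h1
    refine h1.trans (le_of_eq ?_)
    rw [← Finset.mul_sum, one_div, inv_mul_eq_div]
  have hfact : p / Real.exp 1 ≤ ((m + 1).factorial : ℝ) ^ (1 / p) := by
    have h1 := Real.pow_div_factorial_le_exp p hp0.le (m + 1)
    have hf : (0 : ℝ) < (m + 1).factorial := by exact_mod_cast Nat.factorial_pos _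
    have h2 : (p / Real.exp 1) ^ (m + 1) ≤ (m + 1).factorial := by
      rw [div_pow, ← Real.exp_nat_mul, mul_one]
      rw [div_le_iff₀ hf] at h1
      rw [div_le_iff₀ (Real.exp_pos _), mul_comm]
      convert h1 using 3
      push_cast
      rfl
    calc p / Real.exp 1 = ((p / Real.exp 1) ^ (m + 1)) ^ (1 / p) := by
          rw [← Real.rpow_natCast, ← Real.rpow_mul (by positivity)]
          push_cast
          rw [← hp, mul_one_div_cancel hp0.ne', Real.rpow_one]
      _ ≤ _ := Real.rpow_le_rpow (by positivity) h2 (by positivity)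
  have hP0 : 0 ≤ ∏ k ∈ Finset.range (m + 1), a k := Finset.prod_nonneg fun k _ => ha k
  set G := (∏ k ∈ Finset.range (m + 1), a k) ^ (1 / p)
  have hG : 0 ≤ G := Real.rpow_nonneg hP0 _
  rw [hprod, Real.mul_rpow (by positivity) hP0] at hamgm
  have h3 : p / Real.exp 1 * G ≤ S (m + 1) / p :=
    (mul_le_mul_of_nonneg_right hfact hG).trans hamgm
  have he := Real.exp_pos 1
  have h4 : G ≤ Real.exp 1 * (S (m + 1) / p ^ 2) := by
    rw [div_mul_eq_mul_div, div_le_iff₀ he] at h3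
    have h5 : G = p * G / p := by field_simp
    rw [h5, div_le_iff₀ hp0]
    refine h3.trans (le_of_eq ?_)
    field_simp
  refine h4.trans ?_
  have h6 : S (m + 1) / p ^ 2 ≤ 2 * (S (m + 1) / (p * (m + 2))) := by
    rw [← mul_div_assoc, div_le_div_iff₀ (by positivity) (by positivity)]
    have h7 : p * (m + 2) ≤ 2 * p ^ 2 := by
      have : (0 : ℝ) ≤ m := Nat.cast_nonneg _
      rw [hp]; nlinarith
    calc S (m + 1) * (p * (m + 2)) ≤ S (m + 1) * (2 * p ^ 2) :=
          mul_le_mul_of_nonneg_left h7 (hS0 _)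
      _ = _ := by ring
  calc Real.exp 1 * (S (m + 1) / p ^ 2) ≤ Real.exp 1 * (2 * (S (m + 1) / (p * (m + 2)))) := by
        gcongr
    _ = _ := by ring

/-- The product of the ratios telescopes to `M 0 / M (m + 1)`. As `M 0 ≥ 1`, its root dominates the
term of the root series, and Carleman's inequality applies. -/
theorem not_summable_ratio {M : ℕ → ℝ} (hM : ∀ m, 0 < M m) (hM0 : 1 ≤ M 0)
    (h : ¬ Summable fun m : ℕ => M (m + 1) ^ (-(1 / ((m : ℝ) + 1)))) :
    ¬ Summable fun m => M m / M (m + 1) := by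
  refine fun hs => h ?_
  refine Summable.of_nonneg_of_le (fun m => Real.rpow_nonneg (hM _).le _) (fun m => ?_)
    (summable_geom_mean (fun m => (div_pos (hM m) (hM (m + 1))).le) hs)
  have hprod : ∏ k ∈ Finset.range (m + 1), M k / M (k + 1) = M 0 / M (m + 1) := by
    induction m + 1 with
    | zero => simp [(hM 0).ne']
    | succ m ih =>
      rw [Finset.prod_range_succ, ih]
      have := (hM m).ne'
      field_simp
  rw [hprod, Real.div_rpow (hM _).le (hM _).le, Real.rpow_neg (hM _).le,
    ← one_div (M (m + 1) ^ (1 / ((m : ℝ) + 1)))]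
  exact div_le_div_of_nonneg_right (Real.one_le_rpow hM0 (by positivity))
    (Real.rpow_nonneg (hM _).le _)

theorem rootSeriesDiverges_iff {M : ℕ → ℝ≥0} (hM : ∀ m, 0 < M m) :
    RootSeriesDiverges (fun m => (M m : ℝ≥0∞)) ↔
      ¬ Summable fun m : ℕ => (M (m + 1) : ℝ) ^ (-(1 / ((m : ℝ) + 1))) := by
  unfold RootSeriesDiverges
  have h1 : ∀ m : ℕ, (M (m + 1) : ℝ≥0∞) ^ (-(1 / ((m : ℝ) + 1))) =
      ((M (m + 1) ^ (-(1 / ((m : ℝ) + 1))) : ℝ≥0) : ℝ≥0∞) := fun m =>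
    (ENNReal.coe_rpow_of_ne_zero (hM _).ne' _).symm
  simp only [h1, ENNReal.tsum_coe_eq_top_iff_not_summable_coe, NNReal.coe_rpow]

end Carleman

/-! ### Standard quasi-analytic weights -/

section QuasiAnalytic

variable {n : ℕ}

theorem moment_single (w : Weight n) (j : Fin n) (m : ℕ) :
    w.moment (EuclideanSpace.single j (1 : ℝ)) m = ⨆ x, ENNReal.ofReal (|x j| ^ m * w x) := by
  unfold Weight.moment supNorm
  congr 1
  funext x
  have := w.nonneg x
  have h : inner ℝ (EuclideanSpace.single j (1 : ℝ)) x = x j := by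
    rw [EuclideanSpace.inner_single_left]
    simp
  simp only [h]
  exact Real.enorm_eq_ofReal (by positivity)

theorem le_moment_single (w : Weight n) (j : Fin n) (m : ℕ) (x : RSpace n) :
    ENNReal.ofReal (|x j| ^ m * w x) ≤ w.moment (EuclideanSpace.single j (1 : ℝ)) m := by
  rw [moment_single]
  exact le_iSup (fun x : RSpace n => ENNReal.ofReal (|x j| ^ m * w x)) x

theorem eq_zero_of_moment_eq_zero {w : Weight n} {j : Fin n} {m : ℕ}
    (h : w.moment (EuclideanSpace.single j (1 : ℝ)) (m + 1) = 0) (x : RSpace n) :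
    |x j| * w x = 0 := by
  have h1 := le_moment_single w j (m + 1) x
  rw [h, nonpos_iff_eq_zero, ENNReal.ofReal_eq_zero] at h1
  have h2 : |x j| ^ (m + 1) * w x = 0 :=
    le_antisymm h1 (mul_nonneg (by positivity) (w.nonneg x))
  rcases mul_eq_zero.mp h2 with h3 | h3
  · rw [pow_eq_zero_iff (by omega)] at h3; rw [h3, zero_mul]
  · rw [h3, mul_zero]

theorem tsum_eq_top_tail {c : ℕ → ℝ≥0∞} (h : ∑' m, c m = ⊤) (hc : ∀ m, c m ≠ ⊤) (K : ℕ) :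
    ∑' m, c (m + K) = ⊤ := by
  rw [← Summable.sum_add_tsum_nat_add' (k := K) ENNReal.summable, ENNReal.add_eq_top] at h
  exact h.resolve_left (ENNReal.sum_ne_top.mpr fun m _ => hc m)

/-- Since `w` is bounded, one infinite moment makes all later ones infinite, so the root series has
only finitely many nonzero terms. These are finite: a vanishing moment would force `|x_j| w = 0`,
contradicting the infinite ones. -/
theorem moment_ne_top {w : Weight n} (hw : w.IsStandardQuasiAnalytic) (j : Fin n) (m : ℕ) :
    w.moment (EuclideanSpace.single j (1 : ℝ)) m ≠ ⊤ := by
  intro htop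
  obtain ⟨B, hB⟩ := w.bounded
  have hmono : ∀ k, m ≤ k → w.moment (EuclideanSpace.single j (1 : ℝ)) k = ⊤ := by
    intro k hk
    have h1 : w.moment (EuclideanSpace.single j (1 : ℝ)) m ≤
        ENNReal.ofReal |B| + w.moment (EuclideanSpace.single j (1 : ℝ)) k := by
      rw [moment_single w j m]
      refine iSup_le fun x => ?_
      have h0 := w.nonneg x
      refine le_trans ?_ (add_le_add_right (le_moment_single w j k x) _)
      rw [← ENNReal.ofReal_add (abs_nonneg _) (by positivity)]
      refine ENNReal.ofReal_le_ofReal ?_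
      rcases le_total |x j| 1 with hx | hx
      · have h2 : |x j| ^ m * w x ≤ 1 * |B| :=
          mul_le_mul (pow_le_one₀ (abs_nonneg _) hx) ((hB x).trans (le_abs_self B)) h0 zero_le_one
        have : 0 ≤ |x j| ^ k * w x := by positivity
        linarith
      · have h2 : |x j| ^ m * w x ≤ |x j| ^ k * w x :=
          mul_le_mul_of_nonneg_right (pow_le_pow_right₀ hx hk) h0
        have := abs_nonneg B
        linarith
    rw [htop, top_le_iff, ENNReal.add_eq_top] at h1
    exact h1.resolve_left ENNReal.ofReal_ne_top
  have hne : ∀ k, w.moment (EuclideanSpace.single j (1 : ℝ)) (k + 1) ≠ 0 := by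
    intro k hk
    have h1 := eq_zero_of_moment_eq_zero hk
    have h2 := hmono (m + 1) (Nat.le_succ m)
    rw [moment_single] at h2
    have h3 : ∀ x : RSpace n, ENNReal.ofReal (|x j| ^ (m + 1) * w x) = 0 := fun x => by
      rw [pow_succ, mul_assoc, h1, mul_zero, ENNReal.ofReal_zero]
    simp [h3] at h2
  have h1 := tsum_eq_top_tail (hw j) (fun k => ?_) m
  · have h2 : ∀ k : ℕ, (w.moment (EuclideanSpace.single j (1 : ℝ)) (k + m + 1)) ^
        (-(1 / (((k + m : ℕ) : ℝ) + 1))) = 0 := fun k => by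
      rw [hmono _ (by omega), ENNReal.top_rpow_of_neg]
      have : (0 : ℝ) < 1 / (((k + m : ℕ) : ℝ) + 1) := by positivity
      linarith
    simp only [h2, tsum_zero] at h1
    exact ENNReal.zero_ne_top h1
  · rw [Ne, ENNReal.rpow_eq_top_iff]
    rintro (⟨h2, -⟩ | ⟨-, h2⟩)
    · exact hne k h2
    · have : (0 : ℝ) < 1 / ((k : ℝ) + 1) := by positivity
      linarith

theorem exists_moment_bound {w : Weight n} (hw : w.IsStandardQuasiAnalytic) (j : Fin n) (m : ℕ) :
    ∃ K : ℝ, ∀ x : RSpace n, |x j| ^ m * w x ≤ K := by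
  refine ⟨(w.moment (EuclideanSpace.single j (1 : ℝ)) m).toReal, fun x => ?_⟩
  have h1 := ENNReal.toReal_mono (moment_ne_top hw j m) (le_moment_single w j m x)
  rwa [ENNReal.toReal_ofReal (mul_nonneg (by positivity) (w.nonneg x))] at h1

theorem exists_norm_le_mul_coord [Nonempty (Fin n)] (x : RSpace n) : ∃ j, ‖x‖ ≤ n * |x j| := by
  obtain ⟨j, hj⟩ := Finite.exists_max fun j => |x j|
  refine ⟨j, ?_⟩
  have hn : (1 : ℝ) ≤ n := by
    have := Fin.pos j
    exact_mod_cast this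
  rw [EuclideanSpace.norm_eq]
  refine Real.sqrt_le_iff.mpr ⟨by positivity, ?_⟩
  calc ∑ i, ‖x i‖ ^ 2 ≤ ∑ _i : Fin n, |x j| ^ 2 :=
        Finset.sum_le_sum fun i _ => pow_le_pow_left₀ (norm_nonneg _) (hj i) 2
    _ = n * |x j| ^ 2 := by simp
    _ ≤ (n : ℝ) ^ 2 * |x j| ^ 2 :=
        mul_le_mul_of_nonneg_right (le_self_pow₀ hn two_ne_zero) (by positivity)
    _ = _ := (mul_pow _ _ _).symm

/-- Finite moments of order `k + 1` in all coordinates bound `‖x‖^(k+1) w(x)`, which leaves a factor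
`1/‖x‖` for the decay of order `k`. -/
theorem Weight.IsStandardQuasiAnalytic.inClass_top {w : Weight n}
    (hw : w.IsStandardQuasiAnalytic) : w.InClass ⊤ := by
  intro k
  unfold Weight.Decays
  rcases isEmpty_or_nonempty (Fin n) with hn | hn
  · have : BoundedSpace (RSpace n) := ⟨Set.subsingleton_univ.finite.isBounded⟩
    rw [Bornology.cobounded_eq_bot]
    exact Filter.tendsto_bot
  choose K hK using fun j => exists_moment_bound hw j (k + 1)
  have hbound : ∀ x : RSpace n, ‖x‖ ^ (k + 1) * w x ≤ (n : ℝ) ^ (k + 1) * ∑ j, |K j| := by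
    intro x
    obtain ⟨j, hj⟩ := exists_norm_le_mul_coord x
    calc ‖x‖ ^ (k + 1) * w x ≤ (n * |x j|) ^ (k + 1) * w x :=
          mul_le_mul_of_nonneg_right (pow_le_pow_left₀ (norm_nonneg _) hj _) (w.nonneg x)
      _ = (n : ℝ) ^ (k + 1) * (|x j| ^ (k + 1) * w x) := by ring
      _ ≤ (n : ℝ) ^ (k + 1) * ∑ j, |K j| := by
          refine mul_le_mul_of_nonneg_left ?_ (by positivity)
          exact ((hK j x).trans (le_abs_self _)).trans
            (Finset.single_le_sum (f := fun j => |K j|) (fun _ _ => abs_nonneg _)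
              (Finset.mem_univ j))
  have hlim : Filter.Tendsto (fun x : RSpace n => (n : ℝ) ^ (k + 1) * (∑ j, |K j|) * ‖x‖⁻¹)
      (Bornology.cobounded (RSpace n)) (𝓝 0) := by
    simpa using (tendsto_inv_atTop_zero.comp tendsto_norm_cobounded_atTop).const_mul
      ((n : ℝ) ^ (k + 1) * ∑ j, |K j|)
  refine squeeze_zero' (Filter.Eventually.of_forall fun x =>
    mul_nonneg (by positivity) (w.nonneg x)) ?_ hlim
  filter_upwards [tendsto_norm_cobounded_atTop.eventually_gt_atTop 0] with x hx
  rw [← div_eq_mul_inv, le_div_iff₀ hx]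
  refine le_trans (le_of_eq ?_) (hbound x)
  ring

end QuasiAnalytic

/-! ### Logarithmically convex sequences of moments -/

section MomentSequences

variable {X : Type*}

/-- `max(1, sup_x y^k v)`. -/
noncomputable def supMoment (y v : X → ℝ) (k : ℕ) : ℝ := max 1 (⨆ x, y x ^ k * v x)

/-- `max(1, sup_x max(1, y)^m v^{1/n})`. -/
noncomputable def supGrowth (y v : X → ℝ) (n m : ℕ) : ℝ :=
  max 1 (⨆ x, max 1 (y x) ^ m * v x ^ (1 / (n : ℝ)))

variable {y v : X → ℝ}

theorem one_le_supMoment (k : ℕ) : 1 ≤ supMoment y v k := le_max_left _ _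

theorem one_le_supGrowth (n m : ℕ) : 1 ≤ supGrowth y v n m := le_max_left _ _

theorem le_supMoment (hb : ∀ k, BddAbove (Set.range fun x => y x ^ k * v x)) (k : ℕ) (x : X) :
    y x ^ k * v x ≤ supMoment y v k := (le_ciSup (hb k) x).trans (le_max_right _ _)

theorem max_one_pow_mul_le (hv1 : ∀ x, v x ≤ 1)
    (hb : ∀ k, BddAbove (Set.range fun x => y x ^ k * v x)) (k : ℕ) (x : X) :
    max 1 (y x) ^ k * v x ≤ supMoment y v k := by
  rcases max_cases 1 (y x) with h | h <;> rw [h.1]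
  · rw [one_pow, one_mul]; exact (hv1 x).trans (one_le_supMoment k)
  · exact le_supMoment hb k x

theorem growth_le_rpow (hv0 : ∀ x, 0 ≤ v x) (hv1 : ∀ x, v x ≤ 1)
    (hb : ∀ k, BddAbove (Set.range fun x => y x ^ k * v x)) {n : ℕ} (hn : n ≠ 0) (m : ℕ) (x : X) :
    max 1 (y x) ^ m * v x ^ (1 / (n : ℝ)) ≤ supMoment y v (n * m) ^ (1 / (n : ℝ)) := by
  have h0 : 0 ≤ max 1 (y x) := zero_le_one.trans (le_max_left _ _)
  have h1 : max 1 (y x) ^ m = (max 1 (y x) ^ (n * m)) ^ (1 / (n : ℝ)) := by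
    rw [mul_comm n m, pow_mul, one_div, Real.pow_rpow_inv_natCast (by positivity) hn]
  rw [h1, ← Real.mul_rpow (by positivity) (hv0 x)]
  exact Real.rpow_le_rpow (mul_nonneg (by positivity) (hv0 x)) (max_one_pow_mul_le hv1 hb _ x)
    (by positivity)

theorem le_supGrowth (hv0 : ∀ x, 0 ≤ v x) (hv1 : ∀ x, v x ≤ 1)
    (hb : ∀ k, BddAbove (Set.range fun x => y x ^ k * v x)) {n : ℕ} (hn : n ≠ 0) (m : ℕ) (x : X) :
    max 1 (y x) ^ m * v x ^ (1 / (n : ℝ)) ≤ supGrowth y v n m := by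
  refine (le_ciSup (f := fun x => max 1 (y x) ^ m * v x ^ (1 / (n : ℝ))) ?_ x).trans
    (le_max_right _ _)
  refine ⟨supMoment y v (n * m) ^ (1 / (n : ℝ)), ?_⟩
  rintro _ ⟨x, rfl⟩
  exact growth_le_rpow hv0 hv1 hb hn m x

theorem supGrowth_le [Nonempty X] (hv0 : ∀ x, 0 ≤ v x) (hv1 : ∀ x, v x ≤ 1)
    (hb : ∀ k, BddAbove (Set.range fun x => y x ^ k * v x)) {n : ℕ} (hn : n ≠ 0) (m : ℕ) :
    supGrowth y v n m ≤ supMoment y v (n * m) ^ (1 / (n : ℝ)) :=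
  max_le (Real.one_le_rpow (one_le_supMoment _) (by positivity))
    (ciSup_le fun x => growth_le_rpow hv0 hv1 hb hn m x)

/-- For fixed `x` the sequence is geometric in `m`, and a supremum of log-convex sequences is
log-convex. -/
theorem supGrowth_sq_le [Nonempty X] (hv0 : ∀ x, 0 ≤ v x) (hv1 : ∀ x, v x ≤ 1)
    (hb : ∀ k, BddAbove (Set.range fun x => y x ^ k * v x)) {n : ℕ} (hn : n ≠ 0) (m : ℕ) :
    supGrowth y v n (m + 1) ^ 2 ≤ supGrowth y v n m * supGrowth y v n (m + 2) := by
  have h0 := one_le_supGrowth (y := y) (v := v) n m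
  have h2 := one_le_supGrowth (y := y) (v := v) n (m + 2)
  have hle : supGrowth y v n (m + 1) ≤ √(supGrowth y v n m * supGrowth y v n (m + 2)) := by
    refine max_le (Real.one_le_sqrt.mpr (one_le_mul_of_one_le_of_one_le h0 h2))
      (ciSup_le fun x => Real.le_sqrt_of_sq_le ?_)
    have h3 := le_supGrowth hv0 hv1 hb hn m x
    have h4 := le_supGrowth hv0 hv1 hb hn (m + 2) x
    have hr : 0 ≤ v x ^ (1 / (n : ℝ)) := Real.rpow_nonneg (hv0 x) _
    have hu : 0 ≤ max 1 (y x) := zero_le_one.trans (le_max_left _ _)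
    calc (max 1 (y x) ^ (m + 1) * v x ^ (1 / (n : ℝ))) ^ 2
        = (max 1 (y x) ^ m * v x ^ (1 / (n : ℝ))) *
            (max 1 (y x) ^ (m + 2) * v x ^ (1 / (n : ℝ))) := by ring
      _ ≤ _ := mul_le_mul h3 h4 (by positivity) (by linarith)
  have hpos : 0 ≤ supGrowth y v n (m + 1) := zero_le_one.trans (one_le_supGrowth _ _)
  calc supGrowth y v n (m + 1) ^ 2 ≤ √(supGrowth y v n m * supGrowth y v n (m + 2)) ^ 2 :=
        pow_le_pow_left₀ hpos hle 2
    _ = _ := Real.sq_sqrt (by positivity)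

/-- The normalization `v ≤ 1` gives `v ≤ v^s` for the quotient `s ≤ 1` of the two exponents, so the
lower moment is at most the `s`-th power of the higher one. -/
theorem antitone_supMoment_root [Nonempty X] (hy : ∀ x, 0 ≤ y x) (hv0 : ∀ x, 0 ≤ v x)
    (hv1 : ∀ x, v x ≤ 1) (hb : ∀ k, BddAbove (Set.range fun x => y x ^ k * v x)) :
    Antitone fun m : ℕ => supMoment y v (m + 1) ^ (-(1 / ((m : ℝ) + 1))) := by
  intro k l hkl
  have hk : (0 : ℝ) < (k : ℝ) + 1 := by positivity
  have hl : (0 : ℝ) < (l : ℝ) + 1 := by positivity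
  have hkl' : (k : ℝ) + 1 ≤ (l : ℝ) + 1 := by
    have : (k : ℝ) ≤ l := by exact_mod_cast hkl
    linarith
  have hPl := one_le_supMoment (y := y) (v := v) (l + 1)
  have hPk := one_le_supMoment (y := y) (v := v) (k + 1)
  set s : ℝ := ((k : ℝ) + 1) / ((l : ℝ) + 1) with hs
  have hs0 : 0 < s := by positivity
  have hs1 : s ≤ 1 := (div_le_one hl).mpr hkl'
  have key : supMoment y v (k + 1) ≤ supMoment y v (l + 1) ^ s := by
    refine max_le (Real.one_le_rpow hPl hs0.le) (ciSup_le fun x => ?_)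
    have h1 : y x ^ (k + 1) = (y x ^ (l + 1)) ^ s := by
      rw [← Real.rpow_natCast (y x) (l + 1), ← Real.rpow_mul (hy x), hs,
        ← Real.rpow_natCast (y x) (k + 1)]
      congr 1
      push_cast
      field_simp
    have h2 : v x ≤ v x ^ s := Real.self_le_rpow_of_le_one (hv0 x) (hv1 x) hs1
    have h3 : 0 ≤ y x ^ (l + 1) := pow_nonneg (hy x) _
    calc y x ^ (k + 1) * v x ≤ (y x ^ (l + 1)) ^ s * v x ^ s := by
          rw [h1]
          exact mul_le_mul_of_nonneg_left h2 (Real.rpow_nonneg h3 _)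
      _ = (y x ^ (l + 1) * v x) ^ s := (Real.mul_rpow h3 (hv0 x)).symm
      _ ≤ _ := Real.rpow_le_rpow (mul_nonneg h3 (hv0 x)) (le_supMoment hb _ x) hs0.le
  change supMoment y v (l + 1) ^ (-(1 / ((l : ℝ) + 1))) ≤
    supMoment y v (k + 1) ^ (-(1 / ((k : ℝ) + 1)))
  calc supMoment y v (l + 1) ^ (-(1 / ((l : ℝ) + 1)))
      = (supMoment y v (l + 1) ^ s) ^ (-(1 / ((k : ℝ) + 1))) := by
        rw [← Real.rpow_mul (by linarith), hs]
        congr 1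
        field_simp
    _ ≤ supMoment y v (k + 1) ^ (-(1 / ((k : ℝ) + 1))) := by
        refine Real.rpow_le_rpow_of_nonpos (by linarith) key ?_
        have : 0 < 1 / ((k : ℝ) + 1) := by positivity
        linarith

/-- Up to the factor `D`, the terms dominate those of the moment root series whose exponents are
multiples of `n`. A monotone series cannot converge along one residue class while diverging as a
whole. -/
theorem not_summable_supGrowth [Nonempty X] (hy : ∀ x, 0 ≤ y x) (hv0 : ∀ x, 0 ≤ v x)
    (hv1 : ∀ x, v x ≤ 1) (hb : ∀ k, BddAbove (Set.range fun x => y x ^ k * v x))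
    (h : ¬ Summable fun m : ℕ => supMoment y v (m + 1) ^ (-(1 / ((m : ℝ) + 1))))
    {n : ℕ} (hn : n ≠ 0) {D : ℝ} (hD : 0 < D) :
    ¬ Summable fun m : ℕ => (D ^ (m + 1) * supGrowth y v n (m + 1)) ^ (-(1 / ((m : ℝ) + 1))) := by
  intro hs
  have : NeZero n := ⟨hn⟩
  -- The residue is `n - 1` because the index `m` stands for the exponent `m + 1`.
  refine h ((summable_indicator_mod_iff (antitone_supMoment_root hy hv0 hv1 hb)
    ((n - 1 : ℕ) : ZMod n)).mp ?_)
  rw [summable_indicator_mod_iff_summable n (n - 1)]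
  refine Summable.of_nonneg_of_le
    (fun m => Real.rpow_nonneg (zero_le_one.trans (one_le_supMoment _)) _) (fun m => ?_)
    (hs.mul_left D)
  have hg := one_le_supGrowth (y := y) (v := v) n (m + 1)
  have hp := one_le_supMoment (y := y) (v := v) (n * (m + 1))
  have hidx : n * m + (n - 1) + 1 = n * (m + 1) := by
    have : 1 ≤ n := Nat.one_le_iff_ne_zero.mpr hn
    rw [mul_add]; omega
  have hcast : ((n * m + (n - 1) : ℕ) : ℝ) + 1 = n * ((m : ℝ) + 1) := by
    exact_mod_cast hidx
  have hneg : -(1 / ((m : ℝ) + 1)) ≤ 0 := by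
    have : 0 < 1 / ((m : ℝ) + 1) := by positivity
    linarith
  have hn' : (n : ℝ) ≠ 0 := by exact_mod_cast hn
  rw [hidx, hcast]
  have h1 : (D ^ (m + 1)) ^ (-(1 / ((m : ℝ) + 1))) = D⁻¹ := by
    rw [← Real.rpow_natCast, ← Real.rpow_mul hD.le, ← Real.rpow_neg_one]
    congr 1
    push_cast
    field_simp
  rw [Real.mul_rpow (by positivity) (by linarith), h1, ← mul_assoc, mul_inv_cancel₀ hD.ne', one_mul]
  calc supMoment y v (n * (m + 1)) ^ (-(1 / ((n : ℝ) * ((m : ℝ) + 1))))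
      = (supMoment y v (n * (m + 1)) ^ (1 / (n : ℝ))) ^ (-(1 / ((m : ℝ) + 1))) := by
        rw [← Real.rpow_mul (by linarith)]
        congr 1
        field_simp
    _ ≤ _ := Real.rpow_le_rpow_of_nonpos (by linarith) (supGrowth_le hv0 hv1 hb hn _) hneg

end MomentSequences

/-! ### Majorizing sequences attached to a quasi-analytic weight. -/

section WeightSequences

variable {n : ℕ}

/-- The root series of a standard quasi-analytic weight, normalized by a bound `B ≥ 1`, diverges. -/
theorem not_summable_supMoment {w : Weight n} (hw : w.IsStandardQuasiAnalytic) (j : Fin n) {B : ℝ}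
    (hB1 : 1 ≤ B) :
    ¬ Summable fun m : ℕ => supMoment (fun x : RSpace n => |x j|) (fun x => w x / B) (m + 1) ^
      (-(1 / ((m : ℝ) + 1))) := by
  set y : RSpace n → ℝ := fun x => |x j| with hy
  set v : RSpace n → ℝ := fun x => w x / B with hv
  have hv0 : ∀ x, 0 ≤ v x := fun x => div_nonneg (w.nonneg x) (zero_le_one.trans hB1)
  have hvw : ∀ x, v x ≤ w x := fun x => div_le_self (w.nonneg x) hB1
  intro hs
  -- A vanishing moment would make every term of the supposedly summable series equal to `1`.
  have hne : ∀ k, w.moment (EuclideanSpace.single j (1 : ℝ)) (k + 1) ≠ 0 := by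
    intro k hk
    have h1 : ∀ m, supMoment y v (m + 1) = 1 := fun m => by
      have h2 : ∀ x, y x ^ (m + 1) * v x = 0 := fun x => by
        have := eq_zero_of_moment_eq_zero hk x
        simp only [hy, hv]
        rw [pow_succ, mul_assoc, ← mul_div_assoc, this, zero_div, mul_zero]
      simp [supMoment, h2]
    simp only [h1, Real.one_rpow] at hs
    exact one_ne_zero (tendsto_nhds_unique tendsto_const_nhds hs.tendsto_atTop_zero)
  set c : ℕ → ℝ≥0∞ := fun m =>
    w.moment (EuclideanSpace.single j (1 : ℝ)) (m + 1) ^ (-(1 / ((m : ℝ) + 1))) with hc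
  have hcfin : ∀ m, c m ≠ ⊤ := fun k => by
    rw [hc, Ne, ENNReal.rpow_eq_top_iff]
    rintro (⟨h2, -⟩ | ⟨-, h2⟩)
    · exact hne k h2
    · have : (0 : ℝ) < 1 / ((k : ℝ) + 1) := by positivity
      linarith
  -- From some index on the terms are below `1`, so the truncation at `1` in `supMoment` is inactive
  -- and comparison with the true moments is possible.
  obtain ⟨K, hK⟩ := Filter.eventually_atTop.mp
    (hs.tendsto_atTop_zero.eventually_lt_const one_pos)
  have htop := tsum_eq_top_tail (hw j) hcfin K
  have hle : ∀ m, c (m + K) ≤ ENNReal.ofReal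
      (supMoment y v (m + K + 1) ^ (-(1 / (((m + K : ℕ) : ℝ) + 1)))) := by
    intro m
    have h1 := hK (m + K) (Nat.le_add_left _ _)
    have h2 : supMoment y v (m + K + 1) = ⨆ x, y x ^ (m + K + 1) * v x := by
      refine max_eq_right_of_lt (lt_of_not_ge fun h => ?_)
      have h3 : supMoment y v (m + K + 1) = 1 := max_eq_left h
      rw [h3, Real.one_rpow] at h1
      exact lt_irrefl _ h1
    have hpos : 0 < supMoment y v (m + K + 1) := zero_lt_one.trans_le (one_le_supMoment _)
    rw [← ENNReal.ofReal_rpow_of_pos hpos, hc]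
    simp only [ENNReal.rpow_neg]
    refine ENNReal.inv_le_inv.mpr (ENNReal.rpow_le_rpow ?_ (by positivity))
    rw [h2]
    refine ENNReal.ofReal_le_of_le_toReal (ciSup_le fun x => ?_)
    have h4 := ENNReal.toReal_mono (moment_ne_top hw j (m + K + 1))
      (le_moment_single w j (m + K + 1) x)
    rw [ENNReal.toReal_ofReal (mul_nonneg (by positivity) (w.nonneg x))] at h4
    exact (mul_le_mul_of_nonneg_left (hvw x) (by positivity)).trans h4
  have hfin : ∑' m, ENNReal.ofReal
      (supMoment y v (m + K + 1) ^ (-(1 / (((m + K : ℕ) : ℝ) + 1)))) ≠ ⊤ :=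
    ((summable_nat_add_iff K).mpr hs).tsum_ofReal_ne_top
  exact hfin (top_le_iff.mp (htop ▸ ENNReal.tsum_le_tsum hle))

/-- The majorizing sequences for the derivatives of the transform. -/
theorem exists_majorant {w : Weight n} (hw : w.IsStandardQuasiAnalytic) (N : ℕ) :
    ∃ (C : ℝ) (M : Fin n → ℕ → ℝ≥0), 0 < C ∧ (∀ j m, 1 ≤ M j m) ∧
      (∀ j m, M j (m + 1) ^ 2 ≤ M j m * M j (m + 2)) ∧
      (∀ j, RootSeriesDiverges fun m => (M j m : ℝ≥0∞)) ∧
      ∀ (α : MultiIndex n) (x : RSpace n), (∏ j, (1 + (α j : ℝ)) ^ N) *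
        ((∏ j, (1 + |x j| ^ α j)) * w x) ≤ C * ∏ j, (M j (α j) : ℝ) := by
  obtain ⟨B₀, hB₀⟩ := w.bounded
  set B := max 1 B₀
  have hB1 : 1 ≤ B := le_max_left _ _
  have hBpos : 0 < B := zero_lt_one.trans_le hB1
  set v : RSpace n → ℝ := fun x => w x / B with hv
  have hv0 : ∀ x, 0 ≤ v x := fun x => div_nonneg (w.nonneg x) hBpos.le
  have hv1 : ∀ x, v x ≤ 1 := fun x => (div_le_one hBpos).mpr ((hB₀ x).trans (le_max_right _ _))
  set y : Fin n → RSpace n → ℝ := fun j x => |x j| with hy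
  have hy0 : ∀ j x, 0 ≤ y j x := fun j x => abs_nonneg _
  have hb : ∀ j k, BddAbove (Set.range fun x => y j x ^ k * v x) := fun j k => by
    obtain ⟨K, hK⟩ := exists_moment_bound hw j k
    refine ⟨K, ?_⟩
    rintro _ ⟨x, rfl⟩
    exact (mul_le_mul_of_nonneg_left (div_le_self (w.nonneg x) hB1) (by positivity)).trans (hK x)
  set Q : Fin n → ℕ → ℝ := fun j m => supGrowth (y j) v n m with hQ
  have hQ1 : ∀ j m, 1 ≤ Q j m := fun j m => one_le_supGrowth _ _
  -- `(1 + m)^N ≤ D^m`, and a geometric factor affects neither log-convexity nor the divergence of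
  -- the root series.
  set D : ℝ := 2 ^ N with hDdef
  have hD : 1 ≤ D := one_le_pow₀ one_le_two
  have hM1 : ∀ j m, 1 ≤ D ^ m * Q j m := fun j m =>
    one_le_mul_of_one_le_of_one_le (one_le_pow₀ hD) (hQ1 j m)
  have hMcoe : ∀ j m, ((D ^ m * Q j m).toNNReal : ℝ) = D ^ m * Q j m := fun j m =>
    Real.coe_toNNReal _ (zero_le_one.trans (hM1 j m))
  have hn : ∀ _ : Fin n, n ≠ 0 := fun j => (Fin.pos j).ne'
  refine ⟨B * 2 ^ n, fun j m => (D ^ m * Q j m).toNNReal, by positivity, fun j m => ?_,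
    fun j m => ?_, fun j => ?_, fun α x => ?_⟩
  · rw [← NNReal.coe_le_coe, hMcoe]
    exact hM1 j m
  · rw [← NNReal.coe_le_coe, NNReal.coe_pow, NNReal.coe_mul, hMcoe, hMcoe, hMcoe]
    calc (D ^ (m + 1) * Q j (m + 1)) ^ 2 = D ^ (2 * m + 2) * Q j (m + 1) ^ 2 := by ring
      _ ≤ D ^ (2 * m + 2) * (Q j m * Q j (m + 2)) :=
          mul_le_mul_of_nonneg_left (supGrowth_sq_le hv0 hv1 (hb j) (hn j) m) (by positivity)
      _ = _ := by ring
  · rw [rootSeriesDiverges_iff fun m => by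
      rw [← NNReal.coe_pos, hMcoe]; exact zero_lt_one.trans_le (hM1 j m)]
    simp only [hMcoe]
    exact not_summable_supGrowth (hy0 j) hv0 hv1 (hb j) (not_summable_supMoment hw j hB1) (hn j)
      (zero_lt_one.trans_le hD)
  · simp only [hMcoe]
    -- One factor `ρ` goes to each coordinate, which decouples the product; for `n = 0` the required
    -- `v ≤ ρ^n` is just `v ≤ 1`.
    set ρ : ℝ := v x ^ (1 / (n : ℝ)) with hρ
    have hρ0 : 0 ≤ ρ := Real.rpow_nonneg (hv0 x) _
    have hvρ : v x ≤ ρ ^ n := by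
      rcases Nat.eq_zero_or_pos n with h0 | h0
      · simpa [h0] using hv1 x
      · rw [hρ, one_div, Real.rpow_inv_natCast_pow (hv0 x) h0.ne']
    have hw' : w x = B * v x := by rw [hv]; field_simp
    have hfac : ∀ j, (1 + (α j : ℝ)) ^ N * ((1 + |x j| ^ α j) * ρ) ≤
        2 * (D ^ α j * Q j (α j)) := by
      intro j
      have h1 : (1 + (α j : ℝ)) ^ N ≤ D ^ α j := by
        rw [hDdef, ← pow_mul, mul_comm, pow_mul]
        refine pow_le_pow_left₀ (by positivity) ?_ _
        have : α j + 1 ≤ 2 ^ α j := Nat.lt_two_pow_self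
        rw [add_comm]
        exact_mod_cast this
      have h2 : 1 + |x j| ^ α j ≤ 2 * max 1 |x j| ^ α j := by
        have h3 : 1 ≤ max 1 |x j| ^ α j := one_le_pow₀ (le_max_left _ _)
        have h4 : |x j| ^ α j ≤ max 1 |x j| ^ α j :=
          pow_le_pow_left₀ (abs_nonneg _) (le_max_right _ _) _
        linarith
      have h5 := le_supGrowth hv0 hv1 (hb j) (hn j) (α j) x
      have h6 : (1 + |x j| ^ α j) * ρ ≤ 2 * Q j (α j) := by
        calc (1 + |x j| ^ α j) * ρ ≤ 2 * max 1 |x j| ^ α j * ρ :=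
              mul_le_mul_of_nonneg_right h2 hρ0
          _ = 2 * (max 1 |x j| ^ α j * ρ) := by ring
          _ ≤ _ := mul_le_mul_of_nonneg_left h5 zero_le_two
      calc (1 + (α j : ℝ)) ^ N * ((1 + |x j| ^ α j) * ρ) ≤ D ^ α j * (2 * Q j (α j)) :=
            mul_le_mul h1 h6 (by positivity) (by positivity)
        _ = _ := by ring
    calc (∏ j, (1 + (α j : ℝ)) ^ N) * ((∏ j, (1 + |x j| ^ α j)) * w x)
        ≤ (∏ j, (1 + (α j : ℝ)) ^ N) * ((∏ j, (1 + |x j| ^ α j)) * (B * ρ ^ n)) := by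
          rw [hw']
          gcongr
      _ = B * ∏ j, (1 + (α j : ℝ)) ^ N * ((1 + |x j| ^ α j) * ρ) := by
          rw [Finset.prod_mul_distrib, Finset.prod_mul_distrib (f := fun j => 1 + |x j| ^ α j),
            Finset.prod_const, Finset.card_univ, Fintype.card_fin]
          ring
      _ ≤ B * ∏ j, 2 * (D ^ α j * Q j (α j)) := by
          refine mul_le_mul_of_nonneg_left (Finset.prod_le_prod (fun j _ => by positivity)
            fun j _ => hfac j) hBpos.le
      _ = _ := by
          rw [Finset.prod_mul_distrib, Finset.prod_const, Finset.card_univ, Fintype.card_fin]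
          ring

end WeightSequences

/-! ### Quasi-analyticity in several variables -/

section SeveralVariables

variable {n : ℕ}

/-- The Denjoy–Carleman theorem for several variables, applied one coordinate at a time. -/
theorem eq_zero_of_quasiAnalytic {G : MultiIndex n → RSpace n → ℂ}
    (hG : ∀ α j l, HasLineDerivAt ℝ (G α) (G (raise α j) l) l (EuclideanSpace.single j (1 : ℝ)))
    {M : Fin n → ℕ → ℝ} (hM1 : ∀ j m, 1 ≤ M j m)
    (hlc : ∀ j m, M j (m + 1) ^ 2 ≤ M j m * M j (m + 2))
    (hdiv : ∀ j, ¬ Summable fun m : ℕ => M j (m + 1) ^ (-(1 / ((m : ℝ) + 1))))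
    {C : ℝ} (hC : 0 ≤ C) {N : ℕ}
    (hb : ∀ α l, ‖G α l‖ ≤ C * (1 + ‖l‖) ^ N * ∏ j, M j (α j))
    {l₀ : RSpace n} (h0 : ∀ α, G α l₀ = 0) (α : MultiIndex n) (l : RSpace n) : G α l = 0 := by
  have hMpos : ∀ j m, 0 < M j m := fun j m => zero_lt_one.trans_le (hM1 j m)
  -- `s` is the set of coordinates in which `l` may differ from `l₀`. Vanishing for all `α` at once
  -- is what provides vanishing of all derivatives along the next coordinate line.
  have key : ∀ s : Finset (Fin n), ∀ l : RSpace n, (∀ j ∉ s, l j = l₀ j) → ∀ α, G α l = 0 := by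
    intro s
    induction s using Finset.induction_on with
    | empty =>
      intro l hl α
      have : l = l₀ := by ext j; exact hl j (Finset.notMem_empty j)
      rw [this, h0]
    | insert j s hj ih =>
      intro l hl α
      set e : RSpace n := EuclideanSpace.single j (1 : ℝ) with he
      set l' : RSpace n := l + (l₀ j - l j) • e with hl'
      have hl'0 : ∀ α, G α l' = 0 := ih l' fun i hi => by
        by_cases hij : i = j
        · subst hij; simp [hl', he]
        · rw [← hl i (by simp [hij, hi])]
          simp [hl', he, hij]
      have hmain := eq_zero_of_local_bounds (M := M j) (hMpos j) (hlc j)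
        (not_summable_ratio (hMpos j) (hM1 j 0) (hdiv j))
        (g := fun m t => G (Function.update α j m) (l' + t • e)) (fun m t => ?_) (fun R => ?_)
        (a := 0) (fun m => by simp [hl'0]) (α j) (l j - l₀ j)
      · have hll : l' + (l j - l₀ j) • e = l := by
          rw [hl', add_assoc, ← add_smul]; simp
        simpa [hll] using hmain
      · have h1 := hG (Function.update α j m) j (l' + t • e)
        have hr : raise (Function.update α j m) j = Function.update α j (m + 1) := by
          simp [raise]
        rw [hr] at h1
        have h2 : HasDerivAt (fun s : ℝ => G (Function.update α j m) (l' + t • e + s • e))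
            (G (Function.update α j (m + 1)) (l' + t • e)) (t - t) := by
          rw [sub_self]; exact h1
        have h3 := h2.comp_sub_const t t
        convert! h3 using 1
        funext s
        congr 1
        rw [add_assoc l', ← add_smul, add_sub_cancel]
      -- On `|t| ≤ R` the polynomial factor is bounded, and the other coordinates contribute a
      -- constant independent of `m`.
      · refine ⟨C * (1 + (‖l'‖ + R)) ^ N * ∏ k ∈ Finset.univ.erase j, M k (α k),
          fun m t ht => (hb _ _).trans ?_⟩
        have hprod : ∏ k, M k (Function.update α j m k) =
            M j m * ∏ k ∈ Finset.univ.erase j, M k (α k) := by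
          rw [← Finset.mul_prod_erase _ _ (Finset.mem_univ j), Function.update_self]
          congr 1
          exact Finset.prod_congr rfl fun k hk => by
            rw [Function.update_of_ne (Finset.ne_of_mem_erase hk)]
        have hnorm : ‖l' + t • e‖ ≤ ‖l'‖ + R := by
          refine (norm_add_le _ _).trans (add_le_add_right ?_ _)
          rw [norm_smul, he, PiLp.norm_single]
          simpa using ht
        have hp0 : 0 ≤ ∏ k ∈ Finset.univ.erase j, M k (α k) :=
          Finset.prod_nonneg fun k _ => (hMpos _ _).le
        have hm0 := (hMpos j m).le
        rw [hprod]
        calc C * (1 + ‖l' + t • e‖) ^ N * (M j m * ∏ k ∈ Finset.univ.erase j, M k (α k))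
            ≤ C * (1 + (‖l'‖ + R)) ^ N * (M j m * ∏ k ∈ Finset.univ.erase j, M k (α k)) := by
              gcongr
          _ = _ := by ring
  exact key Finset.univ l (fun j hj => absurd (Finset.mem_univ j) hj) α

end SeveralVariables

/-! ### Properties of the transform -/

section Main

variable {n : ℕ}

theorem neg_I_smul_rePart_le (l : RSpace n) : ‖rePart (-Complex.I • toC l)‖ ≤ 0 := by
  rw [rePart_neg_I_smul, imPart_toC, norm_zero]

theorem norm_neg_I_smul (l : CSpace n) : ‖-Complex.I • l‖ = ‖l‖ := by
  rw [norm_smul, norm_neg, Complex.norm_I, one_mul]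

theorem enorm_neg_I_pow (k : ℕ) : ‖(-Complex.I) ^ k‖ₑ = 1 := by
  rw [enorm_pow, enorm_neg, ← ofReal_norm, Complex.norm_I, ENNReal.ofReal_one, one_pow]

theorem fourierConst_pos (n : ℕ) : 0 < ‖fourierConst n‖ := by
  rw [norm_pos_iff, fourierConst, Complex.ofReal_ne_zero]
  positivity

theorem transform_eq {w : Weight n} (T : CwDual w) {α : MultiIndex n} {l : CSpace n}
    (h : monoExp α (-Complex.I • l) ∈ cwSubmodule w) :
    transform T α l = fourierConst n * (-Complex.I) ^ order α * T (Cw.mk _ h) := by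
  rw [transform, evalMono_eq T h]

theorem exists_transform_eq_expFun {w : Weight n} (T : CwDual w) {l : CSpace n}
    (h : monoExp 0 (-Complex.I • l) ∈ cwSubmodule w) :
    ∃ h : expFun (-Complex.I • l) ∈ cwSubmodule w,
      transform T 0 l = fourierConst n * T (Cw.mk _ h) := by
  have key : ∀ f : RSpace n → ℂ, monoExp 0 (-Complex.I • l) = f → ∃ h : f ∈ cwSubmodule w,
      transform T 0 l = fourierConst n * T (Cw.mk _ h) := by
    rintro _ rfl
    exact ⟨h, by rw [transform_eq T h]; simp [order]⟩
  exact key _ (monoExp_zero _)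

theorem exists_enorm_transform_le {w : Weight n} (T : CwDual w) :
    ∃ C : ℝ, 0 < C ∧ ∀ (α : MultiIndex n) (l : CSpace n), ‖transform T α l‖ₑ ≤
      ENNReal.ofReal (C * (1 + ‖l‖) ^ dualOrder T * ∏ j, (1 + (α j : ℝ)) ^ dualOrder T) *
        supNorm (fun x : RSpace n => (∏ j, (1 + |x j| ^ α j)) *
          Real.exp (inner ℝ (imPart l) x) * w x) := by
  obtain ⟨C, hC0, hC⟩ := exists_enorm_evalMono_le T
  refine ⟨‖fourierConst n‖ * C, mul_pos (fourierConst_pos n) hC0, fun α l => ?_⟩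
  have h1 := hC α (-Complex.I • l)
  rw [norm_neg_I_smul, rePart_neg_I_smul] at h1
  rw [transform, enorm_mul, enorm_mul, enorm_neg_I_pow, mul_one, mul_assoc ‖fourierConst n‖,
    mul_assoc ‖fourierConst n‖, ENNReal.ofReal_mul (norm_nonneg _), ofReal_norm,
    mul_assoc ‖fourierConst n‖ₑ]
  gcongr

theorem exists_enorm_transform_real_le {w : Weight n} (T : CwDual w) :
    ∃ C : ℝ, 0 < C ∧ ∀ (α : MultiIndex n) (l : RSpace n), ‖transform T α (toC l)‖ₑ ≤
      ENNReal.ofReal (C * (1 + ‖l‖) ^ dualOrder T * ∏ j, (1 + (α j : ℝ)) ^ dualOrder T) *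
        supNorm (fun x : RSpace n => (∏ j, (1 + |x j| ^ α j)) * w x) := by
  obtain ⟨C, hC0, hC⟩ := exists_enorm_transform_le T
  refine ⟨C, hC0, fun α l => ?_⟩
  have h1 := hC α (toC l)
  rw [norm_toC, imPart_toC] at h1
  simpa using h1

theorem contDiff_transform {w : Weight n} (T : CwDual w) {d : ℕ∞} (hw : w.InClass d) :
    ContDiff ℝ (d : ℕ∞ω) fun l => transform T 0 (toC l) := by
  refine contDiff_iff_forall_nat_le.mpr fun m hm => ?_
  exact contDiff_transform_real T (hw.decaysExp (k := m) hm) m (by simp [order])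

theorem multiD_transform {w : Weight n} (T : CwDual w) {d : ℕ∞} (hw : w.InClass d)
    {α : MultiIndex n} (hα : (order α : ℕ∞) ≤ d) (l : RSpace n) :
    multiD ℝ α (fun l => transform T 0 (toC l)) l = transform T α (toC l) :=
  multiD_eq_of_hasLineDerivAt (H := fun α l => transform T α (toC l)) isOpen_univ
    (fun _ j hβ l _ => hasLineDerivAt_transform_real T (hw.decaysExp hβ) le_rfl j l) hα
    (Set.mem_univ l)

/-- The transform as a continuous function. -/
noncomputable def transformMap {w : Weight n} (h : w.DecaysExp 0 0) (T : CwDual w) :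
    C(RSpace n, ℂ) :=
  ⟨fun l => transform T 0 (toC l), continuous_transform_real T h (by simp [order])⟩

/-- The function `T̂` determines `T` on the image of the Schwartz Fourier transform, which is the
whole Schwartz space. -/
theorem transformMap_injective {w : Weight n} (h : w.DecaysExp 0 0) :
    Function.Injective (transformMap h) := by
  intro T₁ T₂ hT
  refine toTempered_injective w ?_
  ext f
  obtain ⟨g, rfl⟩ := schwartzFourier_surjective n f
  have h1 := (isRepresentedBy_transform T₁ h g).2
  have h2 := (isRepresentedBy_transform T₂ h g).2
  have h3 : (fun l => transform T₁ 0 (toC l)) = fun l => transform T₂ 0 (toC l) :=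
    congrArg (fun F : C(RSpace n, ℂ) => (F : RSpace n → ℂ)) hT
  rw [temperedFourier_apply] at h1 h2
  rw [h1, h2]
  simp only [congrFun h3 _]

theorem continuous_norm_imPart : Continuous fun l : CSpace n => ‖imPart l‖ := by
  unfold imPart
  fun_prop

/-- Choosing `r` strictly between `‖Im λ‖` and an admissible `ε` leaves `e^{-(ε-r)‖x‖}` to beat
every polynomial, and leaves room for a neighbourhood of `λ`. -/
theorem exists_decaysExp_of_mem_tube {w : Weight n} {l : CSpace n} (hl : l ∈ tube w) :
    ∃ r : ℝ, ‖imPart l‖ < r ∧ ∀ k, w.DecaysExp k r := by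
  simp only [tube, Weight.tau, Set.mem_ofPred_eq, lt_iSup_iff] at hl
  obtain ⟨ε, ⟨hε, C, hC0, hC⟩, hlε⟩ := hl
  rw [ENNReal.ofReal_lt_ofReal_iff hε] at hlε
  obtain ⟨r, hr, hrε⟩ := exists_between hlε
  refine ⟨r, hr, fun k => ?_⟩
  have hlim : Filter.Tendsto (fun t : ℝ => C * (t ^ k * Real.exp (-(ε - r) * t)))
      Filter.atTop (𝓝 0) := by
    simpa using
      (tendsto_rpow_mul_exp_neg_mul_atTop_nhds_zero k _ (sub_pos.mpr hrε)).const_mul C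
  refine squeeze_zero' (Filter.Eventually.of_forall fun x => ?_) ?_
    (hlim.comp tendsto_norm_cobounded_atTop)
  · have := w.nonneg x
    positivity
  · filter_upwards [tendsto_norm_cobounded_atTop.eventually_ge_atTop 1] with x hx
    rw [max_eq_right hx]
    calc ‖x‖ ^ k * Real.exp (r * ‖x‖) * w x
        ≤ ‖x‖ ^ k * Real.exp (r * ‖x‖) * (C * Real.exp (-ε * ‖x‖)) :=
          mul_le_mul_of_nonneg_left (hC x) (by positivity)
      _ = C * (‖x‖ ^ k * (Real.exp (r * ‖x‖) * Real.exp (-ε * ‖x‖))) := by ring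
      _ = _ := by
          rw [← Real.exp_add, Function.comp]
          congr 3
          ring

theorem isOpen_tube (w : Weight n) : IsOpen (tube w) :=
  isOpen_lt (ENNReal.continuous_ofReal.comp continuous_norm_imPart) continuous_const

theorem toC_mem_tube {w : Weight n} (hw : w.IsHolomorphic) (l : RSpace n) : toC l ∈ tube w := by
  obtain ⟨ε, hε, h⟩ := hw
  have h1 : ENNReal.ofReal ε ≤ w.tau :=
    le_iSup₂_of_le (f := fun (ε : ℝ) (_ : ε ∈ {ε : ℝ | 0 < ε ∧ w.ExpBound ε}) =>
      ENNReal.ofReal ε) ε ⟨hε, h⟩ le_rfl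
  change ENNReal.ofReal ‖imPart (toC l)‖ < w.tau
  rw [imPart_toC, norm_zero, ENNReal.ofReal_zero]
  exact (ENNReal.ofReal_pos.mpr hε).trans_le h1

theorem monoExp_mem_of_mem_tube {w : Weight n} {l : CSpace n} (hl : l ∈ tube w)
    (α : MultiIndex n) : monoExp α (-Complex.I • l) ∈ cwSubmodule w := by
  obtain ⟨r, hr, h⟩ := exists_decaysExp_of_mem_tube hl
  exact monoExp_mem (h (order α)) le_rfl (by rw [rePart_neg_I_smul]; exact hr.le)

theorem eventually_norm_imPart_le {l : CSpace n} {r : ℝ} (hr : ‖imPart l‖ < r) :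
    ∀ᶠ v in 𝓝 l, ‖imPart v‖ ≤ r :=
  (continuous_norm_imPart.continuousAt.eventually_lt_const hr).mono fun _ h => h.le

theorem differentiableOn_transform {w : Weight n} (T : CwDual w) :
    DifferentiableOn ℂ (transform T 0) (tube w) := by
  intro l hl
  obtain ⟨r, hr, h⟩ := exists_decaysExp_of_mem_tube hl
  exact (hasFDerivAt_transform_complex T (h _) le_rfl
    (eventually_norm_imPart_le hr)).differentiableAt.differentiableWithinAt

theorem multiD_transform_complex {w : Weight n} (T : CwDual w) (α : MultiIndex n) {l : CSpace n}
    (hl : l ∈ tube w) : multiD ℂ α (transform T 0) l = transform T α l := by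
  refine multiD_eq_of_hasLineDerivAt (H := fun α => transform T α) (d := ⊤) (isOpen_tube w)
    (fun β j _ l hl => ?_) le_top hl
  obtain ⟨r, hr, h⟩ := exists_decaysExp_of_mem_tube hl
  exact hasLineDerivAt_transform_complex T (h _) le_rfl j (eventually_norm_imPart_le hr)

theorem exists_quasiAnalytic_bound {w : Weight n} (hw : w.IsStandardQuasiAnalytic)
    (T : CwDual w) : ∃ (C : ℝ) (M : Fin n → ℕ → ℝ≥0), 0 < C ∧ (∀ j m, 1 ≤ M j m) ∧
      (∀ j m, M j (m + 1) ^ 2 ≤ M j m * M j (m + 2)) ∧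
      (∀ j, RootSeriesDiverges fun m => (M j m : ℝ≥0∞)) ∧
      ∀ (α : MultiIndex n) (l : RSpace n), ‖transform T α (toC l)‖ ≤
        C * (1 + ‖l‖) ^ dualOrder T * ∏ j, (M j (α j) : ℝ) := by
  obtain ⟨C₁, hC₁, h1⟩ := exists_enorm_transform_real_le T
  obtain ⟨C₂, M, hC₂, hM1, hlc, hdiv, h2⟩ := exists_majorant hw (dualOrder T)
  refine ⟨C₁ * C₂, M, mul_pos hC₁ hC₂, hM1, hlc, hdiv, fun α l => ?_⟩
  set P := ∏ j, (1 + (α j : ℝ)) ^ dualOrder T with hP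
  have hP0 : 0 < P := Finset.prod_pos fun _ _ => by positivity
  have hsup : supNorm (fun x : RSpace n => (∏ j, (1 + |x j| ^ α j)) * w x) ≤
      ENNReal.ofReal (C₂ * (∏ j, (M j (α j) : ℝ)) / P) := by
    refine iSup_le fun x => ?_
    have h3 : 0 ≤ (∏ j, (1 + |x j| ^ α j)) * w x :=
      mul_nonneg (Finset.prod_nonneg fun _ _ => by positivity) (w.nonneg x)
    rw [Real.enorm_eq_ofReal h3]
    refine ENNReal.ofReal_le_ofReal ((le_div_iff₀' hP0).mpr (h2 α x))
  have h4 : ‖transform T α (toC l)‖ₑ ≤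
      ENNReal.ofReal (C₁ * C₂ * (1 + ‖l‖) ^ dualOrder T * ∏ j, (M j (α j) : ℝ)) := by
    refine (h1 α l).trans ((mul_le_mul_right hsup _).trans (le_of_eq ?_))
    rw [← ENNReal.ofReal_mul (by positivity)]
    congr 1
    field_simp
    rw [mul_comm]
  rw [← ofReal_norm] at h4
  refine (ENNReal.ofReal_le_ofReal_iff ?_).mp h4
  exact mul_nonneg (by positivity) (Finset.prod_nonneg fun _ _ => NNReal.coe_nonneg _)

theorem transform_eq_zero_of_quasiAnalytic {w : Weight n} (hw : w.IsStandardQuasiAnalytic)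
    (T : CwDual w) {l₀ : RSpace n} (h0 : ∀ α, transform T α (toC l₀) = 0) (α : MultiIndex n)
    (l : RSpace n) : transform T α (toC l) = 0 := by
  obtain ⟨C, M, hC, hM1, hlc, hdiv, hb⟩ := exists_quasiAnalytic_bound hw T
  refine eq_zero_of_quasiAnalytic (G := fun α l => transform T α (toC l))
    (M := fun j m => (M j m : ℝ))
    (fun α j l => hasLineDerivAt_transform_real T
      (hw.inClass_top.decaysExp (k := order α + 1) le_top) le_rfl j l)
    (fun j m => by exact_mod_cast hM1 j m) (fun j m => by exact_mod_cast hlc j m)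
    (fun j => (rootSeriesDiverges_iff fun m => zero_lt_one.trans_le (hM1 j m)).mp (hdiv j))
    hC.le hb h0 α l

end Main

end WeightedFourier

/-! ### The theorem. -/

open WeightedFourier in
theorem theorem4p7 (n : ℕ) (d : ℕ∞) (w : Weight n) (hw : w.InClass d) :
    -- the natural map into the tempered distributions, and the map `T ↦ T̂`
    ∃ (ι : CwDual w →ₗ[ℂ] 𝓢'(RSpace n, ℂ)) (F : CwDual w → C(RSpace n, ℂ)),
      (∀ (T : CwDual w) (f : 𝓢(RSpace n, ℂ)),
        ∃ h : (f : RSpace n → ℂ) ∈ cwSubmodule w, ι T f = T (Cw.mk f h)) ∧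
      Function.Injective ι ∧
      (∀ T : CwDual w, distOrder (ι T) ≤ (dualOrder T : ℕ∞)) ∧
      Function.Injective F ∧
      ∀ T : CwDual w,
        -- the Fourier transform of `T` is the function `T̂`
        IsRepresentedBy (temperedFourier (ι T)) (F T) ∧
        (∀ l : RSpace n, ∃ h : expFun (-Complex.I • toC l) ∈ cwSubmodule w,
          F T l = fourierConst n * T (Cw.mk _ h)) ∧
        -- regularity and derivatives
        ContDiff ℝ (d : ℕ∞ω) (F T) ∧
        (∀ α : MultiIndex n, (order α : ℕ∞) ≤ d → ∀ l : RSpace n,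
          ∃ h : monoExp α (-Complex.I • toC l) ∈ cwSubmodule w,
            multiD ℝ α (F T) l =
              fourierConst n * (-Complex.I) ^ order α * T (Cw.mk _ h)) ∧
        -- bounds
        (∃ C : ℝ, 0 < C ∧ ∀ α : MultiIndex n, (order α : ℕ∞) ≤ d → ∀ l : RSpace n,
          ‖multiD ℝ α (F T) l‖ₑ ≤
            ENNReal.ofReal (C * (1 + ‖l‖) ^ dualOrder T *
              ∏ j, (1 + (α j : ℝ)) ^ dualOrder T) *
            supNorm (fun x : RSpace n => (∏ j, (1 + |x j| ^ α j)) * w x)) ∧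
        -- holomorphic weights
        (w.IsHolomorphic → ∃ G : CSpace n → ℂ,
          DifferentiableOn ℂ G (tube w) ∧
          (∀ l : RSpace n, toC l ∈ tube w ∧ G (toC l) = F T l) ∧
          (∀ l ∈ tube w, ∃ h : expFun (-Complex.I • l) ∈ cwSubmodule w,
            G l = fourierConst n * T (Cw.mk _ h)) ∧
          (∀ α : MultiIndex n, ∀ l ∈ tube w,
            ∃ h : monoExp α (-Complex.I • l) ∈ cwSubmodule w,
              multiD ℂ α G l =
                fourierConst n * (-Complex.I) ^ order α * T (Cw.mk _ h)) ∧
          ∃ C : ℝ, 0 < C ∧ ∀ α : MultiIndex n, ∀ l ∈ tube w,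
            ‖multiD ℂ α G l‖ₑ ≤
              ENNReal.ofReal (C * (1 + ‖l‖) ^ dualOrder T *
                ∏ j, (1 + (α j : ℝ)) ^ dualOrder T) *
              supNorm (fun x : RSpace n => (∏ j, (1 + |x j| ^ α j)) *
                Real.exp (inner ℝ (imPart l) x) * w x)) ∧
        -- standard quasi-analytic weights
        (w.IsStandardQuasiAnalytic →
          ContDiff ℝ ∞ (F T) ∧
          (∃ (C : ℝ) (M : Fin n → ℕ → ℝ≥0), 0 < C ∧
            (∀ j, RootSeriesDiverges (fun m => (M j m : ℝ≥0∞))) ∧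
            ∀ (l : RSpace n) (α : MultiIndex n),
              ‖multiD ℝ α (F T) l‖ ≤
                C * (1 + ‖l‖) ^ dualOrder T * ∏ j, (M j (α j) : ℝ)) ∧
          ((∃ l₀ : RSpace n, ∀ α : MultiIndex n, multiD ℝ α (F T) l₀ = 0) → T = 0)) := by
  classical
  have h00 : w.DecaysExp 0 0 := hw.decaysExp (k := 0) (by simp)
  have hF : ∀ T : CwDual w, (transformMap h00 T : RSpace n → ℂ) =
      fun l => transform T 0 (toC l) := fun _ => rfl
  refine ⟨toTempered w, transformMap h00, fun T f => ⟨schwartz_mem_cwSubmodule w f, rfl⟩,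
    toTempered_injective w, distOrder_toTempered_le, transformMap_injective h00, fun T => ?_⟩
  simp only [hF]
  refine ⟨isRepresentedBy_transform T h00, fun l => ?_, contDiff_transform T hw,
    fun α hα l => ?_, ?_, fun hol => ?_, fun hqa => ?_⟩
  · exact exists_transform_eq_expFun T
      (monoExp_mem h00 (by simp [order]) (neg_I_smul_rePart_le l))
  · have h := monoExp_mem (hw.decaysExp hα) le_rfl (neg_I_smul_rePart_le l)
    exact ⟨h, by rw [multiD_transform T hw hα, transform_eq T h]⟩
  · obtain ⟨C, hC0, hC⟩ := exists_enorm_transform_real_le T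
    exact ⟨C, hC0, fun α hα l => by rw [multiD_transform T hw hα]; exact hC α l⟩
  · refine ⟨transform T 0, differentiableOn_transform T, fun l => ⟨toC_mem_tube hol l, rfl⟩,
      fun l hl => exists_transform_eq_expFun T (monoExp_mem_of_mem_tube hl 0), fun α l hl => ?_, ?_⟩
    · exact ⟨monoExp_mem_of_mem_tube hl α, by
        rw [multiD_transform_complex T α hl, transform_eq T (monoExp_mem_of_mem_tube hl α)]⟩
    · obtain ⟨C, hC0, hC⟩ := exists_enorm_transform_le T
      exact ⟨C, hC0, fun α l hl => by rw [multiD_transform_complex T α hl]; exact hC α l⟩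
  · have htop := hqa.inClass_top
    refine ⟨contDiff_transform T htop, ?_, ?_⟩
    · obtain ⟨C, M, hC, -, -, hdiv, hb⟩ := exists_quasiAnalytic_bound hqa T
      exact ⟨C, M, hC, hdiv, fun l α => by rw [multiD_transform T htop le_top]; exact hb α l⟩
    · rintro ⟨l₀, h0⟩
      -- Quasi-analyticity gives `T̂ = 0` everywhere, so `T` and `0` have the same transform.
      refine transformMap_injective h00 ?_
      ext l
      change transform T 0 (toC l) = transform 0 0 (toC l)
      rw [transform_eq_zero_of_quasiAnalytic hqa T (l₀ := l₀) fun α => by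
        rw [← multiD_transform T htop le_top, h0]]
      simp [transform, evalMono]
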